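/- **Model.** Let $n\in\mathbb N$, $\gamma\ge 2$, $\alpha=(\gamma-1)/2$, $C\in\mathbb R$ and $R=2\ln n+C$. A random hyperbolic graph has $n$ vertices, placed independently at points with polar coordinates $(r,\theta)$, $\theta$ uniform modulo $2\pi$ and $r\in[0,R)$ with density $\alpha\sinh(\alpha r)/(\cosh(\alpha R)-1)$. Two distinct vertices are adjacent iff their hyperbolic distance $\operatorname{arcosh}(\cosh r_u\cosh r_v-\sinh r_u\sinh r_v\cos(\theta_u-\theta_v))$ is below $R$; $m$ is the number of edges. For $\gamma>2$ the constant $C$ controls the average degree, $\bar d\approx\frac2\pi\big(\frac{\alpha}{\alpha-1/2}\big)^2e^{-C/2}$, so an upper bound on $C$ amounts to a positive lower bound on $\bar d$. **Sequential sRHG generator** (with a tuning constant $\kappa\ge1$). Let $k=\lfloor\alpha R/\ln 2\rfloor\ge 1$ and $\ell_i=iR/k$; annulus $i$ consists of the radii in $[\ell_{i-1},\ell_i)$. The annuli with $\ell_i\le R/2$ are merged into one *clique annulus*; the others are *streaming annuli*. For a point of radius $r$ and a radius $b$ put $\Delta\theta(r,b)=\pi$ if $r+b<R$ and $\Delta\theta(r,b)=\arccos\frac{\cosh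 r\cosh b-\cosh R}{\sinh r\sinh b}$ otherwise. The generator draws the numbers of points in the annuli (a multinomial variate), and for each annulus a monotone sequence of uniform angles, together with a radius for each of them. In the clique annulus these are the angles of the points, and the edges between all pairs of its points are emitted. In a streaming annulus with lower boundary $a$ an angle $x$ with radius $r$ marks the beginning of a request, and the point is placed at the angle $x+\Delta\theta(r,a)$. The streaming annuli are processed from the innermost outwards. An annulus with $N$ points is cut into $2^e$ cells of equal width with $\kappa\le N/2^e<2\kappa$ (one cell if $N<\kappa$). Each point of radius $r$ and angle $\theta$ from this annulus, the clique annulus or a lower streaming annulus has one request in the annulus, active in the cells that meet $[\theta-\Delta\theta(r,a),\theta+\Delta\theta(r,a)]$ modulo $2\pi$. Node tokens and begin-of-request tokens are assigned to the cells by integer (bucket) sorting. Then the cells are swept in angular order (followed by a second, final turn which completes the requests reaching beyond the angle $2\pi$): on entering a cell the active requests are scanned and the ended ones dropped, the requests beginning there become active and are passed on to the next annulus, and every point in the cell is compared with every active request; an edge is emitted if the distance is below $R$ and the node of the request has the smaller radius. The time is the number of steps, where a step is $O(1)$ real-RAM operations (elementary functions and drawing a single uniform angle or a radius included), and drawing the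 number of points of an annulus is charged one step more than that number. Steps are booked to four phases: generation of points, clique handling, candidate selection (sorting of request and node tokens, the sweep, maintaining the active requests) and distance checks. **Claim.** The generator runs in time $O(m)$ with probability $1-n^{-c}$ for any constant $c>0$: for all $\gamma\ge2$, $C_0\in\mathbb R$, $\kappa\ge1$ and $c>0$ there are $K>0$ and $n_0$ such that for all $n\ge n_0$ and all $C\le C_0$ with $\alpha R\ge\ln 2$, with probability at least $1-n^{-c}$, the total number of steps is at most $K\cdot m$, and so is, in particular, the number of steps for each of clique handling, candidate selection and distance checks. -/

import Mathlib

open MeasureTheory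

noncomputable section

namespace SRHG

/-! ## The random hyperbolic graph model -/

/-- Parameters of the generator: number of vertices `n`, dispersion `α` (the power-law exponent is
`γ = 1 + 2 α`), disk radius `R`, and the tuning constant `κ` for the number of points per cell. -/
structure Params where
  n : ℕ
  α : ℝ
  R : ℝ
  κ : ℕ

/-- The parameters for `n` vertices, power-law exponent `γ` and radius `R = 2 log n + C`. -/
def rhgParams (n : ℕ) (γ C : ℝ) (κ : ℕ) : Params where
  n := n
  α := (γ - 1) / 2
  R := 2 * Real.log n + C
  κ := κ

/-- Radial density `f(r) = α sinh(α r) / (cosh(α R) - 1)`. -/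
def radialDensity (α R r : ℝ) : ℝ :=
  α * Real.sinh (α * r) / (Real.cosh (α * R) - 1)

/-- The law of a radius: density `f` on `[0, R)`. -/
def radialLaw (α R : ℝ) : Measure ℝ :=
  (volume.restrict (Set.Ico 0 R)).withDensity fun r => ENNReal.ofReal (radialDensity α R r)

/-- The uniform law on the angles `[0, 2π)`. -/
def angleLaw : Measure ℝ :=
  ProbabilityTheory.cond volume (Set.Ico 0 (2 * Real.pi))

/-- The random variates consumed by the generator: one uniform angle and one radius for each of the
`n` vertices, all independent. -/
def sampleLaw (p : Params) : Measure (Fin p.n → ℝ × ℝ) :=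
  Measure.pi fun _ => angleLaw.prod (radialLaw p.α p.R)

/-- The density is normalised. -/
theorem isProbabilityMeasure_radialLaw {α R : ℝ} (hα : 0 < α) (hR : 0 < R) :
    IsProbabilityMeasure (radialLaw α R) := by
  have hpos : 0 < Real.cosh (α * R) - 1 := by
    have := Real.one_lt_cosh.2 (mul_pos hα hR).ne'
    linarith
  have hcont : Continuous (radialDensity α R) := by
    unfold radialDensity
    fun_prop
  have hint : ∫ r in (0 : ℝ)..R, radialDensity α R r = 1 := by
    have hd : ∀ r ∈ Set.uIcc 0 R, HasDerivAt
        (fun r => Real.cosh (α * r) / (Real.cosh (α * R) - 1)) (radialDensity α R r) r := by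
      intro r _
      have h := (((hasDerivAt_id r).const_mul α).cosh).div_const (Real.cosh (α * R) - 1)
      simpa [radialDensity, mul_comm] using h
    rw [intervalIntegral.integral_eq_sub_of_hasDerivAt hd (hcont.intervalIntegrable _ _)]
    rw [← sub_div]
    simpa using div_self hpos.ne'
  constructor
  rw [radialLaw, withDensity_apply _ MeasurableSet.univ, Measure.restrict_univ,
    restrict_Ico_eq_restrict_Ioc, ← ofReal_integral_eq_lintegral_ofReal,
    ← intervalIntegral.integral_of_le hR.le, hint, ENNReal.ofReal_one]
  · exact (hcont.intervalIntegrable 0 R).1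
  · filter_upwards [ae_restrict_mem measurableSet_Ioc] with r hr
    have : 0 ≤ Real.sinh (α * r) := Real.sinh_nonneg_iff.2 (mul_pos hα hr.1).le
    exact div_nonneg (mul_nonneg hα.le this) hpos.le

/-- A placed point of the hyperbolic plane, with the vertex it represents. Angles are meant modulo
`2π`. -/
structure Node (n : ℕ) where
  id : Fin n
  θ : ℝ
  r : ℝ

/-- Hyperbolic distance in polar coordinates. -/
def hypDist {n : ℕ} (u v : Node n) : ℝ :=
  Real.arcosh (Real.cosh u.r * Real.cosh v.r -
    Real.sinh u.r * Real.sinh v.r * Real.cos (u.θ - v.θ))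

/-- Largest angular deviation at which a point of radius `r` can reach a point of radius `b`. -/
def deltaTheta (R r b : ℝ) : ℝ :=
  if r + b < R then Real.pi
  else Real.arccos
    ((Real.cosh r * Real.cosh b - Real.cosh R) / (Real.sinh r * Real.sinh b))

/-! ## Decomposition into annuli -/

/-- Number `k = ⌊α R / ln 2⌋` of annuli. -/
def numAnnuli (p : Params) : ℕ := ⌊p.α * p.R / Real.log 2⌋₊

/-- Radial boundaries `ℓ_i = i R / k`; annulus `j` (counted from `0`) is `[ℓ_j, ℓ_{j+1})`. -/
def boundary (p : Params) (i : ℕ) : ℝ := i * p.R / numAnnuli p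

/-- The number of annuli that are merged into the clique annulus: those with `ℓ_{j+1} ≤ R / 2`. -/
def numCliqueAnnuli (p : Params) : ℕ := numAnnuli p / 2

/-- The clique annulus is `[0, cliqueRadius)`. -/
def cliqueRadius (p : Params) : ℝ := boundary p (numCliqueAnnuli p)

/-- The lower radial boundary of the annulus that contains the radius `r`. -/
def lowerBoundary (p : Params) (r : ℝ) : ℝ := boundary p ⌊r * numAnnuli p / p.R⌋₊

/-- The placed point of a vertex with variates `(x, r)`. In the clique annulus `x` is its angle. In
the other annuli `x` is where its request begins, and the point lies `Δθ` further. -/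
def nodeOf (p : Params) (ω : Fin p.n → ℝ × ℝ) (v : Fin p.n) : Node p.n where
  id := v
  θ := if (ω v).2 < cliqueRadius p then (ω v).1
    else (ω v).1 + deltaTheta p.R (ω v).2 (lowerBoundary p (ω v).2)
  r := (ω v).2

/-- The random hyperbolic graph on the placed points: adjacency is hyperbolic distance below `R`. -/
def hyperbolicGraph (p : Params) (ω : Fin p.n → ℝ × ℝ) : SimpleGraph (Fin p.n) where
  Adj u v := u ≠ v ∧ hypDist (nodeOf p ω u) (nodeOf p ω v) < p.R
  symm := ⟨fun u v h => ⟨h.1.symm, by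
    have h2 := h.2
    unfold hypDist at h2 ⊢
    rw [← Real.cos_neg, neg_sub, mul_comm (Real.cosh _), mul_comm (Real.sinh _)]
    exact h2⟩⟩
  loopless := ⟨fun _ h => h.1 rfl⟩

/-- The number `m` of edges of the graph. -/
def numEdges (p : Params) (ω : Fin p.n → ℝ × ℝ) : ℕ := (hyperbolicGraph p ω).edgeSet.ncard

/-! ## Programs with a step count

One step is a bounded number of operations of a real RAM: arithmetic, floor, comparison and the
elementary functions on reals, reading or writing one array or list entry, drawing one uniform
angle or one radius, emitting one edge. Each step is booked to a phase of the generator. -/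

/-- Phases of the generator to which steps are booked. -/
inductive Phase
  | generation
  | clique
  | selection
  | check
  deriving DecidableEq

/-- A finished computation: returned value, steps taken in each phase, emitted edges. -/
structure Prog (n : ℕ) (β : Type) where
  val : β
  steps : Phase → ℕ
  out : List (Fin n × Fin n)

instance (n : ℕ) : Monad (Prog n) where
  pure a := ⟨a, fun _ => 0, []⟩
  bind x f := ⟨(f x.val).val, fun φ => x.steps φ + (f x.val).steps φ, x.out ++ (f x.val).out⟩

/-- Spend `k` steps in phase `φ`. -/
def tick {n : ℕ} (φ : Phase) (k : ℕ) : Prog n Unit :=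
  ⟨(), fun ψ => if ψ = φ then k else 0, []⟩

/-- Emit the edge `{u, v}`; the steps are booked by the caller. -/
def emit {n : ℕ} (u v : Fin n) : Prog n Unit := ⟨(), fun _ => 0, [(u, v)]⟩

/-- Total number of steps. -/
def Prog.time {n : ℕ} {β : Type} (x : Prog n β) : ℕ :=
  x.steps .generation + x.steps .clique + x.steps .selection + x.steps .check

/-! ## The generator -/

open Classical in
/-- Draw the points with radius in `[a, b)`: their number, then a monotone sequence of uniform
variates with a radius for each. The variates of all vertices being independent, the numbers of
points of the annuli are jointly multinomial and, given these, the sequence obtained is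
distributed as the order statistics of independent uniform variates. A count of `N` points is
charged `1 + N` steps, and each of the `N` variates and radii one step. -/
def drawPoints (p : Params) (ω : Fin p.n → ℝ × ℝ) (a b : ℝ) : Prog p.n (List (Fin p.n)) :=
  let vs := ((List.finRange p.n).filter fun v => a ≤ (ω v).2 ∧ (ω v).2 < b).insertionSort
    fun v w => (ω v).1 ≤ (ω w).1
  do
    tick .generation (1 + 3 * vs.length)
    return vs

/-- Place the points that were drawn. -/
def placeNodes (p : Params) (ω : Fin p.n → ℝ × ℝ) : List (Fin p.n) → Prog p.n (List (Node p.n))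
  | [] => pure []
  | v :: vs => do
    tick .generation 1
    let us ← placeNodes p ω vs
    return nodeOf p ω v :: us

/-- Emit all edges between `u` and a list of nodes. -/
def emitStar {n : ℕ} (u : Node n) : List (Node n) → Prog n Unit
  | [] => pure ()
  | v :: vs => do
    tick .clique 1
    emit u.id v.id
    emitStar u vs

/-- Emit all edges of the clique on a list of nodes. -/
def emitClique {n : ℕ} : List (Node n) → Prog n Unit
  | [] => pure ()
  | u :: us => do
    tick .clique 1
    emitStar u us
    emitClique us

/-- The number of cells of an annulus with `N` points: the power of two `2 ^ e` with
`κ ≤ N / 2 ^ e < 2 κ`, and one cell if `N < κ`. -/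
def numCells (κ N : ℕ) : ℕ := 2 ^ Nat.log 2 (N / κ)

/-- The position of an angle in units of the width of one of `c` cells. -/
def cellIndex (c : ℕ) (θ : ℝ) : ℤ := ⌊θ * c / (2 * Real.pi)⌋

/-- The cell of an angle, modulo `2π`. -/
def cellOf (c : ℕ) (θ : ℝ) : ℕ := (cellIndex c θ % c).toNat

/-- The request of `node` in an annulus with `c` cells, active in the cells `first, …, last`.
A cell number `t ≥ c` denotes the cell `t - c` in the final phase, after a full turn. -/
structure Request (n : ℕ) where
  node : Node n
  first : ℕ
  last : ℕ

/-- The request of `u` in the annulus with lower boundary `a` and `c` cells: the cells met by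
`[θ - Δθ, θ + Δθ]`, each of them once. -/
def requestOf {n : ℕ} (R a : ℝ) (c : ℕ) (u : Node n) : Request n :=
  let lo := u.θ - deltaTheta R u.r a
  let hi := u.θ + deltaTheta R u.r a
  { node := u
    first := cellOf c lo
    last := cellOf c lo + min (cellIndex c hi - cellIndex c lo).toNat (c - 1) }

/-- Create the begin-of-request tokens of the given nodes. -/
def makeRequests {n : ℕ} (R a : ℝ) (c : ℕ) : List (Node n) → Prog n (List (Request n))
  | [] => pure []
  | u :: us => do
    tick .selection 1
    let qs ← makeRequests R a c us
    return requestOf R a c u :: qs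

/-- Put tokens one after the other into the buckets given by an integer key. -/
def distribute {n : ℕ} {τ : Type} (key : τ → ℕ) :
    (ℕ → List τ) → List τ → Prog n (ℕ → List τ)
  | buckets, [] => pure buckets
  | buckets, t :: ts => do
    tick .selection 1
    distribute key (Function.update buckets (key t) (t :: buckets (key t))) ts

/-- Integer sorting of tokens by a key below `c`: allocate `c` empty buckets and distribute. -/
def integerSort {n : ℕ} {τ : Type} (key : τ → ℕ) (c : ℕ) (ts : List τ) :
    Prog n (ℕ → List τ) := do
  tick .selection c
  distribute key (fun _ => []) ts

/-- On entering cell `t`, drop the active requests that ended before. -/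
def dropEnded {n : ℕ} (t : ℕ) : List (Request n) → Prog n (List (Request n))
  | [] => pure []
  | q :: qs => do
    tick .selection 1
    let rest ← dropEnded t qs
    return if t ≤ q.last then q :: rest else rest

/-- Process begin-of-request tokens: each joins the active requests, and its node is passed to the
insertion buffer of the next annulus. -/
def openRequests {n : ℕ} : List (Request n) → List (Request n) → List (Node n) →
    Prog n (List (Request n) × List (Node n))
  | [], active, buffer => pure (active, buffer)
  | q :: qs, active, buffer => do
    tick .selection 1
    openRequests qs (q :: active) (q.node :: buffer)

open Classical in
/-- Compare the node `v` with all active requests. An edge is emitted at the endpoint of larger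
radius only (ties are broken by the vertex number), so that no edge is emitted twice. -/
def checkNode {n : ℕ} (R : ℝ) (v : Node n) : List (Request n) → Prog n Unit
  | [] => pure ()
  | q :: qs => do
    tick .check 1
    if (q.node.r < v.r ∨ q.node.r = v.r ∧ q.node.id < v.id) ∧ hypDist q.node v < R then
      emit q.node.id v.id
    checkNode R v qs

/-- Process the node tokens of a cell. -/
def checkNodes {n : ℕ} (R : ℝ) (active : List (Request n)) : List (Node n) → Prog n Unit
  | [] => pure ()
  | v :: vs => do
    tick .check 1
    checkNode R v active
    checkNodes R active vs

/-- The sweep over a list of cell numbers, starting from the given active requests. Returns the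
insertion buffer of the next annulus. -/
def sweep {n : ℕ} (R : ℝ) (c : ℕ) (begins : ℕ → List (Request n)) (nodes : ℕ → List (Node n)) :
    List ℕ → List (Request n) → List (Node n) → Prog n (List (Node n))
  | [], _, buffer => pure buffer
  | t :: ts, active, buffer => do
    tick .selection 1
    let kept ← dropEnded t active
    let (active', buffer') ← openRequests (begins t) kept buffer
    checkNodes R active' (nodes (t % c))
    sweep R c begins nodes ts active' buffer'

/-- Process the streaming annulus `j`, given the insertion buffer from below: draw its points,
choose the number `c` of cells, sort the tokens into cells, and sweep over the cells `0, …, c - 1`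
(main phase) and once more over the cells `c, …, 2 c - 1` (final phase), where no request begins
and those which extend beyond `2π` are completed. -/
def runAnnulus (p : Params) (ω : Fin p.n → ℝ × ℝ) (j : ℕ) (buffer : List (Node p.n)) :
    Prog p.n (List (Node p.n)) := do
  let vs ← drawPoints p ω (boundary p j) (boundary p (j + 1))
  let own ← placeNodes p ω vs
  let c := numCells p.κ vs.length
  tick .generation (1 + Nat.log 2 c)
  let requests ← makeRequests p.R (boundary p j) c (buffer ++ own)
  let begins ← integerSort Request.first c requests
  let nodes ← integerSort (fun v => cellOf c v.θ) c own
  sweep p.R c begins nodes (List.range (2 * c)) [] []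

/-- Process streaming annuli one after the other, from the inside to the outside. -/
def runAnnuli (p : Params) (ω : Fin p.n → ℝ × ℝ) : List ℕ → List (Node p.n) → Prog p.n Unit
  | [], _ => pure ()
  | j :: js, buffer => do
    let buffer' ← runAnnulus p ω j buffer
    runAnnuli p ω js buffer'

/-- The sequential sRHG generator: compute the annuli, handle the clique annulus, and process the
streaming annuli. -/
def generator (p : Params) (ω : Fin p.n → ℝ × ℝ) : Prog p.n Unit := do
  tick .generation (1 + numAnnuli p)
  let vs ← drawPoints p ω 0 (cliqueRadius p)
  let core ← placeNodes p ω vs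
  emitClique core
  runAnnuli p ω (List.range' (numCliqueAnnuli p) (numAnnuli p - numCliqueAnnuli p)) core

end SRHG

end

noncomputable section

namespace SRHG

/-! Edges and work are compared with one and the same quantity. The width of an annulus lies between
two positive constants depending on `α` only. Hence points of the annuli `i` and `j` are adjacent as
soon as their angular distance is below a constant times `scale p i j` (`hypDist_lt_of_norm_le`),
and a request of a point of annulus `i` in annulus `j` reaches no further than another constant
times `scale p i j` (`deltaTheta_boundary_le`). With `N_i` points in annulus `i`, both the number of
edges and the number of candidate pairs should be of the order `Q = ∑_{i ≤ j} N_i N_j scale p i j`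
(`edgeScale`). `Q` is never evaluated, so no case distinction on `γ` arises.

Time: a request pays for the cells it spans and the nodes in them (`time_sweep_le`,
`remaining_requestOf_le`). Rounding to cells costs `O(κ)` per request, because a cell holds at most
`2κ` nodes on average. The number of requests is `totalDepth`, which is `O(n)` with high probability
since the mass of the annuli decays geometrically towards the centre. All pairs of the clique
annulus have scale `1`, so its square is at most `2Q`.

Concentration: the placed angles are independent, uniform, and independent of the annuli
(`measurePreserving_configuration`). Given the annuli, the number of pairs at angular distance at
most `W` is not a sum of independent terms. The pairs are therefore split, by the lowest binary
digit in which the two vertex numbers differ, into logarithmically many bipartite classes. In each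
class one side is frozen and a Chernoff bound applies to the other (`bipartite_tail`). This gives
the expected order up to constant factors and an additive polylogarithmic error `Λ`
(`nearSum_offPairs_concentration`).

Conclusion: with `k` annuli, the time is `O(n + Q + k² Λ)` and `2m` is at least a constant times `Q`
minus `k² Λ`. The outermost annulus alone holds at least `n/8` vertices, so `Q ≥ q n` with `q > 0`
depending on `C₀` only; this is where the upper bound on `C` enters. Thus `n` and the
polylogarithmic errors are absorbed by `Q`, and `Q` by `m` (`time_le_of_typical`). -/

theorem exp_le_one_add_mul {x : ℝ} (h0 : 0 ≤ x) (h1 : x ≤ 1) (a : ℝ) :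
    Real.exp (a * x) ≤ 1 + (Real.exp a - 1) * x := by
  have h := convexOn_exp.2 (Set.mem_univ 0) (Set.mem_univ a) (sub_nonneg.2 h1) h0 (by ring)
  simp only [smul_eq_mul, mul_zero, zero_add, Real.exp_zero, mul_one] at h
  rw [mul_comm a x]; linarith

/-! ### Chernoff bounds for sums of independent bounded terms. -/

section Chernoff

variable {ι : Type*} [Fintype ι] {Ω : ι → Type*} [∀ i, MeasurableSpace (Ω i)]
  {μ : ∀ i, Measure (Ω i)} [∀ i, IsProbabilityMeasure (μ i)]

theorem integral_exp_mul_le {α : Type*} [MeasurableSpace α] {ν : Measure α}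
    [IsProbabilityMeasure ν] {f : α → ℝ} (hf : Measurable f) (h0 : ∀ x, 0 ≤ f x)
    (h1 : ∀ x, f x ≤ 1) (a : ℝ) :
    ∫ x, Real.exp (a * f x) ∂ν ≤ Real.exp ((Real.exp a - 1) * ∫ x, f x ∂ν) := by
  have hfi : Integrable f ν := Integrable.of_bound hf.aestronglyMeasurable 1
    (ae_of_all _ fun x => by rw [Real.norm_eq_abs, abs_of_nonneg (h0 x)]; exact h1 x)
  calc ∫ x, Real.exp (a * f x) ∂ν ≤ ∫ x, (1 + (Real.exp a - 1) * f x) ∂ν := by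
        refine integral_mono_of_nonneg (ae_of_all _ fun x => (Real.exp_pos _).le)
          ((integrable_const _).add (hfi.const_mul _))
          (ae_of_all _ fun x => exp_le_one_add_mul (h0 x) (h1 x) a)
    _ = 1 + (Real.exp a - 1) * ∫ x, f x ∂ν := by
        rw [integral_add (integrable_const _) (hfi.const_mul _), integral_const_mul]; simp
    _ ≤ _ := by linarith [Real.add_one_le_exp ((Real.exp a - 1) * ∫ x, f x ∂ν)]

/-- Markov's inequality for the exponential moment, which factorises over the product measure. The
sign of `a` is free, so that `a = 1` and `a = -1` give the two tails. -/
theorem pi_exp_tail {f : ∀ i, Ω i → ℝ} (hf : ∀ i, Measurable (f i)) (h0 : ∀ i x, 0 ≤ f i x)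
    (h1 : ∀ i x, f i x ≤ 1) (a T : ℝ) :
    Measure.pi μ {ω | T ≤ a * ∑ i, f i (ω i)} ≤
      ENNReal.ofReal (Real.exp ((Real.exp a - 1) * (∑ i, ∫ x, f i x ∂μ i) - T)) := by
  have hm : Measurable fun ω : ∀ i, Ω i => ∑ i, f i (ω i) :=
    Finset.measurable_sum _ fun i _ => (hf i).comp (measurable_pi_apply i)
  have hb : ∀ ω : ∀ i, Ω i, |∑ i, f i (ω i)| ≤ Fintype.card ι := fun ω => by
    rw [abs_of_nonneg (Finset.sum_nonneg fun i _ => h0 i _)]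
    calc ∑ i, f i (ω i) ≤ ∑ i : ι, (1 : ℝ) := Finset.sum_le_sum fun i _ => h1 i _
      _ = _ := by simp
  have hint : Integrable (fun ω : ∀ i, Ω i => Real.exp (1 * (a * ∑ i, f i (ω i))))
      (Measure.pi μ) := by
    refine Integrable.of_bound
      (Real.measurable_exp.comp ((hm.const_mul a).const_mul 1)).aestronglyMeasurable (Real.exp (|a| * Fintype.card ι))
      (ae_of_all _ fun ω => ?_)
    rw [Real.norm_eq_abs, abs_of_pos (Real.exp_pos _), one_mul]
    refine Real.exp_le_exp.2 ((le_abs_self _).trans ?_)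
    rw [abs_mul]
    exact mul_le_mul_of_nonneg_left (hb ω) (abs_nonneg a)
  have h := ProbabilityTheory.measure_ge_le_exp_mul_mgf (μ := Measure.pi μ)
    (X := fun ω : ∀ i, Ω i => a * ∑ i, f i (ω i)) (t := 1) T zero_le_one hint
  have hmgf : ProbabilityTheory.mgf (fun ω : ∀ i, Ω i => a * ∑ i, f i (ω i)) (Measure.pi μ) 1 ≤
      Real.exp ((Real.exp a - 1) * (∑ i, ∫ x, f i x ∂μ i)) := by
    simp only [ProbabilityTheory.mgf, one_mul, Finset.mul_sum, Real.exp_sum]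
    rw [integral_fintype_prod_eq_prod (𝕜 := ℝ) fun i x => Real.exp (a * f i x)]
    exact Finset.prod_le_prod (fun i _ => integral_nonneg fun x => (Real.exp_pos _).le)
      fun i _ => integral_exp_mul_le (hf i) (h0 i) (h1 i) a
  rw [← ENNReal.ofReal_toReal (measure_ne_top (Measure.pi μ) _)]
  refine ENNReal.ofReal_le_ofReal (h.trans ?_)
  calc _ ≤ Real.exp (-1 * T) * Real.exp ((Real.exp a - 1) * (∑ i, ∫ x, f i x ∂μ i)) :=
        mul_le_mul_of_nonneg_left hmgf (Real.exp_pos _).le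
    _ = _ := by rw [← Real.exp_add]; ring_nf

/-- Rescale by `D` and take `a = 1`. Giving away a factor `2` of the mean, which covers `e - 1`,
makes the failure probability independent of the mean. -/
theorem pi_chernoff_upper {f : ∀ i, Ω i → ℝ} (hf : ∀ i, Measurable (f i))
    (h0 : ∀ i x, 0 ≤ f i x) {D : ℝ} (hD : 0 < D) (h1 : ∀ i x, f i x ≤ D) {m : ℝ}
    (hm : ∑ i, ∫ x, f i x ∂μ i ≤ m) (s : ℝ) :
    Measure.pi μ {ω | 2 * m + D * s ≤ ∑ i, f i (ω i)} ≤ ENNReal.ofReal (Real.exp (-s)) := by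
  have h := pi_exp_tail (μ := μ) (f := fun i x => f i x / D) (fun i => (hf i).div_const D)
    (fun i x => div_nonneg (h0 i x) hD.le) (fun i x => (div_le_one hD).2 (h1 i x)) 1 (2 * m / D + s)
  simp only [integral_div, ← Finset.sum_div] at h
  refine (measure_mono fun ω hω => ?_).trans (h.trans (ENNReal.ofReal_le_ofReal
    (Real.exp_le_exp.2 ?_)))
  · simp only [Set.mem_ofPred_eq] at hω ⊢
    rw [one_mul, le_div_iff₀ hD]
    calc _ = 2 * m + D * s := by field_simp
      _ ≤ _ := hω
  · have hS : 0 ≤ ∑ i, ∫ x, f i x ∂μ i :=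
      Finset.sum_nonneg fun i _ => integral_nonneg fun x => h0 i x
    have he : Real.exp 1 - 1 ≤ 2 := by linarith [Real.exp_one_lt_d9]
    have : (Real.exp 1 - 1) * ((∑ i, ∫ x, f i x ∂μ i) / D) ≤ 2 * (m / D) :=
      mul_le_mul he (div_le_div_of_nonneg_right hm hD.le) (div_nonneg hS hD.le) zero_le_two
    rw [mul_div_assoc]
    linarith

/-- The case `a = -1`, where `1 - 1/e ≥ 1/2` leaves half of the mean. -/
theorem pi_chernoff_lower {f : ∀ i, Ω i → ℝ} (hf : ∀ i, Measurable (f i))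
    (h0 : ∀ i x, 0 ≤ f i x) {D : ℝ} (hD : 0 < D) (h1 : ∀ i x, f i x ≤ D) {m : ℝ}
    (hm : m ≤ ∑ i, ∫ x, f i x ∂μ i) (s : ℝ) :
    Measure.pi μ {ω | ∑ i, f i (ω i) ≤ m / 2 - D * s} ≤ ENNReal.ofReal (Real.exp (-s)) := by
  have h := pi_exp_tail (μ := μ) (f := fun i x => f i x / D) (fun i => (hf i).div_const D)
    (fun i x => div_nonneg (h0 i x) hD.le) (fun i x => (div_le_one hD).2 (h1 i x)) (-1)
    (s - m / 2 / D)
  simp only [integral_div, ← Finset.sum_div] at h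
  refine (measure_mono fun ω hω => ?_).trans (h.trans (ENNReal.ofReal_le_ofReal
    (Real.exp_le_exp.2 ?_)))
  · simp only [Set.mem_ofPred_eq] at hω ⊢
    have := div_le_div_of_nonneg_right hω hD.le
    rw [sub_div, mul_div_cancel_left₀ _ hD.ne'] at this
    linarith
  · have hS : 0 ≤ ∑ i, ∫ x, f i x ∂μ i :=
      Finset.sum_nonneg fun i _ => integral_nonneg fun x => h0 i x
    have he : Real.exp (-1) - 1 ≤ -(1 / 2) := by
      rw [Real.exp_neg]
      have : (Real.exp 1)⁻¹ ≤ 2⁻¹ := inv_anti₀ two_pos (by linarith [Real.exp_one_gt_d9])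
      linarith
    have h2 : (Real.exp (-1) - 1) * ((∑ i, ∫ x, f i x ∂μ i) / D) ≤
        -(1 / 2) * ((∑ i, ∫ x, f i x ∂μ i) / D) :=
      mul_le_mul_of_nonneg_right he (div_nonneg hS hD.le)
    have h3 := div_le_div_of_nonneg_right hm hD.le
    have : m / 2 / D = (1 / 2) * (m / D) := by ring
    linarith

end Chernoff

/-! ### Uniform angles on the circle. -/

instance : Fact (0 < 2 * Real.pi) := ⟨Real.two_pi_pos⟩

/-- Angles modulo `2π`. -/
abbrev Circ := AddCircle (2 * Real.pi)

/-- The uniform law on the circle. -/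
abbrev circLaw : Measure Circ := AddCircle.haarAddCircle

/-- Indicator of two angles being at distance at most `W`. -/
def near (W : ℝ) (x y : Circ) : ℝ := if ‖x - y‖ ≤ W then 1 else 0

theorem near_nonneg (W : ℝ) (x y : Circ) : 0 ≤ near W x y := by
  unfold near; split_ifs <;> norm_num

theorem near_le_one (W : ℝ) (x y : Circ) : near W x y ≤ 1 := by
  unfold near; split_ifs <;> norm_num

theorem near_comm (W : ℝ) (x y : Circ) : near W x y = near W y x := by
  simp only [near, norm_sub_rev]

theorem measurable_near {α : Type*} [MeasurableSpace α] (W : ℝ) {f g : α → Circ}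
    (hf : Measurable f) (hg : Measurable g) : Measurable fun a => near W (f a) (g a) :=
  Measurable.ite (measurableSet_le (hf.sub hg).norm measurable_const) measurable_const
    measurable_const

theorem near_triangle {W : ℝ} {x y z : Circ} (h : near W x z ≠ 0) :
    near W y z ≤ near (2 * W) y x := by
  have hx : ‖x - z‖ ≤ W := by
    by_contra hn
    exact h (if_neg hn)
  unfold near
  split_ifs with h1 h2 <;> try norm_num
  exfalso
  have : ‖y - x‖ ≤ ‖y - z‖ + ‖x - z‖ := by
    rw [← norm_sub_rev z x]
    rw [← sub_add_sub_cancel y z x]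
    exact norm_add_le _ _
  linarith

/-- The probability that two independent uniform angles are at distance at most `W`. -/
def nearProb (W : ℝ) : ℝ := circLaw.real (Metric.closedBall 0 W)

theorem integral_near (W : ℝ) (x : Circ) : ∫ y, near W x y ∂circLaw = nearProb W := by
  have : (fun y => near W x y) = (Metric.closedBall x W).indicator 1 := by
    ext y
    simp only [near, Set.indicator, Metric.mem_closedBall, dist_eq_norm, Pi.one_apply,
      norm_sub_rev x y]
  rw [this, integral_indicator_one Metric.isClosed_closedBall.measurableSet, nearProb]
  have hpre : Metric.closedBall x W = (fun y => -x + y) ⁻¹' Metric.closedBall 0 W := by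
    ext y
    rw [Set.mem_preimage, Metric.mem_closedBall, Metric.mem_closedBall, dist_eq_norm, dist_zero_right,
      sub_eq_neg_add]
  rw [measureReal_def, hpre, measure_preimage_add, measureReal_def]

theorem nearProb_eq {W : ℝ} (hW : 0 ≤ W) : nearProb W = min 1 (W / Real.pi) := by
  have h := AddCircle.volume_closedBall (2 * Real.pi) (x := 0) W
  rw [AddCircle.volume_eq_smul_haarAddCircle, Measure.smul_apply, smul_eq_mul] at h
  have h2 := congrArg ENNReal.toReal h
  rw [ENNReal.toReal_mul, ENNReal.toReal_ofReal Real.two_pi_pos.le,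
    ENNReal.toReal_ofReal (le_min Real.two_pi_pos.le (by linarith))] at h2
  have h3 : 2 * Real.pi * nearProb W = min (2 * Real.pi) (2 * W) := h2
  have hpi := Real.pi_pos
  rcases le_total W Real.pi with h | h
  · rw [min_eq_right (by linarith)] at h3
    rw [min_eq_right ((div_le_one hpi).2 h)]
    field_simp; linarith
  · rw [min_eq_left (by linarith)] at h3
    rw [min_eq_left ((one_le_div hpi).2 h)]
    have : 2 * Real.pi ≠ 0 := by positivity
    exact mul_left_cancel₀ this (by linarith)

/-! ### Concentration of the number of close pairs: bipartite sets of pairs. -/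

section Bipartite

variable {ι : Type*}

/-- Number of pairs in `E` at distance at most `W`. -/
def nearSum (E : Finset (ι × ι)) (W : ℝ) (ϑ : ι → Circ) : ℝ :=
  ∑ e ∈ E, near W (ϑ e.1) (ϑ e.2)

theorem measurable_nearSum (E : Finset (ι × ι)) (W : ℝ) : Measurable (nearSum E W) :=
  Finset.measurable_sum _ fun e _ =>
    measurable_near W (measurable_pi_apply e.1) (measurable_pi_apply e.2)

variable [DecidableEq ι]

/-- No angle is within `W` of more than `D` of the first ends of the pairs with a given second
end. -/
def Spread (E : Finset (ι × ι)) (W D : ℝ) (ϑ : ι → Circ) : Prop :=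
  ∀ e ∈ E, ∑ e' ∈ E with e'.2 = e.2, near (2 * W) (ϑ e'.1) (ϑ e.1) ≤ D

theorem measurableSet_spread (E : Finset (ι × ι)) (W D : ℝ) :
    MeasurableSet {ϑ | Spread E W D ϑ} := by
  have : {ϑ | Spread E W D ϑ} = ⋂ e ∈ E, {ϑ : ι → Circ |
      ∑ e' ∈ E with e'.2 = e.2, near (2 * W) (ϑ e'.1) (ϑ e.1) ≤ D} := by
    ext; simp [Spread]
  rw [this]
  exact Finset.measurableSet_biInter _ fun e _ => measurableSet_le
    (Finset.measurable_sum _ fun e' _ =>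
      measurable_near _ (measurable_pi_apply e'.1) (measurable_pi_apply e.1)) measurable_const

/-- If `y` is within `W` of one first end, all first ends within `W` of `y` are within `2W` of that
one. So finitely many conditions on the first ends alone control every position `y` of the second
end. -/
theorem Spread.sum_near_le {E : Finset (ι × ι)} {W D : ℝ} (hD : 0 ≤ D) {ϑ : ι → Circ}
    (h : Spread E W D ϑ) (v : ι) (y : Circ) : ∑ e ∈ E with e.2 = v, near W (ϑ e.1) y ≤ D := by
  by_cases hz : ∀ e ∈ E.filter fun e => e.2 = v, near W (ϑ e.1) y = 0
  · rw [Finset.sum_eq_zero hz]; exact hD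
  · push Not at hz
    obtain ⟨e, he, hne⟩ := hz
    rw [Finset.mem_filter] at he
    refine le_trans (Finset.sum_le_sum fun e' _ => near_triangle hne) ?_
    simpa [he.2] using h e he.1

variable [Fintype ι]

/-- The law of independent uniform angles. -/
abbrev anglesLaw (ι : Type*) [Fintype ι] : Measure (ι → Circ) := Measure.pi fun _ => circLaw

/-- Resampling the coordinates in `Y` from an independent copy does not change the law. This
conditions on the coordinates outside `Y` without splitting the index type. -/
theorem measurePreserving_merge {Ω : Type*} [MeasurableSpace Ω] (ν : Measure Ω)
    [IsProbabilityMeasure ν] (Y : Finset ι) :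
    MeasurePreserving (fun (p : (ι → Ω) × (ι → Ω)) i => if i ∈ Y then p.2 i else p.1 i)
      ((Measure.pi fun _ => ν).prod (Measure.pi fun _ => ν)) (Measure.pi fun _ => ν) := by
  have h1 := (measurePreserving_arrowProdEquivProdArrow Ω Ω ι (fun _ => ν) (fun _ => ν)).symm
  have h2 := measurePreserving_pi (fun _ : ι => ν.prod ν) (fun _ : ι => ν)
    (f := fun i p => if i ∈ Y then p.2 else p.1) (fun i => by
      by_cases hi : i ∈ Y
      · simpa [hi] using measurePreserving_snd (μ := ν) (ν := ν)
      · simpa [hi] using measurePreserving_fst (μ := ν) (ν := ν))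
  exact h2.comp h1

theorem measure_le_of_section_le {α β : Type*} [MeasurableSpace α] [MeasurableSpace β]
    {μ : Measure α} [IsProbabilityMeasure μ] {ν : Measure β} [IsProbabilityMeasure ν]
    {B : Set (α × β)} (hB : MeasurableSet B) {ε : ENNReal}
    (h : ∀ a, ν (Prod.mk a ⁻¹' B) ≤ ε) : μ.prod ν B ≤ ε := by
  rw [Measure.prod_apply hB]
  refine (lintegral_mono h).trans ?_
  simp

/-- Once the angles outside `Y` are frozen, the count is a sum of independent terms, one per vertex
of `Y`. Under `Spread` each term is at most `D`, and by rotation invariance the mean is `E.card *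
nearProb W` whatever the frozen angles are. -/
theorem bipartite_tail {Y : Finset ι} {E : Finset (ι × ι)} (hE : ∀ e ∈ E, e.1 ∉ Y ∧ e.2 ∈ Y)
    {W D : ℝ} (hD : 0 < D) (s : ℝ) :
    anglesLaw ι {ϑ | Spread E W D ϑ ∧ 2 * (E.card * nearProb W) + D * s ≤ nearSum E W ϑ} ≤
        ENNReal.ofReal (Real.exp (-s)) ∧
      anglesLaw ι {ϑ | Spread E W D ϑ ∧ nearSum E W ϑ ≤ E.card * nearProb W / 2 - D * s} ≤
        ENNReal.ofReal (Real.exp (-s)) := by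
  have key : ∀ S : Set ℝ, MeasurableSet S → 
      (∀ θ : ι → Circ, Spread E W D θ → anglesLaw ι {θ' | ∑ v, (∑ e ∈ E with e.2 = v,
        near W (θ e.1) (θ' v)) ∈ S} ≤ ENNReal.ofReal (Real.exp (-s))) →
      anglesLaw ι {ϑ | Spread E W D ϑ ∧ nearSum E W ϑ ∈ S} ≤ ENNReal.ofReal (Real.exp (-s)) := by
    intro S hS h
    have hB : MeasurableSet {ϑ : ι → Circ | Spread E W D ϑ ∧ nearSum E W ϑ ∈ S} :=
      (measurableSet_spread E W D).inter (measurable_nearSum E W hS)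
    have hmp := measurePreserving_merge circLaw Y
    rw [← hmp.measure_preimage hB.nullMeasurableSet]
    refine measure_le_of_section_le (hmp.measurable hB) fun θ => ?_
    have hspread : ∀ θ' : ι → Circ,
        Spread E W D (fun i => if i ∈ Y then θ' i else θ i) ↔ Spread E W D θ := by
      intro θ'
      refine forall₂_congr fun e he => ?_
      have : ∀ e' ∈ E.filter fun e' => e'.2 = e.2,
          near (2 * W) (if e'.1 ∈ Y then θ' e'.1 else θ e'.1)
            (if e.1 ∈ Y then θ' e.1 else θ e.1) = near (2 * W) (θ e'.1) (θ e.1) := fun e' he' => by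
        rw [if_neg (hE e' (Finset.mem_filter.1 he').1).1, if_neg (hE e he).1]
      rw [Finset.sum_congr rfl this]
    have hsum : ∀ θ' : ι → Circ, nearSum E W (fun i => if i ∈ Y then θ' i else θ i) =
        ∑ v, ∑ e ∈ E with e.2 = v, near W (θ e.1) (θ' v) := by
      intro θ'
      rw [nearSum, ← Finset.sum_fiberwise_of_maps_to (t := Finset.univ) (g := fun e => e.2)
        fun _ _ => Finset.mem_univ _]
      refine Finset.sum_congr rfl fun v _ => Finset.sum_congr rfl fun e he => ?_
      obtain ⟨h1, h2⟩ := Finset.mem_filter.1 he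
      rw [if_neg (hE e h1).1, if_pos (hE e h1).2, h2]
    -- `Spread` only sees frozen angles, so a section of the event is either empty or a plain tail
    -- event for independent terms.
    by_cases hθ : Spread E W D θ
    · refine (measure_mono fun θ' hθ' => ?_).trans (h θ hθ)
      have h2 : nearSum E W (fun i => if i ∈ Y then θ' i else θ i) ∈ S := hθ'.2
      rw [hsum] at h2
      exact h2
    · have : (Prod.mk θ ⁻¹' ((fun (p : (ι → Circ) × (ι → Circ)) i =>
          if i ∈ Y then p.2 i else p.1 i) ⁻¹' {ϑ | Spread E W D ϑ ∧ nearSum E W ϑ ∈ S})) = ∅ := by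
        ext θ'
        simp only [Set.mem_empty_iff_false, iff_false]
        exact fun hc => hθ ((hspread θ').1 hc.1)
      rw [this]; simp
  have hmeas : ∀ (θ : ι → Circ) (v : ι),
      Measurable fun y => ∑ e ∈ E with e.2 = v, near W (θ e.1) y := fun θ v =>
    Finset.measurable_sum _ fun e _ => measurable_near W measurable_const measurable_id
  have hint : ∀ θ : ι → Circ, ∑ v, ∫ y, ∑ e ∈ E with e.2 = v, near W (θ e.1) y ∂circLaw =
      E.card * nearProb W := by
    intro θ
    have : ∀ v, ∫ y, ∑ e ∈ E with e.2 = v, near W (θ e.1) y ∂circLaw =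
        ∑ e ∈ E with e.2 = v, nearProb W := fun v => by
      rw [integral_finsetSum]
      · simp only [integral_near]
      · intro e _
        exact Integrable.of_bound (measurable_near W measurable_const
          measurable_id).aestronglyMeasurable 1 (ae_of_all _ fun y => by
            rw [Real.norm_eq_abs, abs_of_nonneg (near_nonneg _ _ _)]; exact near_le_one _ _ _)
    simp only [this]
    rw [Finset.sum_fiberwise_of_maps_to fun _ _ => Finset.mem_univ _]
    simp
  constructor
  · refine key (Set.Ici _) measurableSet_Ici fun θ hθ => ?_
    exact pi_chernoff_upper (hmeas θ) (fun v y => Finset.sum_nonneg fun _ _ => near_nonneg _ _ _)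
      hD (fun v y => hθ.sum_near_le hD.le v y) (hint θ).le s
  · refine key (Set.Iic _) measurableSet_Iic fun θ hθ => ?_
    exact pi_chernoff_lower (hmeas θ) (fun v y => Finset.sum_nonneg fun _ _ => near_nonneg _ _ _)
      hD (fun v y => hθ.sum_near_le hD.le v y) (hint θ).ge s

end Bipartite

/-- The pairs `(u, v)` form a bipartite set with one pair per second end, hence `Spread` holds with
`D = 1`. The leading `1` pays for `v = u`. -/
theorem star_tail {ι : Type*} [Fintype ι] [DecidableEq ι] (A : Finset ι) (W s : ℝ) (u : ι) :
    anglesLaw ι {ϑ | 1 + (2 * (A.card * nearProb W) + s) ≤ ∑ v ∈ A, near W (ϑ v) (ϑ u)} ≤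
      ENNReal.ofReal (Real.exp (-s)) := by
  set E : Finset (ι × ι) := (A.erase u).image fun v => (u, v) with hEdef
  have hinj : Set.InjOn (fun v : ι => (u, v)) (A.erase u) := fun a _ b _ h => (Prod.ext_iff.1 h).2
  have hE : ∀ e ∈ E, e.1 ∉ A.erase u ∧ e.2 ∈ A.erase u := by
    intro e he
    obtain ⟨v, hv, rfl⟩ := Finset.mem_image.1 he
    exact ⟨Finset.notMem_erase u A, hv⟩
  refine (measure_mono fun ϑ hϑ => ?_).trans (bipartite_tail hE (W := W) one_pos s).1
  have hcard : (E.card : ℝ) ≤ A.card := by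
    rw [hEdef, Finset.card_image_of_injOn hinj]
    exact_mod_cast Finset.card_le_card (Finset.erase_subset u A)
  have hsum : nearSum E W ϑ = ∑ v ∈ A.erase u, near W (ϑ v) (ϑ u) := by
    rw [nearSum, hEdef, Finset.sum_image hinj]
    exact Finset.sum_congr rfl fun v _ => near_comm _ _ _
  have hle : ∑ v ∈ A, near W (ϑ v) (ϑ u) ≤ 1 + nearSum E W ϑ := by
    rw [hsum]
    by_cases hu : u ∈ A
    · rw [← Finset.add_sum_erase A _ hu]
      linarith [near_le_one W (ϑ u) (ϑ u)]
    · rw [Finset.erase_eq_of_notMem hu]; linarith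
  have hq : 0 ≤ nearProb W := measureReal_nonneg
  refine ⟨fun e he => ?_, ?_⟩
  · calc ∑ e' ∈ E with e'.2 = e.2, near (2 * W) (ϑ e'.1) (ϑ e.1)
        ≤ ∑ e' ∈ E with e'.2 = e.2, (1 : ℝ) := Finset.sum_le_sum fun _ _ => near_le_one _ _ _
      _ ≤ 1 := by
        rw [Finset.sum_const, nsmul_eq_mul, mul_one]
        have : (E.filter fun e' => e'.2 = e.2).card ≤ 1 := by
          refine Finset.card_le_one.2 fun a ha b hb => ?_
          obtain ⟨ha1, ha2⟩ := Finset.mem_filter.1 ha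
          obtain ⟨hb1, hb2⟩ := Finset.mem_filter.1 hb
          obtain ⟨x, _, rfl⟩ := Finset.mem_image.1 ha1
          obtain ⟨y, _, rfl⟩ := Finset.mem_image.1 hb1
          exact Prod.ext rfl (ha2.trans hb2.symm)
        exact_mod_cast this
  · have hϑ' : 1 + (2 * (A.card * nearProb W) + s) ≤ ∑ v ∈ A, near W (ϑ v) (ϑ u) := hϑ
    have := mul_le_mul_of_nonneg_right hcard hq
    linarith

/-! ### Concentration of the number of close pairs: arbitrary sets of vertices. -/

/-- The pairs of different elements of `A` and `B`. -/
def offPairs {ι : Type*} [DecidableEq ι] (A B : Finset ι) : Finset (ι × ι) :=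
  (A ×ˢ B).filter fun e => e.1 ≠ e.2

open Classical in
/-- A position at which the binary expansions of two different numbers differ. -/
def splitLevel (x y : ℕ) : ℕ :=
  if h : ∃ i, x.testBit i ≠ y.testBit i then Nat.find h else 0

theorem testBit_splitLevel {x y : ℕ} (h : x ≠ y) :
    x.testBit (splitLevel x y) ≠ y.testBit (splitLevel x y) := by
  classical
  have h' := Nat.exists_testBit_ne_of_ne h
  rw [splitLevel, dif_pos h']
  exact Nat.find_spec h'

theorem splitLevel_lt {x y L : ℕ} (h : x ≠ y) (hx : x < 2 ^ L) (hy : y < 2 ^ L) :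
    splitLevel x y < L := by
  by_contra hL
  push Not at hL
  have hp := Nat.pow_le_pow_right two_pos hL
  exact testBit_splitLevel h (by
    rw [Nat.testBit_eq_false_of_lt (hx.trans_le hp), Nat.testBit_eq_false_of_lt (hy.trans_le hp)])

/-- Classifying a pair by its splitting digit and the value of that digit at the second end gives
`2L` classes, each bipartite with respect to the vertices having this digit. `star_tail` with width
`2W` around each of the `n` vertices supplies `Spread` for all classes at once; the union bound runs
over these `n` events and two tails of each class. -/
theorem offPairs_tail {n L : ℕ} (hL : n ≤ 2 ^ L) (A B : Finset (Fin n)) {W s D : ℝ} (hs : 0 ≤ s)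
    (hD : D = 1 + (2 * (A.card * nearProb (2 * W)) + s)) :
    anglesLaw (Fin n) {ϑ | ¬ (nearSum (offPairs A B) W ϑ ≤
        2 * ((offPairs A B).card * nearProb W) + 2 * L * (D * s) ∧
      (offPairs A B).card * nearProb W / 2 - 2 * L * (D * s) ≤ nearSum (offPairs A B) W ϑ)} ≤
      (n + 4 * L : ℕ) * ENNReal.ofReal (Real.exp (-s)) := by
  set P := offPairs A B with hP
  set ε := ENNReal.ofReal (Real.exp (-s)) with hε
  have hq2 : 0 ≤ nearProb (2 * W) := measureReal_nonneg
  have hD0 : 0 < D := by rw [hD]; positivity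
  set g : Fin n × Fin n → ℕ × Bool := fun e =>
    (splitLevel e.1 e.2, (e.2 : ℕ).testBit (splitLevel e.1 e.2)) with hg
  set cls : ℕ × Bool → Finset (Fin n × Fin n) := fun c => P.filter fun e => g e = c with hcls
  set I : Finset (ℕ × Bool) := Finset.range L ×ˢ Finset.univ with hI
  have hmaps : ∀ e ∈ P, g e ∈ I := by
    intro e he
    have hne : (e.1 : ℕ) ≠ e.2 := fun h => (Finset.mem_filter.1 he).2 (Fin.ext h)
    exact Finset.mem_product.2 ⟨Finset.mem_range.2 (splitLevel_lt hne
      (e.1.2.trans_le hL) (e.2.2.trans_le hL)), Finset.mem_univ _⟩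
  have hIcard : (I.card : ℝ) = 2 * L := by rw [hI, Finset.card_product]; simp; ring
  have hbip : ∀ c, ∀ e ∈ cls c, e.1 ∉ (Finset.univ.filter fun v : Fin n =>
      (v : ℕ).testBit c.1 = c.2) ∧ e.2 ∈ (Finset.univ.filter fun v : Fin n =>
      (v : ℕ).testBit c.1 = c.2) := by
    intro c e he
    obtain ⟨he1, he2⟩ := Finset.mem_filter.1 he
    have hne : (e.1 : ℕ) ≠ e.2 := fun h => (Finset.mem_filter.1 he1).2 (Fin.ext h)
    subst he2
    simp only [Finset.mem_filter, Finset.mem_univ, true_and, hg, and_true]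
    exact testBit_splitLevel hne
  have hcardsum : ∑ c ∈ I, ((cls c).card : ℝ) = P.card := by
    rw [Finset.card_eq_sum_card_fiberwise hmaps]; push_cast; rfl
  have hnearsum : ∀ ϑ, ∑ c ∈ I, nearSum (cls c) W ϑ = nearSum P W ϑ := fun ϑ =>
    Finset.sum_fiberwise_of_maps_to hmaps _
  set U1 : Fin n → Set (Fin n → Circ) := fun u => {ϑ | D ≤ ∑ v ∈ A, near (2 * W) (ϑ v) (ϑ u)}
  set U2 : ℕ × Bool → Set (Fin n → Circ) := fun c => {ϑ | Spread (cls c) W D ϑ ∧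
    2 * ((cls c).card * nearProb W) + D * s ≤ nearSum (cls c) W ϑ}
  set U3 : ℕ × Bool → Set (Fin n → Circ) := fun c => {ϑ | Spread (cls c) W D ϑ ∧
    nearSum (cls c) W ϑ ≤ (cls c).card * nearProb W / 2 - D * s}
  have hsub : {ϑ : Fin n → Circ | ¬ (nearSum P W ϑ ≤ 2 * (P.card * nearProb W) + 2 * L * (D * s) ∧
      P.card * nearProb W / 2 - 2 * L * (D * s) ≤ nearSum P W ϑ)} ⊆
      (⋃ u ∈ (Finset.univ : Finset (Fin n)), U1 u) ∪ ((⋃ c ∈ I, U2 c) ∪ ⋃ c ∈ I, U3 c) := by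
    intro ϑ hϑ
    by_contra hcon
    simp only [Set.mem_union, Set.mem_iUnion, not_or, not_exists, exists_prop, not_and,
      Finset.mem_univ, true_imp_iff] at hcon
    obtain ⟨h1, h2, h3⟩ := hcon
    have hspread : ∀ c, Spread (cls c) W D ϑ := by
      intro c e he
      refine le_trans ?_ (not_le.1 (h1 e.1)).le
      have hinj : Set.InjOn (fun e : Fin n × Fin n => e.1)
          ((cls c).filter fun e' => e'.2 = e.2) := by
        intro a ha b hb hab
        exact Prod.ext hab ((Finset.mem_filter.1 ha).2.trans (Finset.mem_filter.1 hb).2.symm)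
      rw [← Finset.sum_image (f := fun v => near (2 * W) (ϑ v) (ϑ e.1)) hinj]
      refine Finset.sum_le_sum_of_subset_of_nonneg ?_ fun _ _ _ => near_nonneg _ _ _
      intro v hv
      obtain ⟨e', he', rfl⟩ := Finset.mem_image.1 hv
      have h5 := (Finset.mem_filter.1 (Finset.mem_filter.1 he').1).1
      exact (Finset.mem_product.1 (Finset.mem_filter.1 h5).1).1
    refine hϑ ⟨?_, ?_⟩
    · rw [← hnearsum ϑ, ← hcardsum]
      calc ∑ c ∈ I, nearSum (cls c) W ϑ
          ≤ ∑ c ∈ I, (2 * ((cls c).card * nearProb W) + D * s) :=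
            Finset.sum_le_sum fun c hc => by
              by_contra hn
              exact h2 c hc ⟨hspread c, (not_le.1 hn).le⟩
        _ = _ := by
            rw [Finset.sum_add_distrib, Finset.sum_const, nsmul_eq_mul, hIcard, Finset.sum_mul,
              Finset.mul_sum]
    · rw [← hnearsum ϑ, ← hcardsum]
      calc _ = ∑ c ∈ I, ((cls c).card * nearProb W / 2 - D * s) := by
            rw [Finset.sum_sub_distrib, Finset.sum_const, nsmul_eq_mul, hIcard, Finset.sum_mul,
              Finset.sum_div]
        _ ≤ _ := Finset.sum_le_sum fun c hc => by
              by_contra hn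
              exact h3 c hc ⟨hspread c, (not_le.1 hn).le⟩
  have hIc : I.card = 2 * L := by exact_mod_cast hIcard
  have hb1 : anglesLaw (Fin n) (⋃ u ∈ (Finset.univ : Finset (Fin n)), U1 u) ≤ n * ε := by
    refine (measure_biUnion_finset_le _ _).trans ?_
    refine (Finset.sum_le_card_nsmul _ _ ε fun u _ => ?_).trans (by simp)
    have := star_tail A (2 * W) s u
    rwa [← hD] at this
  have hb2 : anglesLaw (Fin n) (⋃ c ∈ I, U2 c) ≤ (2 * L : ℕ) * ε := by
    refine (measure_biUnion_finset_le _ _).trans ?_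
    refine (Finset.sum_le_card_nsmul _ _ ε fun c _ => (bipartite_tail (hbip c) hD0 s).1).trans ?_
    rw [hIc, nsmul_eq_mul]
  have hb3 : anglesLaw (Fin n) (⋃ c ∈ I, U3 c) ≤ (2 * L : ℕ) * ε := by
    refine (measure_biUnion_finset_le _ _).trans ?_
    refine (Finset.sum_le_card_nsmul _ _ ε fun c _ => (bipartite_tail (hbip c) hD0 s).2).trans ?_
    rw [hIc, nsmul_eq_mul]
  calc _ ≤ _ := measure_mono hsub
    _ ≤ n * ε + ((2 * L : ℕ) * ε + (2 * L : ℕ) * ε) :=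
      (measure_union_le _ _).trans (add_le_add hb1 ((measure_union_le _ _).trans
        (add_le_add hb2 hb3)))
    _ = _ := by push_cast; ring

theorem nearSum_offPairs_comm {n : ℕ} (A B : Finset (Fin n)) (W : ℝ) (ϑ : Fin n → Circ) :
    nearSum (offPairs A B) W ϑ = nearSum (offPairs B A) W ϑ := by
  unfold nearSum
  refine Finset.sum_bij' (fun e _ => e.swap) (fun e _ => e.swap) ?_ ?_ ?_ ?_ ?_
  · intro e he
    simp only [offPairs, Finset.mem_filter, Finset.mem_product] at he ⊢
    exact ⟨⟨he.1.2, he.1.1⟩, he.2.symm⟩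
  · intro e he
    simp only [offPairs, Finset.mem_filter, Finset.mem_product] at he ⊢
    exact ⟨⟨he.1.2, he.1.1⟩, he.2.symm⟩
  · simp
  · simp
  · intro e _
    exact near_comm _ _ _

theorem card_offPairs_le {n : ℕ} (A B : Finset (Fin n)) :
    ((offPairs A B).card : ℝ) ≤ A.card * B.card := by
  rw [← Nat.cast_mul, ← Finset.card_product]
  exact_mod_cast Finset.card_filter_le _ _

theorem le_card_offPairs {n : ℕ} (A B : Finset (Fin n)) :
    (A.card * B.card : ℝ) - A.card ≤ (offPairs A B).card := by
  have h := Finset.card_filter_add_card_filter_not (s := A ×ˢ B) (fun e : Fin n × Fin n => e.1 ≠ e.2)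
  have h2 : ((A ×ˢ B).filter fun e : Fin n × Fin n => ¬ e.1 ≠ e.2).card ≤ A.card := by
    refine Finset.card_le_card_of_injOn (fun e => e.1) ?_ ?_
    · intro e he
      exact (Finset.mem_product.1 (Finset.mem_filter.1 he).1).1
    · intro a ha b hb hab
      have ha' := (Finset.mem_filter.1 ha).2
      have hb' := (Finset.mem_filter.1 hb).2
      push Not at ha' hb'
      exact Prod.ext hab (by rw [← ha', ← hb']; exact hab)
  rw [Finset.card_product] at h
  have h3 : A.card * B.card ≤ (offPairs A B).card + A.card := by
    unfold offPairs; omega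
  have : (A.card * B.card : ℝ) ≤ (offPairs A B).card + A.card := by exact_mod_cast h3
  linarith

theorem nearProb_nonneg (W : ℝ) : 0 ≤ nearProb W := measureReal_nonneg

theorem nearProb_le_one (W : ℝ) : nearProb W ≤ 1 := measureReal_le_one

theorem nearProb_two_mul_le {W : ℝ} (hW : 0 ≤ W) : nearProb (2 * W) ≤ 2 * nearProb W := by
  rw [nearProb_eq hW, nearProb_eq (by linarith)]
  rcases le_total 1 (W / Real.pi) with h | h
  · rw [min_eq_left h]; linarith [min_le_left 1 (2 * W / Real.pi)]
  · rw [min_eq_right h]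
    calc _ ≤ 2 * W / Real.pi := min_le_right _ _
      _ = _ := by ring

/-- The error of `offPairs_tail` grows with `|A| * nearProb W`, the expected degree into the smaller
side. It is absorbed by the main term if `|B|` exceeds the polylogarithmic factor; otherwise `|A|
|B|` itself is below the additive error. -/
theorem offPairs_tail_of_card_le {n L : ℕ} (hL : n ≤ 2 ^ L) (hL1 : 1 ≤ L) {A B : Finset (Fin n)}
    (hAB : A.card ≤ B.card) {W s : ℝ} (hW : 0 ≤ W) (hs : 1 ≤ s) :
    anglesLaw (Fin n) {ϑ | ¬ (nearSum (offPairs A B) W ϑ ≤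
        4 * (A.card * B.card * nearProb W) + (64 * L * s) ^ 2 ∧
      A.card * B.card * nearProb W / 8 - (64 * L * s) ^ 2 ≤ nearSum (offPairs A B) W ϑ)} ≤
      (n + 4 * L : ℕ) * ENNReal.ofReal (Real.exp (-s)) := by
  refine (measure_mono fun ϑ hϑ => ?_).trans
    (offPairs_tail hL A B (W := W) (s := s) (by linarith) rfl)
  refine fun hcon => hϑ ?_
  obtain ⟨h1, h2⟩ := hcon
  have hq := nearProb_nonneg W
  have hq1 := nearProb_le_one W
  have hq2 := nearProb_two_mul_le hW
  have hc1 := card_offPairs_le A B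
  have hc2 := le_card_offPairs A B
  have hL1' : (1 : ℝ) ≤ L := by exact_mod_cast hL1
  have hAB' : (A.card : ℝ) ≤ B.card := by exact_mod_cast hAB
  have ha : (0 : ℝ) ≤ A.card := Nat.cast_nonneg _
  have hb : (0 : ℝ) ≤ B.card := Nat.cast_nonneg _
  have hP : (0 : ℝ) ≤ (offPairs A B).card := Nat.cast_nonneg _
  have hSP : nearSum (offPairs A B) W ϑ ≤ (offPairs A B).card := by
    calc nearSum (offPairs A B) W ϑ ≤ ∑ e ∈ offPairs A B, (1 : ℝ) :=
          Finset.sum_le_sum fun _ _ => near_le_one _ _ _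
      _ = _ := by simp
  have hS0 : 0 ≤ nearSum (offPairs A B) W ϑ := Finset.sum_nonneg fun _ _ => near_nonneg _ _ _
  generalize nearSum (offPairs A B) W ϑ = S at *
  generalize ((offPairs A B).card : ℝ) = M at *
  generalize (A.card : ℝ) = a at *
  generalize (B.card : ℝ) = b at *
  generalize nearProb (2 * W) = q2 at *
  generalize nearProb W = q at *
  generalize (L : ℝ) = l at *
  set x := l * s with hx
  have hx1 : 1 ≤ x := by nlinarith
  -- The threshold `64 x` below turns `8 a q x` into at most `a b q / 8`; replacing `M` by `a b` in
  -- the lower bound costs another half.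
  have hD : 2 * l * ((1 + (2 * (a * q2) + s)) * s) ≤ 8 * (a * q) * x + 4 * x ^ 2 := by
    have e1 : 2 * l * ((1 + (2 * (a * q2) + s)) * s) = 2 * x + 4 * (a * q2) * x + 2 * (s * x) := by
      rw [hx]; ring
    have e2 : a * q2 ≤ 2 * (a * q) := by
      have := mul_le_mul_of_nonneg_left hq2 ha; linarith
    have e3 : s ≤ x := by rw [hx]; nlinarith
    have e4 : 4 * (a * q2) * x ≤ 4 * (2 * (a * q)) * x := by gcongr
    have e5 : s * x ≤ x * x := by gcongr
    nlinarith
  have hMq : M * q ≤ a * b * q := mul_le_mul_of_nonneg_right hc1 hq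
  have haq : 0 ≤ a * q := mul_nonneg ha hq
  rw [show 64 * l * s = 64 * x by rw [hx]; ring]
  rcases le_total (64 * x) b with hbx | hbx
  · have h3 : (a * q) * (64 * x) ≤ (a * q) * b := mul_le_mul_of_nonneg_left hbx haq
    have h4 : 2 * (a * q) ≤ (a * q) * b := by
      have := mul_le_mul_of_nonneg_left (show 2 ≤ b by linarith) haq; linarith
    have h5 : (a * b - a) * q ≤ M * q := mul_le_mul_of_nonneg_right hc2 hq
    constructor <;> nlinarith
  · have h6 : a * b ≤ (64 * x) ^ 2 := by
      rw [sq]; exact mul_le_mul (hAB'.trans hbx) hbx hb (by linarith)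
    have h7 : a * b * q ≤ a * b := mul_le_of_le_one_right (mul_nonneg ha hb) hq1
    have h8 : 0 ≤ a * b * q := mul_nonneg (mul_nonneg ha hb) hq
    constructor <;> linarith

/-- The number of pairs of points within distance `W` is concentrated up to constant factors and
a polylogarithmic error. -/
theorem nearSum_offPairs_concentration {n L : ℕ} (hL : n ≤ 2 ^ L) (hL1 : 1 ≤ L)
    (A B : Finset (Fin n)) {W s : ℝ} (hW : 0 ≤ W) (hs : 1 ≤ s) :
    anglesLaw (Fin n) {ϑ | ¬ (nearSum (offPairs A B) W ϑ ≤
        4 * (A.card * B.card * nearProb W) + (64 * L * s) ^ 2 ∧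
      A.card * B.card * nearProb W / 8 - (64 * L * s) ^ 2 ≤ nearSum (offPairs A B) W ϑ)} ≤
      (n + 4 * L : ℕ) * ENNReal.ofReal (Real.exp (-s)) := by
  rcases le_total A.card B.card with h | h
  · exact offPairs_tail_of_card_le hL hL1 h hW hs
  · have := offPairs_tail_of_card_le hL hL1 h hW hs
    simpa only [nearSum_offPairs_comm B A, mul_comm (B.card : ℝ)] using this

/-! ### The joint law of placed angles and annuli. -/

/-- The annulus that contains the radius `r`. -/
def annulus (p : Params) (r : ℝ) : ℕ := ⌊r * numAnnuli p / p.R⌋₊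

theorem measurable_annulus (p : Params) : Measurable (annulus p) :=
  Nat.measurable_floor.comp ((measurable_id.mul_const _).div_const _)

/-- The position of a vertex with variates `(x, r)`, as an angle modulo `2π` and an annulus. -/
def placed (p : Params) (y : ℝ × ℝ) : Circ × ℕ :=
  (((if y.2 < cliqueRadius p then y.1
    else y.1 + deltaTheta p.R y.2 (lowerBoundary p y.2) : ℝ) : Circ), annulus p y.2)

theorem map_mk_angleLaw : MeasurePreserving (fun x : ℝ => (x : Circ)) angleLaw circLaw := by
  refine ⟨AddCircle.measurable_mk', ?_⟩
  have h := (AddCircle.measurePreserving_mk (2 * Real.pi) 0).map_eq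
  rw [zero_add, ← restrict_Ico_eq_restrict_Ioc] at h
  rw [angleLaw, ProbabilityTheory.cond, Measure.map_smul]
  have h' : Measure.map (fun x : ℝ => (x : Circ)) (volume.restrict (Set.Ico 0 (2 * Real.pi))) =
    volume := h
  have h0 : ENNReal.ofReal (2 * Real.pi) ≠ 0 := by
    rw [Ne, ENNReal.ofReal_eq_zero, not_le]; exact Real.two_pi_pos
  rw [h', AddCircle.volume_eq_smul_haarAddCircle, Real.volume_Ico, sub_zero, smul_smul,
    ENNReal.inv_mul_cancel h0 ENNReal.ofReal_ne_top, one_smul]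

theorem map_mk_add_angleLaw (t : ℝ) :
    Measure.map (fun x : ℝ => ((x + t : ℝ) : Circ)) angleLaw = circLaw := by
  have h := (measurePreserving_add_right circLaw (t : Circ)).comp map_mk_angleLaw
  have : (fun x : ℝ => ((x + t : ℝ) : Circ)) = (fun x => x + (t : Circ)) ∘ fun x : ℝ => (x : Circ) := by
    ext x; simp
  rw [this]
  exact h.map_eq

theorem measurable_deltaTheta (p : Params) :
    Measurable fun r => deltaTheta p.R r (lowerBoundary p r) := by
  have hl : Measurable (lowerBoundary p) := by
    have : Measurable fun n : ℕ => boundary p n := measurable_from_top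
    exact this.comp (measurable_annulus p)
  refine Measurable.ite (measurableSet_lt (measurable_id.add hl) measurable_const)
    measurable_const (Real.continuous_arccos.measurable.comp ?_)
  exact (((Real.measurable_cosh).mul (Real.measurable_cosh.comp hl)).sub_const _).div
    (Real.measurable_sinh.mul (Real.measurable_sinh.comp hl))

instance : IsProbabilityMeasure angleLaw :=
  ProbabilityTheory.cond_isProbabilityMeasure_of_finite (by simp [Real.pi_pos])
    (by rw [Real.volume_Ico]; exact ENNReal.ofReal_ne_top)

/-- The law of the annulus of a vertex. -/
def annulusLaw (p : Params) : Measure ℕ := (radialLaw p.α p.R).map (annulus p)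

/-- Placement rotates the angle by an amount that depends on the radius only. Rotations preserve the
uniform law, so the placed angle stays uniform and independent of the annulus. -/
theorem measurePreserving_placed (p : Params) [IsProbabilityMeasure (radialLaw p.α p.R)] :
    MeasurePreserving (placed p) (angleLaw.prod (radialLaw p.α p.R))
      (circLaw.prod (annulusLaw p)) := by
  have : IsProbabilityMeasure (annulusLaw p) :=
    Measure.isProbabilityMeasure_map (measurable_annulus p).aemeasurable
  set t : ℝ → ℝ := fun r => if r < cliqueRadius p then 0
    else deltaTheta p.R r (lowerBoundary p r) with ht
  have htm : Measurable t := Measurable.ite measurableSet_Iio measurable_const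
    (measurable_deltaTheta p)
  have h1 : MeasurePreserving (fun q : ℝ × ℝ => (annulus p q.1, ((q.2 + t q.1 : ℝ) : Circ)))
      ((radialLaw p.α p.R).prod angleLaw) ((annulusLaw p).prod circLaw) := by
    refine MeasurePreserving.skew_product (f := annulus p)
      (g := fun r x => ((x + t r : ℝ) : Circ)) ⟨measurable_annulus p, rfl⟩ ?_ ?_
    · exact AddCircle.measurable_mk'.comp (measurable_snd.add (htm.comp measurable_fst))
    · exact ae_of_all _ fun r => map_mk_add_angleLaw (t r)
  have h2 := (Measure.measurePreserving_swap (μ := annulusLaw p) (ν := circLaw)).comp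
    (h1.comp (Measure.measurePreserving_swap (μ := angleLaw) (ν := radialLaw p.α p.R)))
  convert h2 using 1
  ext y
  · simp only [placed, ht, Function.comp, Prod.swap]
    split_ifs <;> simp
  · rfl

/-- The angles modulo `2π` and the annuli of all vertices. -/
def configuration (p : Params) (ω : Fin p.n → ℝ × ℝ) : (Fin p.n → Circ) × (Fin p.n → ℕ) :=
  (fun v => (placed p (ω v)).1, fun v => (placed p (ω v)).2)

theorem measurePreserving_configuration (p : Params)
    [IsProbabilityMeasure (radialLaw p.α p.R)] :
    MeasurePreserving (configuration p) (sampleLaw p)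
      ((anglesLaw (Fin p.n)).prod (Measure.pi fun _ => annulusLaw p)) := by
  have : IsProbabilityMeasure (annulusLaw p) :=
    Measure.isProbabilityMeasure_map (measurable_annulus p).aemeasurable
  have h1 := measurePreserving_pi (fun _ : Fin p.n => angleLaw.prod (radialLaw p.α p.R))
    (fun _ : Fin p.n => circLaw.prod (annulusLaw p)) fun _ => measurePreserving_placed p
  exact (measurePreserving_arrowProdEquivProdArrow Circ ℕ (Fin p.n) (fun _ => circLaw)
    (fun _ => annulusLaw p)).comp h1

/-- Summing over the values of the discrete coordinate replaces Fubini, so the joint event needs no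
measurability. -/
theorem prod_le_of_forall_section_le {α β : Type*} [MeasurableSpace α] [MeasurableSpace β]
    [Countable β] [MeasurableSingletonClass β] {μ : Measure α} [IsProbabilityMeasure μ]
    {ν : Measure β} [IsProbabilityMeasure ν] {B : β → Set α} {ε : ENNReal}
    (h : ∀ b, μ (B b) ≤ ε) : μ.prod ν {q | q.1 ∈ B q.2} ≤ ε := by
  have hsub : {q : α × β | q.1 ∈ B q.2} ⊆ ⋃ b, B b ×ˢ {b} := fun q hq =>
    Set.mem_iUnion.2 ⟨q.2, hq, rfl⟩
  have hone : ∑' b, ν {b} = 1 := by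
    rw [← measure_iUnion (fun a b hab => Set.disjoint_singleton.2 hab)
      fun b => measurableSet_singleton b, Set.iUnion_of_singleton, measure_univ]
  calc μ.prod ν {q | q.1 ∈ B q.2} ≤ ∑' b, μ.prod ν (B b ×ˢ {b}) :=
        (measure_mono hsub).trans (measure_iUnion_le _)
    _ ≤ ∑' b, ε * ν {b} := ENNReal.tsum_le_tsum fun b => by
        rw [Measure.prod_prod]; exact mul_le_mul_left (h b) _
    _ = ε := by rw [ENNReal.tsum_mul_left, hone, mul_one]

/-! ### Geometric decay of the radial law over the annuli. -/

theorem cosh_sub_one_le {x y : ℝ} (hx : 0 ≤ x) (hxy : x ≤ y) :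
    Real.cosh x - 1 ≤ Real.exp (-(y - x)) * (Real.cosh y - 1) := by
  -- In this form the exponential growth is split off and the remaining factor is increasing for `z
  -- ≥ 0`.
  have h1 : ∀ z : ℝ, Real.cosh z - 1 = Real.exp z * (1 - Real.exp (-z)) ^ 2 / 2 := by
    intro z
    have : Real.exp z * Real.exp (-z) = 1 := by rw [← Real.exp_add]; simp
    rw [Real.cosh_eq]
    linear_combination (-1 + Real.exp (-z) / 2) * (-this)
  rw [h1, h1]
  have h2 : Real.exp (-(y - x)) * Real.exp y = Real.exp x := by rw [← Real.exp_add]; ring_nf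
  have h3 : 0 ≤ 1 - Real.exp (-x) := by
    have := Real.exp_le_one_iff.2 (neg_nonpos.2 hx); linarith
  have h4 : 1 - Real.exp (-x) ≤ 1 - Real.exp (-y) := by
    have := Real.exp_le_exp.2 (neg_le_neg hxy); linarith
  calc _ ≤ Real.exp x * (1 - Real.exp (-y)) ^ 2 / 2 := by gcongr
    _ = _ := by rw [← h2]; ring

theorem radialLaw_Iio_le {α R b : ℝ} (hα : 0 < α) (hR : 0 < R) (hb : 0 ≤ b) (hbR : b ≤ R) :
    radialLaw α R (Set.Iio b) ≤ ENNReal.ofReal (Real.exp (-(α * (R - b)))) := by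
  have hpos : 0 < Real.cosh (α * R) - 1 := by
    have := Real.one_lt_cosh.2 (mul_pos hα hR).ne'
    linarith
  have hcont : Continuous (radialDensity α R) := by
    unfold radialDensity
    fun_prop
  have hint : ∫ r in (0 : ℝ)..b, radialDensity α R r =
      (Real.cosh (α * b) - 1) / (Real.cosh (α * R) - 1) := by
    have hd : ∀ r ∈ Set.uIcc 0 b, HasDerivAt
        (fun r => Real.cosh (α * r) / (Real.cosh (α * R) - 1)) (radialDensity α R r) r := by
      intro r _
      have h := (((hasDerivAt_id r).const_mul α).cosh).div_const (Real.cosh (α * R) - 1)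
      simpa [radialDensity, mul_comm] using h
    rw [intervalIntegral.integral_eq_sub_of_hasDerivAt hd (hcont.intervalIntegrable _ _)]
    rw [← sub_div]
    simp
  have hset : Set.Iio b ∩ Set.Ico 0 R = Set.Ico 0 b := by
    ext x; simp only [Set.mem_inter_iff, Set.mem_Iio, Set.mem_Ico]
    constructor
    · rintro ⟨h1, h2, h3⟩; exact ⟨h2, h1⟩
    · rintro ⟨h1, h2⟩; exact ⟨h2, h1, h2.trans_le hbR⟩
  rw [radialLaw, withDensity_apply _ measurableSet_Iio,
    Measure.restrict_restrict measurableSet_Iio, hset,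
    restrict_Ico_eq_restrict_Ioc, ← ofReal_integral_eq_lintegral_ofReal,
    ← intervalIntegral.integral_of_le hb, hint]
  · refine ENNReal.ofReal_le_ofReal ((div_le_iff₀ hpos).2 ?_)
    have := cosh_sub_one_le (mul_nonneg hα.le hb) (mul_le_mul_of_nonneg_left hbR hα.le)
    rwa [← mul_sub] at this
  · exact (hcont.intervalIntegrable 0 b).1
  · filter_upwards [ae_restrict_mem measurableSet_Ioc] with r hr
    have : 0 ≤ Real.sinh (α * r) := Real.sinh_nonneg_iff.2 (mul_pos hα hr.1).le
    exact div_nonneg (mul_nonneg hα.le this) hpos.le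

theorem radialLaw_compl_Ico (α R : ℝ) : radialLaw α R (Set.Ico 0 R)ᶜ = 0 := by
  rw [radialLaw, withDensity_apply _ measurableSet_Ico.compl,
    Measure.restrict_restrict measurableSet_Ico.compl]
  simp

/-- Nondegenerate parameters. -/
structure Params.Valid (p : Params) : Prop where
  α_pos : 0 < p.α
  log_two_le : Real.log 2 ≤ p.α * p.R

section

variable {p : Params}

theorem Params.Valid.R_pos (h : p.Valid) : 0 < p.R := by
  have h1 := (Real.log_pos one_lt_two).trans_le h.log_two_le
  exact (pos_iff_pos_of_mul_pos h1).1 h.α_pos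

theorem Params.Valid.numAnnuli_pos (h : p.Valid) : 0 < numAnnuli p := by
  rw [numAnnuli, Nat.floor_pos, one_le_div (Real.log_pos one_lt_two)]
  exact h.log_two_le

theorem Params.Valid.numAnnuli_mul_log_le (h : p.Valid) :
    numAnnuli p * Real.log 2 ≤ p.α * p.R := by
  rw [← le_div_iff₀ (Real.log_pos one_lt_two)]
  exact Nat.floor_le (div_nonneg (mul_nonneg h.α_pos.le h.R_pos.le) (Real.log_pos one_lt_two).le)

theorem le_annulus_iff (h : p.Valid) {r : ℝ} (hr : 0 ≤ r) (j : ℕ) :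
    j ≤ annulus p r ↔ boundary p j ≤ r := by
  have hk : (0 : ℝ) < numAnnuli p := by exact_mod_cast h.numAnnuli_pos
  have hR := h.R_pos
  rw [annulus, Nat.le_floor_iff (by positivity), boundary, le_div_iff₀ hR, div_le_iff₀ hk]

theorem annulus_lt_iff (h : p.Valid) {r : ℝ} (hr : 0 ≤ r) (j : ℕ) :
    annulus p r < j ↔ r < boundary p j := by
  rw [← not_le, le_annulus_iff h hr, not_le]

theorem boundary_numAnnuli (h : p.Valid) : boundary p (numAnnuli p) = p.R := by
  have hk : (0 : ℝ) < numAnnuli p := by exact_mod_cast h.numAnnuli_pos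
  rw [boundary, mul_div_cancel_left₀ _ hk.ne']

theorem boundary_nonneg (h : p.Valid) (j : ℕ) : 0 ≤ boundary p j := by
  have := h.R_pos; unfold boundary; positivity

theorem boundary_mono (h : p.Valid) : Monotone (boundary p) := by
  intro i j hij
  have := h.R_pos
  unfold boundary
  gcongr

theorem isProbabilityMeasure_radialLaw' (h : p.Valid) :
    IsProbabilityMeasure (radialLaw p.α p.R) := isProbabilityMeasure_radialLaw h.α_pos h.R_pos

theorem isProbabilityMeasure_annulusLaw (h : p.Valid) : IsProbabilityMeasure (annulusLaw p) :=
  have := isProbabilityMeasure_radialLaw' h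
  Measure.isProbabilityMeasure_map (measurable_annulus p).aemeasurable

/-- The floor in `numAnnuli` makes an annulus wide enough that `α` times its width is at least `log
2`. Each annulus further in thus halves the bound. -/
theorem annulusLaw_Iic_le (h : p.Valid) {j : ℕ} (hj : j < numAnnuli p) :
    annulusLaw p (Set.Iic j) ≤ ENNReal.ofReal ((1 / 2) ^ (numAnnuli p - 1 - j)) := by
  rw [annulusLaw, Measure.map_apply (measurable_annulus p) measurableSet_Iic]
  have hb : boundary p (j + 1) ≤ p.R := by
    rw [← boundary_numAnnuli h]; exact boundary_mono h hj
  have hk : (0 : ℝ) < numAnnuli p := by exact_mod_cast h.numAnnuli_pos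
  have hsub : annulus p ⁻¹' Set.Iic j ⊆ Set.Iio (boundary p (j + 1)) ∪ (Set.Ico 0 p.R)ᶜ := by
    intro r hr
    by_cases h0 : 0 ≤ r
    · exact Or.inl ((annulus_lt_iff h h0 _).1 (Nat.lt_succ_of_le hr))
    · exact Or.inr fun hc => h0 hc.1
  refine (measure_mono hsub).trans ((measure_union_le _ _).trans ?_)
  rw [radialLaw_compl_Ico, add_zero]
  refine (radialLaw_Iio_le h.α_pos h.R_pos (boundary_nonneg h _) hb).trans
    (ENNReal.ofReal_le_ofReal ?_)
  have h2 : ((1 : ℝ) / 2) ^ (numAnnuli p - 1 - j) =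
      Real.exp (-((numAnnuli p - 1 - j : ℕ) * Real.log 2)) := by
    rw [Real.exp_neg, Real.exp_nat_mul, Real.exp_log two_pos, one_div, inv_pow]
  rw [h2]
  refine Real.exp_le_exp.2 (neg_le_neg ?_)
  have h3 : p.R - boundary p (j + 1) = p.R / numAnnuli p * (numAnnuli p - 1 - j : ℕ) := by
    rw [boundary, Nat.sub_sub, Nat.cast_sub (by omega)]
    push_cast; field_simp; ring
  have h4 : Real.log 2 ≤ p.α * (p.R / numAnnuli p) := by
    rw [← mul_div_assoc, le_div_iff₀ hk, mul_comm]
    exact h.numAnnuli_mul_log_le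
  rw [h3, ← mul_assoc, mul_comm]
  exact mul_le_mul_of_nonneg_right h4 (Nat.cast_nonneg _)

theorem annulusLaw_Ici_eq_zero (h : p.Valid) : annulusLaw p (Set.Ici (numAnnuli p)) = 0 := by
  rw [annulusLaw, Measure.map_apply (measurable_annulus p) measurableSet_Ici]
  refine measure_mono_null (fun r hr => ?_) (radialLaw_compl_Ico p.α p.R)
  intro hc
  have := (le_annulus_iff h hc.1 _).1 hr
  rw [boundary_numAnnuli h] at this
  exact absurd hc.2 (not_lt.2 this)

/-- All annuli before the last one together have mass at most `1/2`, by the halving from one annulus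
to the next. -/
theorem half_le_annulusLaw_last (h : p.Valid) :
    1 / 2 ≤ (annulusLaw p).real {numAnnuli p - 1} := by
  have := isProbabilityMeasure_annulusLaw h
  have hk := h.numAnnuli_pos
  have h1 : (annulusLaw p).real (Set.Iio (numAnnuli p - 1)) ≤ 1 / 2 := by
    rcases Nat.eq_zero_or_pos (numAnnuli p - 1) with h0 | h0
    · rw [h0]; simp
    · have hI : Set.Iio (numAnnuli p - 1) = Set.Iic (numAnnuli p - 2) := by
        ext x; simp only [Set.mem_Iio, Set.mem_Iic]; omega
      have := ENNReal.toReal_mono ENNReal.ofReal_ne_top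
        (annulusLaw_Iic_le h (j := numAnnuli p - 2) (by omega))
      rw [show numAnnuli p - 1 - (numAnnuli p - 2) = 1 by omega, pow_one,
        ENNReal.toReal_ofReal (by norm_num)] at this
      rw [hI]; exact this
  have h2 : (annulusLaw p).real (Set.Ici (numAnnuli p)) = 0 := by
    rw [measureReal_def, annulusLaw_Ici_eq_zero h]; rfl
  have h3 : (1 : ℝ) ≤ (annulusLaw p).real (Set.Iio (numAnnuli p - 1)) +
      ((annulusLaw p).real {numAnnuli p - 1} + (annulusLaw p).real (Set.Ici (numAnnuli p))) := by
    have hu : (Set.univ : Set ℕ) ⊆ Set.Iio (numAnnuli p - 1) ∪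
        ({numAnnuli p - 1} ∪ Set.Ici (numAnnuli p)) := by
      intro x _
      simp only [Set.mem_union, Set.mem_Iio, Set.mem_singleton_iff, Set.mem_Ici]; omega
    calc (1 : ℝ) = (annulusLaw p).real Set.univ := by simp
      _ ≤ _ := measureReal_mono hu
      _ ≤ _ := (measureReal_union_le _ _).trans
        (add_le_add le_rfl (measureReal_union_le _ _))
  linarith

/-- The depth of a vertex is the number of annuli `j` at or outside its own, so its mean is the sum
of the masses of `Set.Iic j`, bounded by a geometric series. -/
theorem integral_depth_le (h : p.Valid) :
    ∫ t, ((numAnnuli p - t : ℕ) : ℝ) ∂annulusLaw p ≤ 2 := by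
  have := isProbabilityMeasure_annulusLaw h
  have h1 : ∀ t : ℕ, ((numAnnuli p - t : ℕ) : ℝ) =
      ∑ j ∈ Finset.range (numAnnuli p), (Set.Iic j).indicator (1 : ℕ → ℝ) t := by
    intro t
    simp only [Set.indicator, Set.mem_Iic, Pi.one_apply]
    rw [Finset.sum_ite, Finset.sum_const_zero, add_zero, Finset.sum_const, nsmul_eq_mul, mul_one]
    congr 1
    rw [show (Finset.range (numAnnuli p)).filter (fun j => t ≤ j) = Finset.Ico t (numAnnuli p) by
      ext x; simp only [Finset.mem_filter, Finset.mem_range, Finset.mem_Ico]; omega]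
    simp
  simp only [h1]
  rw [integral_finsetSum _ fun j _ => IntegrableOn.integrable_indicator (f := (1 : ℕ → ℝ))
    (integrable_const (1 : ℝ)).integrableOn measurableSet_Iic]
  simp only [integral_indicator_one measurableSet_Iic]
  calc ∑ j ∈ Finset.range (numAnnuli p), (annulusLaw p).real (Set.Iic j)
      ≤ ∑ j ∈ Finset.range (numAnnuli p), ((1 : ℝ) / 2) ^ (numAnnuli p - 1 - j) := by
        refine Finset.sum_le_sum fun j hj => ?_
        have := ENNReal.toReal_mono ENNReal.ofReal_ne_top
          (annulusLaw_Iic_le h (Finset.mem_range.1 hj))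
        rwa [ENNReal.toReal_ofReal (by positivity)] at this
    _ = ∑ j ∈ Finset.range (numAnnuli p), ((1 : ℝ) / 2) ^ j :=
        Finset.sum_range_reflect (fun j => ((1 : ℝ) / 2) ^ j) _
    _ ≤ 2 := by
        have := Summable.sum_le_tsum (Finset.range (numAnnuli p))
          (fun i _ => by positivity) summable_geometric_two
        rwa [tsum_geometric_two] at this

/-- The law of the annuli of all vertices. -/
abbrev annuliLaw (p : Params) : Measure (Fin p.n → ℕ) := Measure.pi fun _ => annulusLaw p

theorem sum_depth_tail (h : p.Valid) (s : ℝ) :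
    annuliLaw p {τ | 4 * p.n + numAnnuli p * s ≤ ∑ v, ((numAnnuli p - τ v : ℕ) : ℝ)} ≤
      ENNReal.ofReal (Real.exp (-s)) := by
  have := isProbabilityMeasure_annulusLaw h
  have hk : (0 : ℝ) < numAnnuli p := by exact_mod_cast h.numAnnuli_pos
  have := pi_chernoff_upper (μ := fun _ : Fin p.n => annulusLaw p)
    (f := fun _ t => ((numAnnuli p - t : ℕ) : ℝ)) (fun _ => measurable_from_top)
    (fun _ _ => Nat.cast_nonneg _) hk (fun _ t => by exact_mod_cast Nat.sub_le _ _)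
    (m := 2 * p.n) (by
      calc _ ≤ ∑ _v : Fin p.n, (2 : ℝ) := Finset.sum_le_sum fun _ _ => integral_depth_le h
        _ = _ := by simp [mul_comm]) s
  refine (measure_mono fun τ hτ => ?_).trans this
  have hτ' : 4 * p.n + numAnnuli p * s ≤ ∑ v, ((numAnnuli p - τ v : ℕ) : ℝ) := hτ
  simp only [Set.mem_ofPred_eq]
  linarith

theorem card_last_tail (h : p.Valid) (s : ℝ) :
    annuliLaw p {τ | ((Finset.univ.filter fun v => τ v = numAnnuli p - 1).card : ℝ) ≤
      p.n / 4 - s} ≤ ENNReal.ofReal (Real.exp (-s)) := by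
  have := isProbabilityMeasure_annulusLaw h
  have := pi_chernoff_lower (μ := fun _ : Fin p.n => annulusLaw p)
    (f := fun _ t => if t = numAnnuli p - 1 then (1 : ℝ) else 0) (fun _ => measurable_from_top)
    (fun _ t => by split_ifs <;> norm_num) one_pos (fun _ t => by split_ifs <;> norm_num)
    (m := p.n / 2) (by
      have h1 : ∫ t, (if t = numAnnuli p - 1 then (1 : ℝ) else 0) ∂annulusLaw p =
          (annulusLaw p).real {numAnnuli p - 1} := by
        rw [← integral_indicator_one (measurableSet_singleton _)]
        congr 1
        ext t
        simp [Set.indicator]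
      calc (p.n : ℝ) / 2 = ∑ _v : Fin p.n, (1 / 2 : ℝ) := by
            rw [Finset.sum_const, Finset.card_univ, Fintype.card_fin, nsmul_eq_mul]; ring
        _ ≤ _ := Finset.sum_le_sum fun _ _ => by rw [h1]; exact half_le_annulusLaw_last h) s
  refine (measure_mono fun τ hτ => ?_).trans this
  have hτ' : ((Finset.univ.filter fun v => τ v = numAnnuli p - 1).card : ℝ) ≤ p.n / 4 - s := hτ
  simp only [Set.mem_ofPred_eq, Finset.sum_boole]
  linarith

end

/-! ### Hyperbolic geometry: adjacency and request widths on the scale of two annuli. -/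

section

variable {p : Params}

/-- The angular scale at which points of the annuli `i` and `j` become adjacent. -/
def scale (p : Params) (i j : ℕ) : ℝ :=
  min 1 (Real.exp ((p.R - boundary p i - boundary p j) / 2))

theorem scale_nonneg (p : Params) (i j : ℕ) : 0 ≤ scale p i j :=
  le_min zero_le_one (Real.exp_pos _).le

theorem scale_le_one (p : Params) (i j : ℕ) : scale p i j ≤ 1 := min_le_left _ _

theorem scale_sq (p : Params) (i j : ℕ) :
    scale p i j ^ 2 = min 1 (Real.exp (p.R - boundary p i - boundary p j)) := by
  have h : Real.exp (p.R - boundary p i - boundary p j) =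
      Real.exp ((p.R - boundary p i - boundary p j) / 2) ^ 2 := by
    rw [← Real.exp_nat_mul]; congr 1; push_cast; ring
  rw [h, scale]
  generalize hx : Real.exp ((p.R - boundary p i - boundary p j) / 2) = x
  have hx0 : 0 ≤ x := hx ▸ (Real.exp_pos _).le
  rcases le_total 1 x with h1 | h1
  · rw [min_eq_left h1, min_eq_left (one_le_pow₀ h1), one_pow]
  · rw [min_eq_right h1, min_eq_right (pow_le_one₀ hx0 h1)]

/-- Half of a lower bound on the width of the annuli, depending on `α` only. -/
def margin (α : ℝ) : ℝ := Real.log 2 / α / 2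

theorem margin_pos {α : ℝ} (hα : 0 < α) : 0 < margin α :=
  half_pos (div_pos (Real.log_pos one_lt_two) hα)

/-- A constant in `(0, 1)` depending on `α` only. -/
def marginGap (α : ℝ) : ℝ := 1 - Real.exp (-margin α)

theorem marginGap_pos {α : ℝ} (hα : 0 < α) : 0 < marginGap α := by
  have := Real.exp_lt_exp.2 (neg_lt_zero.2 (margin_pos hα))
  rw [Real.exp_zero] at this
  unfold marginGap; linarith

theorem marginGap_lt_one (α : ℝ) : marginGap α < 1 := by
  have := Real.exp_pos (-margin α); unfold marginGap; linarith

theorem Params.Valid.two_margin_le_width (h : p.Valid) :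
    2 * margin p.α ≤ p.R / numAnnuli p := by
  have hk : (0 : ℝ) < numAnnuli p := by exact_mod_cast h.numAnnuli_pos
  have hα := h.α_pos
  rw [margin, mul_div_cancel₀ _ two_ne_zero, div_le_div_iff₀ hα hk]
  linarith [h.numAnnuli_mul_log_le]

theorem Params.Valid.width_le (h : p.Valid) : p.R / numAnnuli p ≤ 4 * margin p.α := by
  have hk : (1 : ℝ) ≤ numAnnuli p := by exact_mod_cast h.numAnnuli_pos
  have hα := h.α_pos
  -- With `k ≥ 1` annuli, rounding down loses at most a factor `2`, since `k + 1 ≤ 2k`.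
  have h1 : p.α * p.R / Real.log 2 < numAnnuli p + 1 := Nat.lt_floor_add_one _
  rw [div_lt_iff₀ (Real.log_pos one_lt_two)] at h1
  rw [margin, div_le_iff₀ (by linarith)]
  have h2 : (numAnnuli p + 1) * Real.log 2 ≤ (2 * numAnnuli p) * Real.log 2 :=
    mul_le_mul_of_nonneg_right (by linarith) (Real.log_pos one_lt_two).le
  have : p.R ≤ 2 * (Real.log 2 / p.α) * numAnnuli p := by
    rw [← mul_div_assoc, div_mul_eq_mul_div, le_div_iff₀ hα]; linarith
  linarith

theorem boundary_succ (p : Params) (j : ℕ) :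
    boundary p (j + 1) = boundary p j + p.R / numAnnuli p := by
  unfold boundary; push_cast; ring

theorem Params.Valid.width_le_R (h : p.Valid) : p.R / numAnnuli p ≤ p.R :=
  div_le_self h.R_pos.le (by exact_mod_cast h.numAnnuli_pos)

theorem two_margin_le_boundary (h : p.Valid) {j : ℕ} (hj : 0 < j) :
    2 * margin p.α ≤ boundary p j := by
  have h1 := boundary_mono h (Nat.one_le_iff_ne_zero.2 hj.ne')
  have h2 := boundary_succ p 0
  have h3 := boundary_nonneg h 0
  rw [zero_add] at h2
  linarith [h.two_margin_le_width]

/-- Convexity of a hyperbolic ball along a ray: a bound at radius `0` and at radius `r'` holds in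
between. The value at `r` is a combination of the two end values with weights `sinh (r' - r) / sinh
r'` and `sinh r / sinh r'`, whose sum is at most `1`. -/
theorem cosh_mul_sub_lt {r r' y z c : ℝ} (hr : 0 ≤ r) (hrr : r ≤ r') (hc : 0 ≤ c)
    (h0 : z < c) (h1 : Real.cosh r' * z - Real.sinh r' * y < c) :
    Real.cosh r * z - Real.sinh r * y < c := by
  rcases hrr.eq_or_lt with rfl | hlt
  · exact h1
  have hs' : 0 < Real.sinh r' := Real.sinh_pos_iff.2 (hr.trans_lt hlt)
  have hs : 0 ≤ Real.sinh r := Real.sinh_nonneg_iff.2 hr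
  have hd : 0 < Real.sinh (r' - r) := Real.sinh_pos_iff.2 (sub_pos.2 hlt)
  have hadd : Real.sinh (r' - r) + Real.sinh r ≤ Real.sinh r' := by
    have h := Real.sinh_add (r' - r) r
    rw [sub_add_cancel] at h
    nlinarith [Real.one_le_cosh r, Real.one_le_cosh (r' - r)]
  have hid : (Real.cosh r * z - Real.sinh r * y) * Real.sinh r' =
      z * Real.sinh (r' - r) + (Real.cosh r' * z - Real.sinh r' * y) * Real.sinh r := by
    rw [Real.sinh_sub]; ring
  have h2 : (Real.cosh r * z - Real.sinh r * y) * Real.sinh r' < c * Real.sinh r' := by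
    rw [hid]
    have e1 : z * Real.sinh (r' - r) < c * Real.sinh (r' - r) := mul_lt_mul_of_pos_right h0 hd
    have e2 := mul_le_mul_of_nonneg_right h1.le hs
    have e3 := mul_le_mul_of_nonneg_left hadd hc
    linarith
  exact lt_of_mul_lt_mul_right h2 hs'.le

/-- The room between `cosh (R - δ)` and `cosh R` is at least `e^R (1 - e^{-δ})² / 2`. -/
theorem cosh_sub_margin_lt {δ R ε : ℝ} (hδR : δ ≤ R)
    (hε : ε < (1 - Real.exp (-δ)) ^ 2 / 2) (hδ : 0 ≤ δ) :
    Real.cosh (R - δ) + ε * Real.exp R < Real.cosh R := by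
  have h1 : Real.exp (R - δ) = Real.exp R * Real.exp (-δ) := by rw [← Real.exp_add]; ring_nf
  have h2 : Real.exp (-(R - δ)) ≤ Real.exp R * Real.exp (-δ) := by
    rw [← Real.exp_add]; exact Real.exp_le_exp.2 (by linarith)
  have h3 : Real.exp (-R) = Real.exp (-(R - δ)) * Real.exp (-δ) := by
    rw [← Real.exp_add]; ring_nf
  have h4 : Real.exp (-δ) ≤ 1 := Real.exp_le_one_iff.2 (by linarith)
  have h5 := mul_lt_mul_of_pos_right hε (Real.exp_pos R)
  rw [Real.cosh_eq, Real.cosh_eq, h3, h1]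
  nlinarith [mul_nonneg (sub_nonneg.2 h2) (sub_nonneg.2 h4)]

theorem sinh_le_exp_half (x : ℝ) : Real.sinh x ≤ Real.exp x / 2 := by
  rw [Real.sinh_eq]; linarith [Real.exp_pos (-x)]

/-- For a point near the centre and one near the rim, `cosh (r - b)` leaves no room below `cosh R`.
So both points are first moved out to radius at least `δ`, where their radii differ by at most `R -
δ` and the room pays for the angle. `cosh_mul_sub_lt` then moves them back, one after the other. -/
theorem hypDist_lt_of_cos {R t r b x y : ℝ} {δ : ℝ} (hδ : 0 < δ) (hδR : δ < R)
    (hr : 0 ≤ r) (hrR : r < R) (hb : 0 ≤ b) (hbR : b < R) (hrx : max r δ ≤ x) (hby : max b δ ≤ y)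
    {ε : ℝ} (ht : 1 - ε * Real.exp (R - x - y) ≤ t) (ht1 : t ≤ 1)
    (hε : ε < 2 * (1 - Real.exp (-δ)) ^ 2) :
    Real.arcosh (Real.cosh r * Real.cosh b - Real.sinh r * Real.sinh b * t) < R := by
  have hcR : ∀ {z : ℝ}, 0 ≤ z → z < R → Real.cosh z < Real.cosh R := fun h0 h1 =>
    Real.cosh_lt_cosh.2 (by rwa [abs_of_nonneg h0, abs_of_nonneg (h0.trans h1.le)])
  have hc0 : 0 ≤ Real.cosh R := (Real.cosh_pos R).le
  set r' := max r δ with hr'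
  set b' := max b δ with hb'
  have hr'R : r' < R := max_lt hrR hδR
  have hb'R : b' < R := max_lt hbR hδR
  have hr'δ : δ ≤ r' := le_max_right _ _
  have hb'δ : δ ≤ b' := le_max_right _ _
  have main : Real.cosh r' * Real.cosh b' - Real.sinh r' * (Real.sinh b' * t) < Real.cosh R := by
    have e1 : Real.cosh (r' - b') ≤ Real.cosh (R - δ) := by
      refine Real.cosh_le_cosh.2 ?_
      rw [abs_of_nonneg (by linarith : (0 : ℝ) ≤ R - δ)]
      exact abs_le.2 ⟨by linarith, by linarith⟩
    have s1 : 0 ≤ Real.sinh r' := Real.sinh_nonneg_iff.2 (by linarith)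
    have s2 : 0 ≤ Real.sinh b' := Real.sinh_nonneg_iff.2 (by linarith)
    have e2 : Real.sinh r' * Real.sinh b' ≤ Real.exp x / 2 * (Real.exp y / 2) :=
      mul_le_mul ((sinh_le_exp_half _).trans (by gcongr)) ((sinh_le_exp_half _).trans (by gcongr))
        s2 (by positivity)
    have e3 : Real.sinh r' * Real.sinh b' * (1 - t) ≤
        Real.exp x / 2 * (Real.exp y / 2) * (ε * Real.exp (R - x - y)) :=
      mul_le_mul e2 (by linarith) (by linarith) (by positivity)
    have e4 : Real.exp x / 2 * (Real.exp y / 2) * (ε * Real.exp (R - x - y)) =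
        ε / 4 * Real.exp R := by
      have : Real.exp R = Real.exp x * Real.exp y * Real.exp (R - x - y) := by
        rw [← Real.exp_add, ← Real.exp_add]; ring_nf
      rw [this]; ring
    have e5 := cosh_sub_margin_lt (ε := ε / 4) hδR.le (by linarith) hδ.le
    have e6 := Real.cosh_sub r' b'
    linarith
  have step1 : Real.cosh r' * Real.cosh b - Real.sinh r' * (Real.sinh b * t) < Real.cosh R := by
    have := cosh_mul_sub_lt (r := b) (r' := b') (y := Real.sinh r' * t) (z := Real.cosh r') hb
      (le_max_left _ _) hc0 (hcR (by linarith) hr'R) (by linarith)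
    linarith
  have step2 := cosh_mul_sub_lt (r := r) (r' := r') hr (le_max_left _ _) hc0 (hcR hb hbR) step1
  have hone : 1 ≤ Real.cosh r * Real.cosh b - Real.sinh r * Real.sinh b * t := by
    have e1 := Real.cosh_sub r b
    have e2 := Real.one_le_cosh (r - b)
    have e3 := mul_le_mul_of_nonneg_left ht1
      (mul_nonneg (Real.sinh_nonneg_iff.2 hr) (Real.sinh_nonneg_iff.2 hb))
    linarith
  rw [← Real.arcosh_cosh (hr.trans hrR.le : 0 ≤ R)]
  refine (Real.arcosh_lt_arcosh (by linarith) (Real.cosh_pos R)).2 ?_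
  linarith

theorem one_sub_sq_le_cos_of_norm_le {x W : ℝ} (h : ‖(x : Circ)‖ ≤ W) :
    1 - W ^ 2 / 2 ≤ Real.cos x := by
  rw [AddCircle.norm_eq] at h
  rw [← Real.cos_sub_int_mul_two_pi x (round ((2 * Real.pi)⁻¹ * x))]
  refine le_trans ?_ Real.one_sub_sq_div_two_le_cos
  have := pow_le_pow_left₀ (abs_nonneg _) h 2
  rw [sq_abs] at this
  linarith

/-- Points at distance at most this constant times `scale` are adjacent. -/
def adjConst (α : ℝ) : ℝ := Real.exp (-(4 * margin α)) * marginGap α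

theorem adjConst_pos {α : ℝ} (hα : 0 < α) : 0 < adjConst α :=
  mul_pos (Real.exp_pos _) (marginGap_pos hα)

theorem adjConst_le_one {α : ℝ} (hα : 0 < α) : adjConst α ≤ 1 := by
  have h1 := marginGap_lt_one α
  have h2 := marginGap_pos hα
  have h3 : Real.exp (-(4 * margin α)) ≤ 1 :=
    Real.exp_le_one_iff.2 (by linarith [margin_pos hα])
  exact mul_le_one₀ h3 h2.le h1.le

theorem hypDist_lt_of_norm_le (h : p.Valid) {u v : Node p.n} (hu0 : 0 ≤ u.r) (huR : u.r < p.R)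
    (hv0 : 0 ≤ v.r) (hvR : v.r < p.R)
    (hn : ‖((u.θ : ℝ) : Circ) - (v.θ : ℝ)‖ ≤
      adjConst p.α * scale p (annulus p u.r) (annulus p v.r)) :
    hypDist u v < p.R := by
  have hα := h.α_pos
  have hm := margin_pos hα
  have hw1 := h.two_margin_le_width
  have hw2 := h.width_le
  have hwR := h.width_le_R
  set i := annulus p u.r with hi
  set j := annulus p v.r with hj
  have hui : u.r < boundary p i + p.R / numAnnuli p := by
    rw [← boundary_succ]; exact (annulus_lt_iff h hu0 _).1 (Nat.lt_succ_self _)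
  have hvj : v.r < boundary p j + p.R / numAnnuli p := by
    rw [← boundary_succ]; exact (annulus_lt_iff h hv0 _).1 (Nat.lt_succ_self _)
  have hbi := boundary_nonneg h i
  have hbj := boundary_nonneg h j
  have hcos := one_sub_sq_le_cos_of_norm_le (x := u.θ - v.θ) (by simpa using hn)
  rw [mul_pow, scale_sq] at hcos
  have hgap := marginGap_pos hα
  -- An annulus is at most `4 * margin` wide, so `x` and `y` bound the radii from above; the factor
  -- `exp (-(4 * margin))` in `adjConst` compensates for this excess.
  refine hypDist_lt_of_cos (δ := margin p.α) (x := boundary p i + 4 * margin p.α)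
    (y := boundary p j + 4 * margin p.α) (ε := marginGap p.α ^ 2 / 2) hm (by linarith) hu0 huR hv0
    hvR (max_le (by linarith) (by linarith)) (max_le (by linarith) (by linarith)) ?_
    (Real.cos_le_one _) ?_
  · refine le_trans ?_ hcos
    have e1 := min_le_right 1 (Real.exp (p.R - boundary p i - boundary p j))
    have e2 : Real.exp (p.R - (boundary p i + 4 * margin p.α) - (boundary p j + 4 * margin p.α)) =
        Real.exp (-(4 * margin p.α)) ^ 2 * Real.exp (p.R - boundary p i - boundary p j) := by
      rw [← Real.exp_nat_mul, ← Real.exp_add]; congr 1; push_cast; ring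
    have e3 := mul_le_mul_of_nonneg_left e1 (sq_nonneg (adjConst p.α))
    rw [e2]
    have e4 : adjConst p.α ^ 2 = Real.exp (-(4 * margin p.α)) ^ 2 * marginGap p.α ^ 2 := by
      rw [adjConst, mul_pow]
    rw [e4] at e3 ⊢
    linarith
  · change _ < 2 * marginGap p.α ^ 2
    nlinarith [sq_nonneg (marginGap p.α), pow_pos hgap 2]

/-- Requests reach at most this constant times `scale`. -/
def reachConst (α : ℝ) : ℝ := 2 * Real.pi / marginGap α

theorem pi_le_reachConst {α : ℝ} (hα : 0 < α) : Real.pi ≤ reachConst α := by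
  rw [reachConst, le_div_iff₀ (marginGap_pos hα)]
  nlinarith [marginGap_lt_one α, Real.pi_pos]

theorem marginGap_mul_exp_le_sinh {α x : ℝ} (hα : 0 < α) (hx : margin α ≤ x) :
    marginGap α * Real.exp x / 2 ≤ Real.sinh x := by
  have h1 : Real.exp (-x) ≤ Real.exp (-margin α) * Real.exp x := by
    rw [← Real.exp_add]; exact Real.exp_le_exp.2 (by linarith [margin_pos hα])
  rw [Real.sinh_eq, marginGap]
  linarith

theorem deltaTheta_nonneg (R r b : ℝ) : 0 ≤ deltaTheta R r b := by
  unfold deltaTheta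
  split_ifs
  · exact Real.pi_pos.le
  · exact Real.arccos_nonneg _

/-- One minus the cosine of the reach is at most `(cosh R - cosh (r - b)) / (sinh r sinh b)`, of
order `exp (R - r - b)` because both radii are bounded away from `0`. The quadratic bound `1 - cos x
≥ 2 x² / π²` then controls the angle. -/
theorem deltaTheta_boundary_le (h : p.Valid) {r : ℝ} (hr0 : 0 ≤ r) (hrR : r < p.R) {j : ℕ}
    (hj : j < numAnnuli p) :
    deltaTheta p.R r (boundary p j) ≤ reachConst p.α * scale p (annulus p r) j := by
  have hα := h.α_pos
  have hm := margin_pos hα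
  have hir := (le_annulus_iff h hr0 _).1 (le_refl (annulus p r))
  set i := annulus p r
  unfold deltaTheta
  split_ifs with hlt
  · have : scale p i j = 1 := min_eq_left (Real.one_le_exp (by linarith))
    rw [this, mul_one]; exact pi_le_reachConst hα
  push Not at hlt
  have hw := h.two_margin_le_width
  have hbR : boundary p j + p.R / numAnnuli p ≤ p.R := by
    have h2 := boundary_mono h (Nat.succ_le_of_lt hj)
    rw [boundary_numAnnuli h, Nat.succ_eq_add_one, boundary_succ] at h2
    exact h2
  -- For `j = 0` the boundary is `0` and `r + b < R`, which was the other branch.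
  have hj0 : 0 < j := by
    rcases Nat.eq_zero_or_pos j with rfl | h0
    · simp [boundary] at hlt; linarith
    · exact h0
  have hb := two_margin_le_boundary h hj0
  set b := boundary p j
  have hsr := marginGap_mul_exp_le_sinh hα (x := r) (by linarith)
  have hsb := marginGap_mul_exp_le_sinh hα (x := b) (by linarith)
  have hg := marginGap_pos hα
  have hsr0 : 0 < Real.sinh r := lt_of_lt_of_le (by positivity) hsr
  have hsb0 : 0 < Real.sinh b := lt_of_lt_of_le (by positivity) hsb
  set X := (Real.cosh r * Real.cosh b - Real.cosh p.R) / (Real.sinh r * Real.sinh b) with hX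
  have hss : 0 < Real.sinh r * Real.sinh b := mul_pos hsr0 hsb0
  have hX1 : 1 - X = (Real.cosh p.R - Real.cosh (r - b)) / (Real.sinh r * Real.sinh b) := by
    rw [hX, Real.cosh_sub, eq_div_iff hss.ne', sub_mul, div_mul_cancel₀ _ hss.ne']; ring
  have hXle : 0 ≤ 1 - X := by
    rw [hX1]
    refine div_nonneg (sub_nonneg.2 (Real.cosh_le_cosh.2 ?_)) hss.le
    rw [abs_of_nonneg h.R_pos.le]
    exact abs_le.2 ⟨by linarith, by linarith⟩
  -- Below `-1` the function `arccos` is clamped, which keeps the inequality.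
  have hcos : X ≤ Real.cos (Real.arccos X) := by
    rcases le_total (-1) X with h1 | h1
    · exact (Real.cos_arccos h1 (by linarith)).ge
    · exact h1.trans (Real.neg_one_le_cos _)
  have hquad := Real.cos_le_one_sub_mul_cos_sq (x := Real.arccos X)
    (abs_le.2 ⟨by linarith [Real.arccos_nonneg X, Real.pi_pos], Real.arccos_le_pi X⟩)
  have hbound : 1 - X ≤ 4 / marginGap p.α ^ 2 * scale p i j ^ 2 := by
    have e1 : Real.cosh p.R - Real.cosh (r - b) ≤ Real.exp p.R := by
      rw [Real.cosh_eq p.R]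
      have : Real.exp (-p.R) ≤ Real.exp p.R := Real.exp_le_exp.2 (by linarith [h.R_pos])
      linarith [Real.cosh_pos (r - b)]
    have e2 : (marginGap p.α * Real.exp r / 2) * (marginGap p.α * Real.exp b / 2) ≤
        Real.sinh r * Real.sinh b := mul_le_mul hsr hsb (by positivity) hsr0.le
    have e3 : 1 - X ≤ Real.exp p.R /
        ((marginGap p.α * Real.exp r / 2) * (marginGap p.α * Real.exp b / 2)) := by
      rw [hX1]; exact div_le_div₀ (Real.exp_pos _).le e1 (by positivity) e2
    have e4 : Real.exp p.R /
        ((marginGap p.α * Real.exp r / 2) * (marginGap p.α * Real.exp b / 2)) =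
        4 / marginGap p.α ^ 2 * Real.exp (p.R - r - b) := by
      rw [Real.exp_sub, Real.exp_sub]; field_simp; ring
    rw [e4] at e3
    refine e3.trans (mul_le_mul_of_nonneg_left ?_ (by positivity))
    rw [scale_sq]
    exact le_min (Real.exp_le_one_iff.2 (by linarith)) (Real.exp_le_exp.2 (by linarith))
  have hpi := Real.pi_pos
  have hsq : Real.arccos X ^ 2 ≤ (reachConst p.α * scale p i j) ^ 2 := by
    have e1 : 2 / Real.pi ^ 2 * Real.arccos X ^ 2 ≤ 1 - X := by linarith
    have e2 : Real.arccos X ^ 2 = Real.pi ^ 2 / 2 * (2 / Real.pi ^ 2 * Real.arccos X ^ 2) := by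
      field_simp
    rw [e2]
    calc _ ≤ Real.pi ^ 2 / 2 * (4 / marginGap p.α ^ 2 * scale p i j ^ 2) := by
          exact mul_le_mul_of_nonneg_left (e1.trans hbound) (by positivity)
      _ ≤ _ := by
          rw [reachConst, mul_pow, div_pow, mul_pow]
          have : 0 ≤ Real.pi ^ 2 / marginGap p.α ^ 2 * scale p i j ^ 2 := by positivity
          linarith [show Real.pi ^ 2 / 2 * (4 / marginGap p.α ^ 2 * scale p i j ^ 2) =
            2 * (Real.pi ^ 2 / marginGap p.α ^ 2 * scale p i j ^ 2) by ring,
            show 2 ^ 2 * Real.pi ^ 2 / marginGap p.α ^ 2 * scale p i j ^ 2 =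
            4 * (Real.pi ^ 2 / marginGap p.α ^ 2 * scale p i j ^ 2) by ring]
  exact le_of_sq_le_sq hsq (mul_nonneg (by linarith [pi_le_reachConst hα]) (scale_nonneg p i j))

theorem scale_eq_one_of_lt_clique (h : p.Valid) {i j : ℕ} (hi : i < numCliqueAnnuli p)
    (hj : j < numCliqueAnnuli p) : scale p i j = 1 := by
  refine min_eq_left (Real.one_le_exp (div_nonneg ?_ zero_le_two))
  have hk : (0 : ℝ) < numAnnuli p := by exact_mod_cast h.numAnnuli_pos
  have hij : i + j ≤ numAnnuli p := by unfold numCliqueAnnuli at hi hj; omega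
  have : boundary p i + boundary p j ≤ boundary p (numAnnuli p) := by
    refine le_trans (le_of_eq ?_) (boundary_mono h hij)
    unfold boundary; push_cast; ring
  rw [boundary_numAnnuli h] at this
  linarith

theorem exp_neg_half_le_scale (h : p.Valid) {j : ℕ} (hj : j < numAnnuli p) :
    Real.exp (-(p.R / 2)) ≤ scale p j j := by
  have hb : boundary p j ≤ p.R := by
    rw [← boundary_numAnnuli h]; exact boundary_mono h hj.le
  refine le_min (Real.exp_le_one_iff.2 (by linarith [h.R_pos])) (Real.exp_le_exp.2 (by linarith))

end

/-! ### Values and step counts of the primitive programs. -/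

section Time

variable {n : ℕ} {β β' : Type}

@[simp] theorem time_bind (x : Prog n β) (f : β → Prog n β') :
    (x >>= f).time = x.time + (f x.val).time := by
  change _ + _ + (_ + _) + (_ + _) + (_ + _) = _
  simp only [Prog.time]
  omega

@[simp] theorem time_pure (a : β) : (pure a : Prog n β).time = 0 := rfl

@[simp] theorem val_bind (x : Prog n β) (f : β → Prog n β') :
    (x >>= f).val = (f x.val).val := rfl

@[simp] theorem val_pure (a : β) : (pure a : Prog n β).val = a := rfl

@[simp] theorem time_tick (φ : Phase) (k : ℕ) : (tick φ k : Prog n Unit).time = k := by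
  cases φ <;> simp [tick, Prog.time]

@[simp] theorem time_emit (u v : Fin n) : (emit u v : Prog n Unit).time = 0 := rfl

theorem steps_le_time (x : Prog n β) (φ : Phase) : x.steps φ ≤ x.time := by
  unfold Prog.time
  cases φ <;> omega

end Time

section Lists

theorem sum_map_le_of_forall {τ : Type*} {L : List τ} {f g : τ → ℕ} (h : ∀ x ∈ L, f x ≤ g x) :
    (L.map f).sum ≤ (L.map g).sum := List.sum_le_sum h

theorem sum_map_filter {τ : Type*} (L : List τ) (P : τ → Prop) [DecidablePred P] (f : τ → ℕ) :
    ((L.filter fun x => P x).map f).sum = (L.map fun x => if P x then f x else 0).sum := by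
  induction L with
  | nil => rfl
  | cons x L ih => by_cases h : P x <;> simp [h, ih]

/-- Every token lies in one bucket only. This turns sums over cells into sums over tokens; tokens
with a key outside `S` are simply lost. -/
theorem sum_buckets_le {τ : Type*} (key : τ → ℕ) (L : List τ) (S : Finset ℕ) (g : ℕ → τ → ℕ) :
    ∑ t ∈ S, ((L.filter fun x => key x = t).map (g t)).sum ≤ (L.map fun x => g (key x) x).sum := by
  induction L with
  | nil => simp
  | cons x L ih =>
    have : ∀ t, (((x :: L).filter fun x => key x = t).map (g t)).sum =
        (if key x = t then g t x else 0) + ((L.filter fun x => key x = t).map (g t)).sum := by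
      intro t
      by_cases h : key x = t <;> simp [h]
    simp only [this, Finset.sum_add_distrib, List.map_cons, List.sum_cons, Finset.sum_ite_eq]
    refine add_le_add ?_ ih
    split_ifs <;> simp

end Lists

section Primitives

variable (p : Params) (ω : Fin p.n → ℝ × ℝ)

open Classical in
theorem sum_map_drawPoints (a b : ℝ) (f : Fin p.n → ℕ) :
    ((drawPoints p ω a b).val.map f).sum =
      ∑ v with a ≤ (ω v).2 ∧ (ω v).2 < b, f v := by
  change ((List.insertionSort _ _).map f).sum = _
  rw [((List.perm_insertionSort _ _).map f).sum_eq, Finset.sum_filter, Fin.sum_univ_def,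
    ← sum_map_filter]

theorem time_drawPoints (a b : ℝ) :
    (drawPoints p ω a b).time = 1 + 3 * (drawPoints p ω a b).val.length := by
  unfold drawPoints; simp

theorem val_placeNodes (vs : List (Fin p.n)) :
    (placeNodes p ω vs).val = vs.map (nodeOf p ω) := by
  induction vs with
  | nil => rfl
  | cons v vs ih => simp [placeNodes, ih]

theorem time_placeNodes (vs : List (Fin p.n)) : (placeNodes p ω vs).time = vs.length := by
  induction vs with
  | nil => rfl
  | cons v vs ih => simp [placeNodes, ih]; omega

variable {n : ℕ}

theorem time_emitStar (u : Node n) (vs : List (Node n)) : (emitStar u vs).time = vs.length := by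
  induction vs with
  | nil => rfl
  | cons v vs ih => simp [emitStar, ih]; omega

theorem time_emitClique (us : List (Node n)) : (emitClique us).time ≤ us.length ^ 2 := by
  induction us with
  | nil => simp [emitClique]
  | cons u us ih => simp [emitClique, time_emitStar]; nlinarith

theorem val_makeRequests (R a : ℝ) (c : ℕ) (us : List (Node n)) :
    (makeRequests R a c us).val = us.map (requestOf R a c) := by
  induction us with
  | nil => rfl
  | cons u us ih => simp [makeRequests, ih]

theorem time_makeRequests (R a : ℝ) (c : ℕ) (us : List (Node n)) :
    (makeRequests R a c us).time = us.length := by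
  induction us with
  | nil => rfl
  | cons u us ih => simp [makeRequests, ih]; omega

theorem val_distribute {τ : Type} (key : τ → ℕ) (ts : List τ) (b : ℕ → List τ) (t : ℕ) :
    (distribute (n := n) key b ts).val t = (ts.filter fun x => key x = t).reverse ++ b t := by
  induction ts generalizing b with
  | nil => simp [distribute]
  | cons x ts ih =>
    simp only [distribute, val_bind, ih]
    by_cases h : key x = t
    · subst h; simp
    · simp [h, Function.update_of_ne (Ne.symm h)]

theorem time_distribute {τ : Type} (key : τ → ℕ) (ts : List τ) (b : ℕ → List τ) :
    (distribute (n := n) key b ts).time = ts.length := by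
  induction ts generalizing b with
  | nil => rfl
  | cons x ts ih => simp [distribute, ih]; omega

theorem val_integerSort {τ : Type} (key : τ → ℕ) (c : ℕ) (ts : List τ) (t : ℕ) :
    (integerSort (n := n) key c ts).val t = (ts.filter fun x => key x = t).reverse := by
  simp [integerSort, val_distribute]

theorem time_integerSort {τ : Type} (key : τ → ℕ) (c : ℕ) (ts : List τ) :
    (integerSort (n := n) key c ts).time = c + ts.length := by
  simp [integerSort, time_distribute]

theorem val_dropEnded (t : ℕ) (qs : List (Request n)) :
    (dropEnded t qs).val = qs.filter fun q => t ≤ q.last := by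
  induction qs with
  | nil => rfl
  | cons q qs ih => by_cases h : t ≤ q.last <;> simp [dropEnded, ih, h]

theorem time_dropEnded (t : ℕ) (qs : List (Request n)) : (dropEnded t qs).time = qs.length := by
  induction qs with
  | nil => rfl
  | cons q qs ih => simp [dropEnded, ih]; omega

theorem val_openRequests (qs active : List (Request n)) (buffer : List (Node n)) :
    (openRequests qs active buffer).val =
      (qs.reverse ++ active, (qs.map Request.node).reverse ++ buffer) := by
  induction qs generalizing active buffer with
  | nil => rfl
  | cons q qs ih => simp [openRequests, ih]

theorem time_openRequests (qs active : List (Request n)) (buffer : List (Node n)) :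
    (openRequests qs active buffer).time = qs.length := by
  induction qs generalizing active buffer with
  | nil => rfl
  | cons q qs ih => simp [openRequests, ih]; omega

theorem time_checkNode (R : ℝ) (v : Node n) (qs : List (Request n)) :
    (checkNode R v qs).time = qs.length := by
  induction qs with
  | nil => rfl
  | cons q qs ih =>
    by_cases h : (q.node.r < v.r ∨ q.node.r = v.r ∧ q.node.id < v.id) ∧ hypDist q.node v < R <;>
      simp [checkNode, h, ih] <;> omega

theorem time_checkNodes (R : ℝ) (active : List (Request n)) (vs : List (Node n)) :
    (checkNodes R active vs).time = vs.length * (1 + active.length) := by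
  induction vs with
  | nil => simp [checkNodes]
  | cons v vs ih => simp [checkNodes, time_checkNode, ih]; ring

end Primitives

/-! ### Cost of the sweep. -/

section Sweep

variable {n : ℕ}

/-- The total weight of a request over the cells `t₀, …, e - 1` up to its last one. -/
def remaining (w : ℕ → ℕ) (e t₀ : ℕ) (q : Request n) : ℕ :=
  ∑ t ∈ Finset.Ico t₀ e with t ≤ q.last, w t

theorem remaining_succ {w : ℕ → ℕ} {e t₀ : ℕ} (h : t₀ < e) {q : Request n} (hq : t₀ ≤ q.last) :
    remaining w e t₀ q = w t₀ + remaining w e (t₀ + 1) q := by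
  unfold remaining
  rw [Finset.sum_filter, Finset.sum_filter, Finset.sum_eq_sum_Ico_succ_bot h, if_pos hq]

theorem val_sweep_cons (R : ℝ) (c : ℕ) (begins : ℕ → List (Request n))
    (nodes : ℕ → List (Node n)) (t : ℕ) (ts : List ℕ) (active : List (Request n))
    (buffer : List (Node n)) :
    (sweep R c begins nodes (t :: ts) active buffer).val =
      (sweep R c begins nodes ts ((begins t).reverse ++ active.filter fun q => t ≤ q.last)
        (((begins t).map Request.node).reverse ++ buffer)).val := by
  simp [sweep, val_dropEnded, val_openRequests]

theorem time_sweep_cons (R : ℝ) (c : ℕ) (begins : ℕ → List (Request n))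
    (nodes : ℕ → List (Node n)) (t : ℕ) (ts : List ℕ) (active : List (Request n))
    (buffer : List (Node n)) :
    (sweep R c begins nodes (t :: ts) active buffer).time =
      1 + active.length + (begins t).length +
      (nodes (t % c)).length *
        (1 + ((begins t).reverse ++ active.filter fun q => t ≤ q.last).length) +
      (sweep R c begins nodes ts ((begins t).reverse ++ active.filter fun q => t ≤ q.last)
        (((begins t).map Request.node).reverse ++ buffer)).time := by
  simp only [sweep, time_bind, time_tick, val_dropEnded, time_dropEnded, val_openRequests,
    time_openRequests, time_checkNodes]
  ring

theorem sum_map_sweep (R : ℝ) (c : ℕ) (begins : ℕ → List (Request n))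
    (nodes : ℕ → List (Node n)) (f : Node n → ℕ) (ts : List ℕ) (active : List (Request n))
    (buffer : List (Node n)) :
    ((sweep R c begins nodes ts active buffer).val.map f).sum = (buffer.map f).sum +
      (ts.map fun t => ((begins t).map fun q => f q.node).sum).sum := by
  induction ts generalizing active buffer with
  | nil => simp [sweep]
  | cons t ts ih =>
    rw [val_sweep_cons, ih]
    simp [Function.comp_def]
    ring

/-- In each of its cells a request pays one step per node there, for the comparisons, and one more
for being scanned on entering the next cell. Thus the scan that drops it is already paid, and only
initially active requests need the extra `active.length`. -/
theorem time_sweep_le (R : ℝ) (c : ℕ) (begins : ℕ → List (Request n))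
    (nodes : ℕ → List (Node n)) (hb : ∀ t, ∀ q ∈ begins t, t ≤ q.last) (len t₀ e : ℕ)
    (he : t₀ + len = e) (active : List (Request n)) (buffer : List (Node n)) :
    (sweep R c begins nodes (List.range' t₀ len) active buffer).time ≤
      (∑ t ∈ Finset.Ico t₀ e, (1 + (begins t).length + (nodes (t % c)).length)) + active.length +
      (active.map (remaining (fun t => 1 + (nodes (t % c)).length) e t₀)).sum +
      ∑ t ∈ Finset.Ico t₀ e,
        ((begins t).map (remaining (fun t => 1 + (nodes (t % c)).length) e t)).sum := by
  induction len generalizing t₀ active buffer with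
  | zero => simp [sweep]
  | succ len ih =>
    set w : ℕ → ℕ := fun t => 1 + (nodes (t % c)).length with hw
    have hlt : t₀ < e := by omega
    rw [List.range'_succ, time_sweep_cons]
    have h := ih (t₀ + 1) (by omega) ((begins t₀).reverse ++ active.filter fun q => t₀ ≤ q.last)
      (((begins t₀).map Request.node).reverse ++ buffer)
    have h1 : ∀ L : List (Request n), (∀ q ∈ L, t₀ ≤ q.last) →
        (L.map (remaining w e t₀)).sum = w t₀ * L.length +
          (L.map (remaining w e (t₀ + 1))).sum := by
      intro L hL
      induction L with
      | nil => simp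
      | cons q L ihL =>
        simp only [List.map_cons, List.sum_cons, List.length_cons]
        rw [ihL fun q hq => hL q (List.mem_cons_of_mem _ hq),
          remaining_succ hlt (hL q List.mem_cons_self)]
        ring
    have h2 := h1 (begins t₀) (hb t₀)
    have h3 := h1 (active.filter fun q => t₀ ≤ q.last) fun q hq => by
      simpa using (List.mem_filter.1 hq).2
    have h4 : ((active.filter fun q => t₀ ≤ q.last).map (remaining w e t₀)).sum ≤
        (active.map (remaining w e t₀)).sum := by
      rw [sum_map_filter]
      exact sum_map_le_of_forall fun q _ => by split_ifs <;> simp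
    rw [Finset.sum_eq_sum_Ico_succ_bot hlt, Finset.sum_eq_sum_Ico_succ_bot hlt]
    simp only [List.map_append, List.sum_append, List.map_reverse, List.sum_reverse,
      List.length_append, List.length_reverse] at h ⊢
    have hw0 : w t₀ = 1 + (nodes (t₀ % c)).length := rfl
    rw [hw0] at h2 h3
    nlinarith

end Sweep

/-! ### Cells, spans of requests, and candidates. -/

section Cells

theorem numCells_pos (κ N : ℕ) : 0 < numCells κ N := pow_pos two_pos _

theorem numCells_le (κ N : ℕ) : numCells κ N ≤ N + 1 := by
  unfold numCells
  rcases Nat.eq_zero_or_pos (N / κ) with h | h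
  · rw [h]; simp
  · exact ((Nat.pow_log_le_self 2 h.ne').trans (Nat.div_le_self _ _)).trans (Nat.le_succ _)

theorem le_mul_numCells {κ : ℕ} (hκ : 1 ≤ κ) (N : ℕ) : N ≤ 2 * κ * numCells κ N := by
  have h1 : N / κ < 2 ^ (Nat.log 2 (N / κ) + 1) := Nat.lt_pow_succ_log_self one_lt_two _
  have h2 : N < κ * (N / κ + 1) := by
    have := Nat.div_add_mod N κ
    have := Nat.mod_lt N hκ
    rw [mul_add]; omega
  have h3 : κ * (N / κ + 1) ≤ κ * 2 ^ (Nat.log 2 (N / κ) + 1) := Nat.mul_le_mul_left _ h1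
  unfold numCells
  rw [pow_succ] at h3
  linarith

theorem card_filter_mod_le_one (c f m : ℕ) :
    ((Finset.Ico f (f + c)).filter fun t => m = t % c).card ≤ 1 := by
  refine Finset.card_le_one.2 fun a ha b hb => ?_
  simp only [Finset.mem_filter, Finset.mem_Ico] at ha hb
  have h : a ≡ b [MOD c] := ha.2.symm.trans hb.2
  rcases le_total a b with hab | hab
  · have := Nat.eq_zero_of_dvd_of_lt ((Nat.modEq_iff_dvd' hab).1 h) (by omega)
    omega
  · have := Nat.eq_zero_of_dvd_of_lt ((Nat.modEq_iff_dvd' hab).1 h.symm) (by omega)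
    omega

theorem sum_sum_map_comm {τ : Type*} (S : Finset ℕ) (L : List τ) (g : ℕ → τ → ℕ) :
    ∑ t ∈ S, (L.map (g t)).sum = (L.map fun x => ∑ t ∈ S, g t x).sum := by
  induction L with
  | nil => simp
  | cons x L ih => simp [Finset.sum_add_distrib, ih]

theorem length_filter_eq_sum {τ : Type*} (L : List τ) (P : τ → Prop) [DecidablePred P] :
    (L.filter fun x => P x).length = (L.map fun x => if P x then 1 else 0).sum := by
  rw [← sum_map_filter]; simp

variable {n : ℕ}

/-- The number of cells of the request of `u`. -/
def spanOf (R a : ℝ) (c : ℕ) (u : Node n) : ℕ :=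
  min (cellIndex c (u.θ + deltaTheta R u.r a) - cellIndex c (u.θ - deltaTheta R u.r a)).toNat
    (c - 1) + 1

theorem last_requestOf (R a : ℝ) (c : ℕ) (u : Node n) :
    (requestOf R a c u).last + 1 = (requestOf R a c u).first + spanOf R a c u := by
  simp [requestOf, spanOf]; omega

theorem spanOf_le {c : ℕ} (hc : 0 < c) (R a : ℝ) (u : Node n) : spanOf R a c u ≤ c := by
  unfold spanOf; omega

theorem spanOf_le_real (R a : ℝ) (c : ℕ) (u : Node n) :
    (spanOf R a c u : ℝ) ≤ deltaTheta R u.r a * c / Real.pi + 2 := by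
  have hΔ := deltaTheta_nonneg R u.r a
  set Δ := deltaTheta R u.r a with hΔdef
  have hpi := Real.pi_pos
  have h1 : (spanOf R a c u : ℝ) ≤
      ((cellIndex c (u.θ + Δ) - cellIndex c (u.θ - Δ)).toNat : ℕ) + 1 := by
    have : spanOf R a c u ≤ (cellIndex c (u.θ + Δ) - cellIndex c (u.θ - Δ)).toNat + 1 := by
      unfold spanOf
      rw [← hΔdef]
      omega
    exact_mod_cast this
  have h2 : (((cellIndex c (u.θ + Δ) - cellIndex c (u.θ - Δ)).toNat : ℕ) : ℝ) ≤
      Δ * c / Real.pi + 1 := by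
    have h3 := Int.floor_le ((u.θ + Δ) * c / (2 * Real.pi))
    have h4 := Int.lt_floor_add_one ((u.θ - Δ) * c / (2 * Real.pi))
    have h5 : (u.θ + Δ) * c / (2 * Real.pi) - (u.θ - Δ) * c / (2 * Real.pi) = Δ * c / Real.pi := by
      field_simp; ring
    have h6 : 0 ≤ Δ * c / Real.pi := by positivity
    rcases le_total 0 (cellIndex c (u.θ + Δ) - cellIndex c (u.θ - Δ)) with h | h
    · have e : (((cellIndex c (u.θ + Δ) - cellIndex c (u.θ - Δ)).toNat : ℕ) : ℝ) =
          ((cellIndex c (u.θ + Δ) : ℤ) : ℝ) - (cellIndex c (u.θ - Δ) : ℤ) := by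
        rw [← Int.cast_natCast, Int.toNat_of_nonneg h, Int.cast_sub]
      rw [e]
      unfold cellIndex
      linarith
    · rw [Int.toNat_of_nonpos h]
      push_cast
      linarith
  linarith

/-- Cell `t` is `s` cells after that of the left end, with `s` at most the distance to the cell of
the right end. Up to a multiple of `2π`, `θ` therefore lies in the request interval enlarged by one
cell on both sides. -/
theorem norm_sub_le_of_cellOf_eq {c : ℕ} (hc : 0 < c) (R a : ℝ) (u : Node n) (θ : ℝ) {t : ℕ}
    (h1 : (requestOf R a c u).first ≤ t) (h2 : t ≤ (requestOf R a c u).last)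
    (h : cellOf c θ = t % c) :
    ‖(θ : Circ) - (u.θ : ℝ)‖ ≤ deltaTheta R u.r a + 2 * Real.pi / c := by
  have hΔ := deltaTheta_nonneg R u.r a
  have hpi := Real.pi_pos
  have hc' : (0 : ℝ) < c := by exact_mod_cast hc
  have hcz : (c : ℤ) ≠ 0 := by exact_mod_cast hc.ne'
  simp only [requestOf] at h1 h2
  set Δ := deltaTheta R u.r a with hΔdef
  set lo := u.θ - Δ with hlo
  set hi := u.θ + Δ with hhi
  obtain ⟨s, rfl⟩ := Nat.exists_eq_add_of_le h1
  have hs : s ≤ (cellIndex c hi - cellIndex c lo).toNat := by omega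
  have hile : cellIndex c lo ≤ cellIndex c hi := by
    refine Int.floor_le_floor ?_
    gcongr
    linarith
  have hs' : cellIndex c lo + s ≤ cellIndex c hi := by omega
  have hmod : cellIndex c θ % c = (cellIndex c lo + s) % c := by
    have e1 : ((cellOf c θ : ℕ) : ℤ) = cellIndex c θ % c :=
      Int.toNat_of_nonneg (Int.emod_nonneg _ hcz)
    have e2 : ((cellOf c lo : ℕ) : ℤ) = cellIndex c lo % c :=
      Int.toNat_of_nonneg (Int.emod_nonneg _ hcz)
    rw [← e1, h]
    push_cast
    rw [e2, Int.emod_add_emod]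
  have hmod' : cellIndex c lo + s ≡ cellIndex c θ [ZMOD c] := hmod.symm
  obtain ⟨z, hz⟩ := hmod'.dvd
  have hz' : (cellIndex c θ : ℝ) = cellIndex c lo + s + c * z := by
    have : cellIndex c θ = cellIndex c lo + s + c * z := by linarith
    exact_mod_cast this
  have f1 := Int.floor_le (θ * c / (2 * Real.pi))
  have f2 := Int.lt_floor_add_one (θ * c / (2 * Real.pi))
  have f3 := Int.lt_floor_add_one (lo * c / (2 * Real.pi))
  have f4 := Int.floor_le (hi * c / (2 * Real.pi))
  have hs'' : (cellIndex c lo : ℝ) + s ≤ cellIndex c hi := by exact_mod_cast hs'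
  unfold cellIndex at hz' hs''
  have hs0 : (0 : ℝ) ≤ s := Nat.cast_nonneg s
  set x := θ - z * (2 * Real.pi) with hx
  have hxc : x * c / (2 * Real.pi) = θ * c / (2 * Real.pi) - c * z := by
    rw [hx]; field_simp
  have g1 : lo * c / (2 * Real.pi) - 1 ≤ x * c / (2 * Real.pi) := by rw [hxc]; linarith
  have g2 : x * c / (2 * Real.pi) ≤ hi * c / (2 * Real.pi) + 1 := by rw [hxc]; linarith
  have conv : ∀ y : ℝ, y * c / (2 * Real.pi) * (2 * Real.pi / c) = y := fun y => by field_simp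
  have hw : 0 ≤ 2 * Real.pi / c := by positivity
  have g3 := mul_le_mul_of_nonneg_right g1 hw
  have g4 := mul_le_mul_of_nonneg_right g2 hw
  rw [sub_mul, conv, conv] at g3
  rw [add_mul, conv, conv] at g4
  have hcoe : (θ : Circ) - (u.θ : ℝ) = ((x - u.θ : ℝ) : Circ) := by
    have : (((z : ℝ) * (2 * Real.pi) : ℝ) : Circ) = 0 := by
      have := AddCircle.coe_zsmul (p := 2 * Real.pi) (n := z) (x := 2 * Real.pi)
      rw [AddCircle.coe_period, smul_zero, zsmul_eq_mul] at this
      exact this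
    rw [hx, AddCircle.coe_sub, AddCircle.coe_sub, this, sub_zero]
  rw [hcoe]
  refine (QuotientAddGroup.norm_mk_le_norm).trans ?_
  rw [Real.norm_eq_abs]
  exact abs_le.2 ⟨by linarith, by linarith⟩

open Classical in
/-- The number of nodes in a list which are within reach of the request of `u`. -/
def candidates (R a : ℝ) (c : ℕ) (own : List (Node n)) (u : Node n) : ℕ :=
  (own.map fun v =>
    if ‖(v.θ : Circ) - (u.θ : ℝ)‖ ≤ deltaTheta R u.r a + 2 * Real.pi / c then 1 else 0).sum

/-- A request spans at most `c` consecutive cells, so modulo `c` each node is met at most once, and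
every node that is met is a candidate. -/
theorem remaining_requestOf_le {c : ℕ} (hc : 0 < c) (R a : ℝ) (own : List (Node n)) (u : Node n)
    (e : ℕ) :
    remaining (fun t => 1 + (own.filter fun v => cellOf c v.θ = t % c).length) e
      (requestOf R a c u).first (requestOf R a c u) ≤
      spanOf R a c u + candidates R a c own u := by
  classical
  set q := requestOf R a c u with hq
  set S := Finset.Ico q.first (q.first + spanOf R a c u) with hS
  have hlast : q.last + 1 = q.first + spanOf R a c u := last_requestOf R a c u
  have hsub : (Finset.Ico q.first e).filter (fun t => t ≤ q.last) ⊆ S := by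
    intro t ht
    simp only [Finset.mem_filter, Finset.mem_Ico, hS] at ht ⊢
    omega
  unfold remaining
  refine (Finset.sum_le_sum_of_subset hsub).trans ?_
  rw [Finset.sum_add_distrib]
  refine add_le_add (by simp [hS]) ?_
  simp only [length_filter_eq_sum]
  rw [sum_sum_map_comm]
  refine sum_map_le_of_forall fun v _ => ?_
  rw [← Finset.card_filter]
  split_ifs with hn
  · have hS' : S ⊆ Finset.Ico q.first (q.first + c) :=
      Finset.Ico_subset_Ico_right (Nat.add_le_add_left (spanOf_le hc R a u) _)
    exact (Finset.card_le_card (Finset.filter_subset_filter _ hS')).trans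
      (card_filter_mod_le_one c q.first _)
  · refine le_of_eq (Finset.card_eq_zero.2 (Finset.filter_eq_empty_iff.2 fun t ht hcell => hn ?_))
    rw [hS, Finset.mem_Ico] at ht
    have htl : t ≤ q.last := by omega
    exact norm_sub_le_of_cellOf_eq hc R a u v.θ ht.1 htl hcell

theorem sum_length_cells_le (c : ℕ) (own : List (Node n)) :
    ∑ t ∈ Finset.Ico 0 (2 * c), (own.filter fun v => cellOf c v.θ = t % c).length ≤
      2 * own.length := by
  simp only [length_filter_eq_sum]
  rw [sum_sum_map_comm]
  calc _ ≤ (own.map fun _ => 2).sum := by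
        refine sum_map_le_of_forall fun v _ => ?_
        rw [← Finset.sum_Ico_consecutive _ (Nat.zero_le c) (by omega : c ≤ 2 * c),
          ← Finset.card_filter, ← Finset.card_filter]
        have h1 := card_filter_mod_le_one c 0 (cellOf c v.θ)
        have h2 := card_filter_mod_le_one c c (cellOf c v.θ)
        rw [zero_add] at h1
        rw [← two_mul] at h2
        omega
    _ = _ := by simp [mul_comm]

end Cells

/-! ### Cost of an annulus and of the whole generator. -/

section Annulus

variable (p : Params) (ω : Fin p.n → ℝ × ℝ)

/-- A list of nodes consists of at most one copy of each node of a set of vertices. -/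
def Dominated (L : List (Node p.n)) (S : Finset (Fin p.n)) : Prop :=
  ∀ f : Node p.n → ℕ, (L.map f).sum ≤ ∑ v ∈ S, f (nodeOf p ω v)

theorem time_sweep_requests_le {c : ℕ} (hc : 0 < c) (a : ℝ) (us own : List (Node p.n))
    (begins : ℕ → List (Request p.n)) (nodes : ℕ → List (Node p.n))
    (hbegins : ∀ t, begins t =
      ((us.map (requestOf p.R a c)).filter fun q => q.first = t).reverse)
    (hnodes : ∀ t, nodes t = (own.filter fun v => cellOf c v.θ = t).reverse) :
    (sweep p.R c begins nodes (List.range (2 * c)) [] []).time ≤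
      2 * c + us.length + 2 * own.length +
        (us.map fun u => spanOf p.R a c u + candidates p.R a c own u).sum := by
  have hlast : ∀ t, ∀ q ∈ begins t, t ≤ q.last := by
    intro t q hq
    rw [hbegins, List.mem_reverse, List.mem_filter] at hq
    obtain ⟨h1, h2⟩ := hq
    obtain ⟨u, _, rfl⟩ := List.mem_map.1 h1
    have h3 : (requestOf p.R a c u).first = t := by simpa using h2
    rw [← h3]
    simp [requestOf]
  have h := time_sweep_le p.R c begins nodes hlast (2 * c) 0 (2 * c) (by omega) [] []
  rw [← List.range_eq_range'] at h
  refine h.trans ?_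
  have hw : (fun t => 1 + (nodes (t % c)).length) =
      fun t => 1 + (own.filter fun v => cellOf c v.θ = t % c).length := by
    ext t; rw [hnodes, List.length_reverse]
  rw [hw]
  simp only [hbegins, hnodes, List.length_reverse, List.length_nil, List.map_nil, List.sum_nil,
    List.map_reverse, List.sum_reverse, add_zero, Finset.sum_add_distrib]
  have e1 : ∑ t ∈ Finset.Ico 0 (2 * c),
      ((us.map (requestOf p.R a c)).filter fun q => q.first = t).length ≤ us.length := by
    have := sum_buckets_le Request.first (us.map (requestOf p.R a c)) (Finset.Ico 0 (2 * c))
      fun _ _ => 1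
    simpa [Function.comp_def] using this
  have e2 := sum_length_cells_le c own
  have e3 := sum_buckets_le Request.first (us.map (requestOf p.R a c)) (Finset.Ico 0 (2 * c))
    (remaining (fun t => 1 + (own.filter fun v => cellOf c v.θ = t % c).length) (2 * c))
  rw [List.map_map] at e3
  have e4 : (us.map ((fun q => remaining
      (fun t => 1 + (own.filter fun v => cellOf c v.θ = t % c).length) (2 * c) q.first q) ∘
      requestOf p.R a c)).sum ≤
      (us.map fun u => spanOf p.R a c u + candidates p.R a c own u).sum :=
    sum_map_le_of_forall fun u _ => remaining_requestOf_le hc p.R a own u (2 * c)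
  have e5 : ∑ t ∈ Finset.Ico 0 (2 * c), 1 = 2 * c := by simp
  rw [e5]
  linarith [e3.trans e4]

/-- The vertices of annulus `j`. -/
def inAnnulus (j : ℕ) : Finset (Fin p.n) := Finset.univ.filter fun v => annulus p (ω v).2 = j

/-- The vertices of the annuli `0, …, j`. -/
def upTo (j : ℕ) : Finset (Fin p.n) := Finset.univ.filter fun v => annulus p (ω v).2 ≤ j

/-- The vertices of the annuli below `j`. -/
def below (j : ℕ) : Finset (Fin p.n) := Finset.univ.filter fun v => annulus p (ω v).2 < j

/-- The number of cells of annulus `j`. -/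
def cellsOf (j : ℕ) : ℕ := numCells p.κ (inAnnulus p ω j).card

variable {p ω}

theorem sum_upTo (f : Fin p.n → ℕ) (j : ℕ) :
    ∑ v ∈ upTo p ω j, f v = ∑ v ∈ below p ω j, f v + ∑ v ∈ inAnnulus p ω j, f v := by
  have hd : Disjoint (below p ω j) (inAnnulus p ω j) := by
    refine Finset.disjoint_filter.2 fun v _ h1 h2 => ?_
    omega
  rw [← Finset.sum_union hd]
  congr 1
  ext v
  simp only [upTo, below, inAnnulus, Finset.mem_union, Finset.mem_filter, Finset.mem_univ,
    true_and]
  omega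

/-- All radii lie in the disk. -/
def InDisk (p : Params) (ω : Fin p.n → ℝ × ℝ) : Prop := ∀ v, 0 ≤ (ω v).2 ∧ (ω v).2 < p.R

theorem sum_map_drawPoints_annulus (h : p.Valid) (hω : InDisk p ω) (j : ℕ) (f : Fin p.n → ℕ) :
    ((drawPoints p ω (boundary p j) (boundary p (j + 1))).val.map f).sum =
      ∑ v ∈ inAnnulus p ω j, f v := by
  rw [sum_map_drawPoints]
  refine Finset.sum_congr ?_ fun _ _ => rfl
  ext v
  simp only [inAnnulus, Finset.mem_filter, Finset.mem_univ, true_and]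
  rw [← le_annulus_iff h (hω v).1, ← annulus_lt_iff h (hω v).1]
  omega

/-- `Dominated` is the invariant carried from annulus to annulus: a request token lies in one bucket
only, so no node enters the next buffer twice. -/
theorem runAnnulus_spec (h : p.Valid) (hω : InDisk p ω) (j : ℕ)
    {buffer : List (Node p.n)} (hbuf : Dominated p ω buffer (below p ω j)) :
    Dominated p ω (runAnnulus p ω j buffer).val (upTo p ω j) ∧
    (runAnnulus p ω j buffer).time ≤ 7 + 15 * (upTo p ω j).card +
      ∑ u ∈ upTo p ω j, (spanOf p.R (boundary p j) (cellsOf p ω j) (nodeOf p ω u) +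
        ∑ v ∈ inAnnulus p ω j, if ‖((nodeOf p ω v).θ : Circ) - ((nodeOf p ω u).θ : ℝ)‖ ≤
          deltaTheta p.R (ω u).2 (boundary p j) + 2 * Real.pi / cellsOf p ω j then 1 else 0) := by
  classical
  have hsum := sum_map_drawPoints_annulus h hω j
  have htime := time_drawPoints p ω (boundary p j) (boundary p (j + 1))
  unfold runAnnulus
  simp only [val_bind, time_bind, time_tick]
  set vs := (drawPoints p ω (boundary p j) (boundary p (j + 1))).val with hvs
  have hlen : vs.length = (inAnnulus p ω j).card := by simpa using hsum fun _ => 1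
  simp only [val_placeNodes, time_placeNodes, val_makeRequests, time_makeRequests,
    time_integerSort]
  have hc : numCells p.κ vs.length = cellsOf p ω j := by rw [hlen, cellsOf]
  rw [hc]
  set c := cellsOf p ω j with hcdef
  have hc0 : 0 < c := numCells_pos _ _
  set own := vs.map (nodeOf p ω) with hown
  have hdom : Dominated p ω (buffer ++ own) (upTo p ω j) := by
    intro f
    rw [sum_upTo, List.map_append, List.sum_append, hown, List.map_map, hsum]
    exact add_le_add (hbuf f) le_rfl
  refine ⟨fun f => ?_, ?_⟩
  · refine le_trans ?_ (hdom f)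
    rw [sum_map_sweep]
    simp only [List.map_nil, List.sum_nil, zero_add, val_integerSort, List.map_reverse,
      List.sum_reverse]
    have := sum_buckets_le Request.first ((buffer ++ own).map (requestOf p.R (boundary p j) c))
      (Finset.range (2 * c)) fun _ q => f q.node
    rw [List.map_map] at this
    exact this
  · have hsw := time_sweep_requests_le p hc0 (boundary p j) (buffer ++ own) own
      (integerSort (n := p.n) Request.first c
        ((buffer ++ own).map (requestOf p.R (boundary p j) c))).val
      (integerSort (n := p.n) (fun v => cellOf c v.θ) c own).val
      (fun t => val_integerSort _ _ _ _) (fun t => val_integerSort _ _ _ _)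
    have hd1 : (buffer ++ own).length ≤ (upTo p ω j).card := by simpa using hdom fun _ => 1
    have hd2 := hdom fun u => spanOf p.R (boundary p j) c u + candidates p.R (boundary p j) c own u
    have hcand : ∀ u, candidates p.R (boundary p j) c own (nodeOf p ω u) =
        ∑ v ∈ inAnnulus p ω j, if ‖((nodeOf p ω v).θ : Circ) - ((nodeOf p ω u).θ : ℝ)‖ ≤
          deltaTheta p.R (ω u).2 (boundary p j) + 2 * Real.pi / c then 1 else 0 := by
      intro u
      rw [candidates, hown, List.map_map, ← hsum]
      rfl
    simp only [hcand] at hd2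
    have hown_len : own.length = vs.length := by simp [hown]
    have hle : vs.length ≤ (buffer ++ own).length := by simp [hown]
    -- With `N` points and `U ≥ N` requests, the cost besides spans and candidates is at most `2 +
    -- 7N + 3U + 5c`, hence at most `7 + 15U`.
    have hcle : c ≤ vs.length + 1 := by rw [hlen]; exact numCells_le _ _
    have hlog : Nat.log 2 c ≤ c := Nat.log_le_self 2 c
    simp only [List.length_map]
    have hd3 := hsw.trans (Nat.add_le_add_left hd2 _)
    omega

theorem time_runAnnuli_le (h : p.Valid) (hω : InDisk p ω) (len j : ℕ)
    {buffer : List (Node p.n)} (hbuf : Dominated p ω buffer (below p ω j)) :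
    (runAnnuli p ω (List.range' j len) buffer).time ≤
      ∑ j ∈ Finset.Ico j (j + len), (7 + 15 * (upTo p ω j).card +
        ∑ u ∈ upTo p ω j, (spanOf p.R (boundary p j) (cellsOf p ω j) (nodeOf p ω u) +
          ∑ v ∈ inAnnulus p ω j, if ‖((nodeOf p ω v).θ : Circ) - ((nodeOf p ω u).θ : ℝ)‖ ≤
            deltaTheta p.R (ω u).2 (boundary p j) + 2 * Real.pi / cellsOf p ω j
            then 1 else 0)) := by
  induction len generalizing j buffer with
  | zero => simp [runAnnuli]
  | succ len ih =>
    rw [List.range'_succ, Finset.sum_eq_sum_Ico_succ_bot (by omega)]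
    simp only [runAnnuli, time_bind]
    obtain ⟨h1, h2⟩ := runAnnulus_spec h hω j hbuf
    have hb : below p ω (j + 1) = upTo p ω j := by
      ext v; simp [below, upTo]
    have := ih (j + 1) (hb ▸ h1)
    rw [show j + 1 + len = j + (len + 1) by omega] at this
    exact add_le_add h2 this

theorem time_generator_le (h : p.Valid) (hω : InDisk p ω) :
    (generator p ω).time ≤ 2 + numAnnuli p + 4 * p.n + (below p ω (numCliqueAnnuli p)).card ^ 2 +
      ∑ j ∈ Finset.range (numAnnuli p), (7 + 15 * (upTo p ω j).card +
        ∑ u ∈ upTo p ω j, (spanOf p.R (boundary p j) (cellsOf p ω j) (nodeOf p ω u) +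
          ∑ v ∈ inAnnulus p ω j, if ‖((nodeOf p ω v).θ : Circ) - ((nodeOf p ω u).θ : ℝ)‖ ≤
            deltaTheta p.R (ω u).2 (boundary p j) + 2 * Real.pi / cellsOf p ω j
            then 1 else 0)) := by
  have hsum : ∀ f : Fin p.n → ℕ, ((drawPoints p ω 0 (cliqueRadius p)).val.map f).sum =
      ∑ v ∈ below p ω (numCliqueAnnuli p), f v := by
    intro f
    rw [sum_map_drawPoints]
    refine Finset.sum_congr ?_ fun _ _ => rfl
    ext v
    simp only [below, Finset.mem_filter, Finset.mem_univ, true_and]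
    rw [cliqueRadius, ← annulus_lt_iff h (hω v).1]
    simp [(hω v).1]
  have htime := time_drawPoints p ω 0 (cliqueRadius p)
  unfold generator
  simp only [time_bind, time_tick, val_placeNodes, time_placeNodes]
  rw [htime]
  set vs := (drawPoints p ω 0 (cliqueRadius p)).val with hvs
  have hlen : vs.length = (below p ω (numCliqueAnnuli p)).card := by simpa using hsum fun _ => 1
  have hn : vs.length ≤ p.n := by
    rw [hlen]
    exact (Finset.card_le_univ _).trans (by simp)
  have hdom : Dominated p ω (vs.map (nodeOf p ω)) (below p ω (numCliqueAnnuli p)) := by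
    intro f
    rw [List.map_map, hsum]
    exact le_rfl
  have h1 := time_runAnnuli_le h hω (numAnnuli p - numCliqueAnnuli p) (numCliqueAnnuli p) hdom
  have h2 := time_emitClique (vs.map (nodeOf p ω))
  rw [List.length_map, hlen] at h2
  have hk : numCliqueAnnuli p ≤ numAnnuli p := Nat.div_le_self _ _
  rw [show numCliqueAnnuli p + (numAnnuli p - numCliqueAnnuli p) = numAnnuli p by omega] at h1
  -- Adding the clique annuli to the sum only enlarges the bound and makes its range uniform.
  have h3 := h1.trans (Finset.sum_le_sum_of_subset (t := Finset.range (numAnnuli p)) (by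
    intro x; simp only [Finset.mem_Ico, Finset.mem_range]; omega))
  omega

end Annulus

/-! ### Running time and number of edges against counts of close pairs. -/

section

variable {p : Params} {ω : Fin p.n → ℝ × ℝ}

/-- The vertices in annulus `i`, when `τ` gives the annuli of all vertices. -/
def annulusSet {n : ℕ} (τ : Fin n → ℕ) (i : ℕ) : Finset (Fin n) :=
  Finset.univ.filter fun v => τ v = i

/-- A bound on the width of a request of a vertex of annulus `i` in annulus `j`, rounded to
cells. -/
def requestWidth (p : Params) (τ : Fin p.n → ℕ) (i j : ℕ) : ℝ :=
  reachConst p.α * scale p i j + 2 * Real.pi / numCells p.κ (annulusSet τ j).card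

/-- The order of magnitude of the number of edges. -/
def edgeScale (p : Params) (τ : Fin p.n → ℕ) : ℝ :=
  ∑ j ∈ Finset.range (numAnnuli p), ∑ i ∈ Finset.range (j + 1),
    ((annulusSet τ i).card * (annulusSet τ j).card * scale p i j : ℝ)

/-- The number of requests in all annuli. -/
def totalDepth (p : Params) (τ : Fin p.n → ℕ) : ℝ := ∑ v, ((numAnnuli p - τ v : ℕ) : ℝ)

/-- The angles of the placed points, modulo `2π`. -/
abbrev anglesOf (p : Params) (ω : Fin p.n → ℝ × ℝ) : Fin p.n → Circ := (configuration p ω).1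

/-- The annuli of the placed points. -/
abbrev annuliOf (p : Params) (ω : Fin p.n → ℝ × ℝ) : Fin p.n → ℕ := (configuration p ω).2

theorem sum_upTo_eq (j : ℕ) (f : Fin p.n → ℝ) :
    ∑ u ∈ upTo p ω j, f u =
      ∑ i ∈ Finset.range (j + 1), ∑ u ∈ annulusSet (annuliOf p ω) i, f u := by
  rw [← Finset.sum_fiberwise_of_maps_to (s := upTo p ω j) (t := Finset.range (j + 1))
    (g := annuliOf p ω)]
  · refine Finset.sum_congr rfl fun i hi => Finset.sum_congr ?_ fun _ _ => rfl
    ext v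
    simp only [upTo, annulusSet, Finset.mem_filter, Finset.mem_univ, true_and]
    rw [Finset.mem_range] at hi
    constructor
    · exact fun h => h.2
    · intro h
      have h' : annulus p (ω v).2 = i := h
      exact ⟨by omega, h⟩
  · intro v hv
    have : annulus p (ω v).2 ≤ j := (Finset.mem_filter.1 hv).2
    exact Finset.mem_range.2 (Nat.lt_succ_of_le this)

theorem sum_card_upTo : ∑ j ∈ Finset.range (numAnnuli p), ((upTo p ω j).card : ℝ) =
    totalDepth p (annuliOf p ω) := by
  have h1 : ∀ j, ((upTo p ω j).card : ℝ) = ∑ v, if annuliOf p ω v ≤ j then (1 : ℝ) else 0 := by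
    intro j
    rw [Finset.sum_boole]; rfl
  simp only [h1]
  rw [Finset.sum_comm, totalDepth]
  refine Finset.sum_congr rfl fun v _ => ?_
  rw [Finset.sum_boole]
  congr 1
  rw [show (Finset.range (numAnnuli p)).filter (fun j => annuliOf p ω v ≤ j) =
    Finset.Ico (annuliOf p ω v) (numAnnuli p) by
      ext x; simp only [Finset.mem_filter, Finset.mem_range, Finset.mem_Ico]; omega]
  simp

theorem sum_sum_near_le {n : ℕ} (A B : Finset (Fin n)) (W : ℝ) (ϑ : Fin n → Circ) :
    ∑ u ∈ A, ∑ v ∈ B, near W (ϑ v) (ϑ u) ≤ nearSum (offPairs A B) W ϑ + A.card := by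
  have h1 : ∑ u ∈ A, ∑ v ∈ B, near W (ϑ v) (ϑ u) =
      ∑ e ∈ A ×ˢ B, near W (ϑ e.1) (ϑ e.2) := by
    rw [Finset.sum_product]
    exact Finset.sum_congr rfl fun u _ => Finset.sum_congr rfl fun v _ => near_comm _ _ _
  rw [h1, ← Finset.sum_filter_add_sum_filter_not _ (fun e : Fin n × Fin n => e.1 ≠ e.2)]
  refine add_le_add le_rfl ?_
  refine (Finset.sum_le_card_nsmul _ _ 1 fun _ _ => near_le_one _ _ _).trans ?_
  rw [nsmul_eq_mul, mul_one]
  have : ((A ×ˢ B).filter fun e : Fin n × Fin n => ¬ e.1 ≠ e.2).card ≤ A.card := by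
    refine Finset.card_le_card_of_injOn (fun e => e.1) ?_ ?_
    · intro e he
      exact (Finset.mem_product.1 (Finset.mem_filter.1 he).1).1
    · intro a ha b hb hab
      have ha' := (Finset.mem_filter.1 ha).2
      have hb' := (Finset.mem_filter.1 hb).2
      push Not at ha' hb'
      exact Prod.ext hab (by rw [← ha', ← hb']; exact hab)
  exact_mod_cast this

/-- Boundaries of two clique annuli add up to at most `R`, so their pairs have scale `1`, and the
square of the total count is at most twice its part with `i ≤ j`. -/
theorem sq_card_below_le (h : p.Valid) :
    ((below p ω (numCliqueAnnuli p)).card : ℝ) ^ 2 ≤ 2 * edgeScale p (annuliOf p ω) := by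
  set kc := numCliqueAnnuli p with hkc
  set N : ℕ → ℝ := fun i => (annulusSet (annuliOf p ω) i).card with hN
  have hN0 : ∀ i, 0 ≤ N i := fun i => Nat.cast_nonneg _
  have hcard : ((below p ω kc).card : ℝ) = ∑ i ∈ Finset.range kc, N i := by
    have := Finset.card_eq_sum_card_fiberwise (s := below p ω kc) (t := Finset.range kc)
      (f := annuliOf p ω) fun v hv => Finset.mem_coe.2 (Finset.mem_range.2 (Finset.mem_filter.1 hv).2)
    rw [this]
    push_cast
    refine Finset.sum_congr rfl fun i hi => ?_
    rw [hN]
    congr 2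
    ext v
    simp only [below, annulusSet, Finset.mem_filter, Finset.mem_univ, true_and]
    rw [Finset.mem_range] at hi
    constructor
    · exact fun h => h.2
    · intro h
      have h' : annulus p (ω v).2 = i := h
      exact ⟨by omega, h⟩
  have hsq : ∀ m, (∑ i ∈ Finset.range m, N i) ^ 2 ≤
      2 * ∑ j ∈ Finset.range m, ∑ i ∈ Finset.range (j + 1), N i * N j := by
    intro m
    induction m with
    | zero => simp
    | succ m ih =>
      rw [Finset.sum_range_succ, Finset.sum_range_succ, ← Finset.sum_mul, Finset.sum_range_succ]
      nlinarith [mul_nonneg (hN0 m) (hN0 m)]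
  rw [hcard]
  refine (hsq kc).trans (mul_le_mul_of_nonneg_left ?_ zero_le_two)
  have hk : kc ≤ numAnnuli p := Nat.div_le_self _ _
  calc _ = ∑ j ∈ Finset.range kc, ∑ i ∈ Finset.range (j + 1), N i * N j * scale p i j := by
        refine Finset.sum_congr rfl fun j hj => Finset.sum_congr rfl fun i hi => ?_
        rw [Finset.mem_range] at hi hj
        rw [scale_eq_one_of_lt_clique h (by omega) hj, mul_one]
    _ ≤ _ := Finset.sum_le_sum_of_subset_of_nonneg (Finset.range_mono hk) fun _ _ _ =>
        Finset.sum_nonneg fun i _ => mul_nonneg (mul_nonneg (hN0 _) (hN0 _)) (scale_nonneg _ _ _)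

/-- The running time in terms of the numbers of pairs of points at a bounded angle. -/
theorem time_generator_le_nearSum (h : p.Valid) (hω : InDisk p ω) :
    ((generator p ω).time : ℝ) ≤ 2 + 8 * numAnnuli p + 4 * p.n +
      (18 + reachConst p.α) * totalDepth p (annuliOf p ω) +
      (2 + reachConst p.α) * edgeScale p (annuliOf p ω) +
      ∑ j ∈ Finset.range (numAnnuli p), ∑ i ∈ Finset.range (j + 1),
        nearSum (offPairs (annulusSet (annuliOf p ω) i) (annulusSet (annuliOf p ω) j))
          (requestWidth p (annuliOf p ω) i j) (anglesOf p ω) := by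
  have hα := h.α_pos
  have hrc : 0 ≤ reachConst p.α := Real.pi_pos.le.trans (pi_le_reachConst hα)
  have h0 : ((generator p ω).time : ℝ) ≤ _ := Nat.cast_le.2 (time_generator_le h hω)
  push_cast at h0
  refine h0.trans ?_
  have hclique := sq_card_below_le (ω := ω) h
  set τ := annuliOf p ω with hτ
  set ϑ := anglesOf p ω with hϑ
  -- Per request, `18 + reachConst` consists of `15`, of `2 + reachConst` for rounding the span and
  -- for `numCells ≤ N + 1`, and of `1` for pairing a vertex with itself.
  have hj : ∀ j ∈ Finset.range (numAnnuli p), (7 + 15 * ((upTo p ω j).card : ℝ) +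
      ∑ u ∈ upTo p ω j, ((spanOf p.R (boundary p j) (cellsOf p ω j) (nodeOf p ω u) : ℝ) +
        ∑ v ∈ inAnnulus p ω j, if ‖((nodeOf p ω v).θ : Circ) - ((nodeOf p ω u).θ : ℝ)‖ ≤
          deltaTheta p.R (ω u).2 (boundary p j) + 2 * Real.pi / cellsOf p ω j then 1 else 0)) ≤
      7 + (18 + reachConst p.α) * ((upTo p ω j).card : ℝ) +
        (reachConst p.α * ∑ i ∈ Finset.range (j + 1),
          ((annulusSet τ i).card * (annulusSet τ j).card * scale p i j : ℝ) +
        ∑ i ∈ Finset.range (j + 1),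
          nearSum (offPairs (annulusSet τ i) (annulusSet τ j)) (requestWidth p τ i j) ϑ) := by
    intro j hj
    have hjk := Finset.mem_range.1 hj
    set Nj : ℝ := ((annulusSet τ j).card : ℝ) with hNj
    have hc : cellsOf p ω j = numCells p.κ (annulusSet τ j).card := rfl
    have hcle : (cellsOf p ω j : ℝ) ≤ Nj + 1 := by
      rw [hc, hNj]
      exact_mod_cast numCells_le p.κ (annulusSet τ j).card
    have hu : ∀ u ∈ upTo p ω j,
        ((spanOf p.R (boundary p j) (cellsOf p ω j) (nodeOf p ω u) : ℝ) +
        ∑ v ∈ inAnnulus p ω j, if ‖((nodeOf p ω v).θ : Circ) - ((nodeOf p ω u).θ : ℝ)‖ ≤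
          deltaTheta p.R (ω u).2 (boundary p j) + 2 * Real.pi / cellsOf p ω j then 1 else 0) ≤
        (2 + reachConst p.α) + (reachConst p.α * (Nj * scale p (τ u) j) +
          ∑ v ∈ annulusSet τ j, near (requestWidth p τ (τ u) j) (ϑ v) (ϑ u)) := by
      intro u _
      have hΔ : deltaTheta p.R (ω u).2 (boundary p j) ≤ reachConst p.α * scale p (τ u) j :=
        deltaTheta_boundary_le h (hω u).1 (hω u).2 hjk
      have hΔ0 := deltaTheta_nonneg p.R (ω u).2 (boundary p j)
      have hs : (spanOf p.R (boundary p j) (cellsOf p ω j) (nodeOf p ω u) : ℝ) ≤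
          deltaTheta p.R (ω u).2 (boundary p j) * cellsOf p ω j / Real.pi + 2 :=
        spanOf_le_real _ _ _ _
      have hs2 : deltaTheta p.R (ω u).2 (boundary p j) * cellsOf p ω j / Real.pi ≤
          reachConst p.α * (Nj * scale p (τ u) j) + reachConst p.α := by
        have hp : deltaTheta p.R (ω u).2 (boundary p j) * cellsOf p ω j ≤
            (reachConst p.α * scale p (τ u) j) * (Nj + 1) :=
          mul_le_mul hΔ hcle (Nat.cast_nonneg _) (hΔ0.trans hΔ)
        have hp1 : deltaTheta p.R (ω u).2 (boundary p j) * cellsOf p ω j / Real.pi ≤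
            deltaTheta p.R (ω u).2 (boundary p j) * cellsOf p ω j :=
          div_le_self (by positivity) (by linarith [Real.pi_gt_three])
        have hp2 : reachConst p.α * scale p (τ u) j ≤ reachConst p.α :=
          mul_le_of_le_one_right hrc (scale_le_one _ _ _)
        linarith
      have hn : (∑ v ∈ inAnnulus p ω j,
          if ‖((nodeOf p ω v).θ : Circ) - ((nodeOf p ω u).θ : ℝ)‖ ≤
          deltaTheta p.R (ω u).2 (boundary p j) + 2 * Real.pi / cellsOf p ω j
          then (1 : ℝ) else 0) ≤
          ∑ v ∈ annulusSet τ j, near (requestWidth p τ (τ u) j) (ϑ v) (ϑ u) := by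
        refine Finset.sum_le_sum fun v _ => ?_
        unfold near
        split_ifs with h1 h2 <;> try norm_num
        refine h2 (h1.trans ?_)
        rw [requestWidth, ← hc]
        linarith
      linarith
    have hsum := (Finset.sum_le_sum hu).trans_eq Finset.sum_add_distrib
    rw [Finset.sum_const, nsmul_eq_mul, sum_upTo_eq j fun u =>
      reachConst p.α * (Nj * scale p (τ u) j) +
        ∑ v ∈ annulusSet τ j, near (requestWidth p τ (τ u) j) (ϑ v) (ϑ u)] at hsum
    have hi : ∀ i ∈ Finset.range (j + 1), ∑ u ∈ annulusSet τ i,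
        (reachConst p.α * (Nj * scale p (τ u) j) +
          ∑ v ∈ annulusSet τ j, near (requestWidth p τ (τ u) j) (ϑ v) (ϑ u)) ≤
        (reachConst p.α * ((annulusSet τ i).card * Nj * scale p i j) +
          nearSum (offPairs (annulusSet τ i) (annulusSet τ j)) (requestWidth p τ i j) ϑ) +
          ∑ u ∈ annulusSet τ i, 1 := by
      intro i _
      have e1 : ∀ u ∈ annulusSet τ i, (reachConst p.α * (Nj * scale p (τ u) j) +
          ∑ v ∈ annulusSet τ j, near (requestWidth p τ (τ u) j) (ϑ v) (ϑ u)) =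
          reachConst p.α * (Nj * scale p i j) +
          ∑ v ∈ annulusSet τ j, near (requestWidth p τ i j) (ϑ v) (ϑ u) := by
        intro u hu
        rw [(Finset.mem_filter.1 hu).2]
      rw [Finset.sum_congr rfl e1, Finset.sum_add_distrib, Finset.sum_const, nsmul_eq_mul]
      have e2 := sum_sum_near_le (annulusSet τ i) (annulusSet τ j) (requestWidth p τ i j) ϑ
      have e3 : ∑ u ∈ annulusSet τ i, (1 : ℝ) = (annulusSet τ i).card := by simp
      rw [e3]
      linarith
    have hsum2 := (Finset.sum_le_sum hi).trans_eq Finset.sum_add_distrib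
    rw [Finset.sum_add_distrib (f := fun i => reachConst p.α * _), ← Finset.mul_sum,
      ← sum_upTo_eq j fun _ => 1, Finset.sum_const, nsmul_eq_mul] at hsum2
    have hgoal := hsum.trans (add_le_add le_rfl hsum2)
    linarith
  have htot : _ ≤ numAnnuli p * 7 + (18 + reachConst p.α) * totalDepth p τ +
      (reachConst p.α * edgeScale p τ +
        ∑ j ∈ Finset.range (numAnnuli p), ∑ i ∈ Finset.range (j + 1),
          nearSum (offPairs (annulusSet τ i) (annulusSet τ j)) (requestWidth p τ i j) ϑ) :=
    (Finset.sum_le_sum hj).trans_eq (by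
      rw [Finset.sum_add_distrib, Finset.sum_add_distrib, Finset.sum_add_distrib,
        ← Finset.mul_sum, ← Finset.mul_sum, Finset.sum_const, nsmul_eq_mul, Finset.card_range,
        sum_card_upTo]
      rfl)
  linarith

/-- A lower bound on the number of edges in terms of the numbers of pairs of points at a bounded
angle. -/
theorem sum_nearSum_le_numEdges (h : p.Valid) (hω : InDisk p ω) :
    ∑ j ∈ Finset.range (numAnnuli p), ∑ i ∈ Finset.range (j + 1),
      nearSum (offPairs (annulusSet (annuliOf p ω) i) (annulusSet (annuliOf p ω) j))
        (adjConst p.α * scale p i j) (anglesOf p ω) ≤ 2 * numEdges p ω := by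
  classical
  set τ := annuliOf p ω with hτ
  set ϑ := anglesOf p ω with hϑ
  set G := hyperbolicGraph p ω with hG
  set D : Finset (Fin p.n × Fin p.n) := Finset.univ.filter fun e => G.Adj e.1 e.2 with hD
  have hDcard : D.card = 2 * numEdges p ω := by
    have h1 : numEdges p ω = G.edgeFinset.card := by
      rw [numEdges, ← Set.ncard_coe_finset, SimpleGraph.coe_edgeFinset]
    rw [h1, ← SimpleGraph.sum_degrees_eq_twice_card_edges, hD, Finset.card_filter,
      ← Finset.univ_product_univ, Finset.sum_product]
    refine Finset.sum_congr rfl fun u _ => ?_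
    rw [← Finset.card_filter, ← SimpleGraph.card_neighborFinset_eq_degree]
    congr 1
    ext v
    simp
  have hlt : ∀ v, τ v < numAnnuli p := by
    intro v
    refine (annulus_lt_iff h (hω v).1 _).2 ?_
    rw [boundary_numAnnuli h]; exact (hω v).2
  -- Close pairs are adjacent, and different `(i, j)` give disjoint classes of ordered pairs. `D`
  -- contains both orientations of an edge, hence the factor `2`.
  have hle : ∀ i j, nearSum (offPairs (annulusSet τ i) (annulusSet τ j))
      (adjConst p.α * scale p i j) ϑ ≤ (D.filter fun e => (τ e.2, τ e.1) = (j, i)).card := by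
    intro i j
    rw [nearSum]
    simp only [near]
    rw [Finset.sum_boole]
    refine Nat.cast_le.2 (Finset.card_le_card fun e he => ?_)
    simp only [offPairs, annulusSet, Finset.mem_filter, Finset.mem_product, Finset.mem_univ,
      true_and, hD] at he ⊢
    obtain ⟨⟨⟨h1, h2⟩, hne⟩, hn⟩ := he
    refine ⟨⟨hne, ?_⟩, by rw [h1, h2]⟩
    refine hypDist_lt_of_norm_le h (hω _).1 (hω _).2 (hω _).1 (hω _).2 ?_
    rw [← h1, ← h2] at hn
    exact hn
  have hmaps : ∀ e ∈ D, (τ e.2, τ e.1) ∈ Finset.range (numAnnuli p) ×ˢ Finset.range (numAnnuli p) :=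
    fun e _ => Finset.mem_product.2 ⟨Finset.mem_range.2 (hlt _), Finset.mem_range.2 (hlt _)⟩
  have hcast : (2 * numEdges p ω : ℝ) = D.card := by rw [hDcard]; push_cast; ring
  rw [hcast, Finset.card_eq_sum_card_fiberwise hmaps, Finset.sum_product]
  push_cast
  refine Finset.sum_le_sum fun j hj => ?_
  refine (Finset.sum_le_sum fun i _ => hle i j).trans ?_
  refine Finset.sum_le_sum_of_subset_of_nonneg ?_ fun _ _ _ => Nat.cast_nonneg _
  exact Finset.range_mono (Finset.mem_range.1 hj)

end

/-! ### The typical event and the comparison of time and edges. -/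

section

variable {p : Params} {ω : Fin p.n → ℝ × ℝ}

/-- The numbers of pairs of points within the width of a request, respectively at the scale of
adjacency, are of the expected order up to an additive error `Λ`. -/
def Concentrated (p : Params) (τ : Fin p.n → ℕ) (Λ : ℝ) (ϑ : Fin p.n → Circ) : Prop :=
  ∀ j < numAnnuli p, ∀ i ≤ j,
    nearSum (offPairs (annulusSet τ i) (annulusSet τ j)) (requestWidth p τ i j) ϑ ≤
        4 * ((annulusSet τ i).card * (annulusSet τ j).card * nearProb (requestWidth p τ i j)) + Λ ∧
      (annulusSet τ i).card * (annulusSet τ j).card * nearProb (adjConst p.α * scale p i j) / 8 - Λ ≤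
        nearSum (offPairs (annulusSet τ i) (annulusSet τ j)) (adjConst p.α * scale p i j) ϑ

theorem reachConst_nonneg {α : ℝ} (hα : 0 < α) : 0 ≤ reachConst α :=
  Real.pi_pos.le.trans (pi_le_reachConst hα)

theorem requestWidth_nonneg (h : p.Valid) (τ : Fin p.n → ℕ) (i j : ℕ) :
    0 ≤ requestWidth p τ i j :=
  add_nonneg (mul_nonneg (reachConst_nonneg h.α_pos) (scale_nonneg _ _ _))
    (div_nonneg Real.two_pi_pos.le (Nat.cast_nonneg _))

/-- Union bound over at most `k²` pairs of annuli and two widths. The annuli are fixed here, so the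
sets of vertices and both widths are deterministic. -/
theorem concentrated_tail (h : p.Valid) (τ : Fin p.n → ℕ) {L : ℕ} (hL : p.n ≤ 2 ^ L) (hL1 : 1 ≤ L)
    {s : ℝ} (hs : 1 ≤ s) :
    anglesLaw (Fin p.n) {ϑ | ¬ Concentrated p τ ((64 * L * s) ^ 2) ϑ} ≤
      (numAnnuli p ^ 2 * (2 * (p.n + 4 * L)) : ℕ) * ENNReal.ofReal (Real.exp (-s)) := by
  set k := numAnnuli p
  set ε := ENNReal.ofReal (Real.exp (-s))
  set E : ℕ × ℕ → ℝ → Set (Fin p.n → Circ) := fun c W =>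
    {ϑ | ¬ (nearSum (offPairs (annulusSet τ c.1) (annulusSet τ c.2)) W ϑ ≤
        4 * ((annulusSet τ c.1).card * (annulusSet τ c.2).card * nearProb W) + (64 * L * s) ^ 2 ∧
      (annulusSet τ c.1).card * (annulusSet τ c.2).card * nearProb W / 8 - (64 * L * s) ^ 2 ≤
        nearSum (offPairs (annulusSet τ c.1) (annulusSet τ c.2)) W ϑ)} with hE
  have hsub : {ϑ | ¬ Concentrated p τ ((64 * L * s) ^ 2) ϑ} ⊆
      ⋃ c ∈ Finset.range k ×ˢ Finset.range k,
        (E c (requestWidth p τ c.1 c.2) ∪ E c (adjConst p.α * scale p c.1 c.2)) := by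
    intro ϑ hϑ
    by_contra hcon
    simp only [Set.mem_iUnion, not_exists] at hcon
    refine hϑ fun j hj i hij => ?_
    have h1 := hcon (i, j) (Finset.mem_product.2
      ⟨Finset.mem_range.2 (hij.trans_lt hj), Finset.mem_range.2 hj⟩)
    rw [Set.mem_union, not_or] at h1
    exact ⟨(not_not.1 h1.1).1, (not_not.1 h1.2).2⟩
  refine (measure_mono hsub).trans ((measure_biUnion_finset_le _ _).trans ?_)
  refine (Finset.sum_le_card_nsmul _ _ ((2 * (p.n + 4 * L) : ℕ) * ε) fun c _ => ?_).trans ?_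
  · refine (measure_union_le _ _).trans ?_
    calc _ ≤ (p.n + 4 * L : ℕ) * ε + (p.n + 4 * L : ℕ) * ε :=
          add_le_add (nearSum_offPairs_concentration hL hL1 _ _ (requestWidth_nonneg h _ _ _) hs)
            (nearSum_offPairs_concentration hL hL1 _ _
              (mul_nonneg (adjConst_pos h.α_pos).le (scale_nonneg _ _ _)) hs)
      _ = _ := by push_cast; ring
  · rw [nsmul_eq_mul, Finset.card_product, Finset.card_range, ← mul_assoc]
    refine le_of_eq ?_
    push_cast; ring

theorem sum_sum_const_le (k : ℕ) {Λ : ℝ} (hΛ : 0 ≤ Λ) :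
    ∑ j ∈ Finset.range k, ∑ _i ∈ Finset.range (j + 1), Λ ≤ k ^ 2 * Λ := by
  calc _ ≤ ∑ _j ∈ Finset.range k, (k * Λ : ℝ) := by
        refine Finset.sum_le_sum fun j hj => ?_
        rw [Finset.sum_const, nsmul_eq_mul, Finset.card_range]
        have : (j + 1 : ℕ) ≤ k := Finset.mem_range.1 hj
        exact mul_le_mul_of_nonneg_right (by exact_mod_cast this) hΛ
    _ = _ := by rw [Finset.sum_const, nsmul_eq_mul, Finset.card_range]; ring

theorem time_le_of_concentrated (h : p.Valid) (hκ : 1 ≤ p.κ) (hω : InDisk p ω) {Λ : ℝ}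
    (hΛ : 0 ≤ Λ) (hc : Concentrated p (annuliOf p ω) Λ (anglesOf p ω)) :
    ((generator p ω).time : ℝ) ≤ 2 + 8 * numAnnuli p + 4 * p.n +
      (18 + reachConst p.α + 16 * p.κ) * totalDepth p (annuliOf p ω) +
      (2 + 5 * reachConst p.α) * edgeScale p (annuliOf p ω) + numAnnuli p ^ 2 * Λ := by
  have hrc := reachConst_nonneg h.α_pos
  have h0 := time_generator_le_nearSum h hω
  have hdepth : ∑ j ∈ Finset.range (numAnnuli p), ∑ i ∈ Finset.range (j + 1),
      ((annulusSet (annuliOf p ω) i).card : ℝ) = totalDepth p (annuliOf p ω) := by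
    rw [← sum_card_upTo]
    refine Finset.sum_congr rfl fun j _ => ?_
    have := sum_upTo_eq (ω := ω) j fun _ => 1
    simpa using this.symm
  set τ := annuliOf p ω
  set ϑ := anglesOf p ω
  have hij : ∀ j ∈ Finset.range (numAnnuli p), ∀ i ∈ Finset.range (j + 1),
      nearSum (offPairs (annulusSet τ i) (annulusSet τ j)) (requestWidth p τ i j) ϑ ≤
      4 * reachConst p.α * ((annulusSet τ i).card * (annulusSet τ j).card * scale p i j) +
        16 * p.κ * ((annulusSet τ i).card : ℝ) + Λ := by
    intro j hj i hi
    have hconc := (hc j (Finset.mem_range.1 hj) i (Nat.lt_succ_iff.1 (Finset.mem_range.1 hi))).1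
    have hW := requestWidth_nonneg h τ i j
    have hq : nearProb (requestWidth p τ i j) ≤ reachConst p.α * scale p i j +
        2 / numCells p.κ (annulusSet τ j).card := by
      rw [nearProb_eq hW]
      refine (min_le_right _ _).trans ?_
      rw [requestWidth, add_div]
      refine add_le_add (div_le_self (mul_nonneg hrc (scale_nonneg _ _ _))
        (by linarith [Real.pi_gt_three])) (le_of_eq ?_)
      have := Real.pi_ne_zero
      field_simp
    -- Rounding to cells adds at most `4κ` expected candidates per request. The factor `4` in
    -- `Concentrated` makes this `16κ`, and summing over `i ≤ j` gives `totalDepth`.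
    have hcell : ((annulusSet τ j).card : ℝ) * (2 / numCells p.κ (annulusSet τ j).card) ≤
        4 * p.κ := by
      have h1 : ((annulusSet τ j).card : ℝ) ≤ 2 * p.κ * numCells p.κ (annulusSet τ j).card := by
        exact_mod_cast le_mul_numCells hκ (annulusSet τ j).card
      have h2 : (0 : ℝ) < numCells p.κ (annulusSet τ j).card := by
        exact_mod_cast numCells_pos _ _
      rw [← mul_div_assoc, div_le_iff₀ h2]
      linarith
    have hNi : (0 : ℝ) ≤ (annulusSet τ i).card := Nat.cast_nonneg _
    have hNj : (0 : ℝ) ≤ (annulusSet τ j).card := Nat.cast_nonneg _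
    have e1 := mul_le_mul_of_nonneg_left hq (mul_nonneg hNi hNj)
    have e2 := mul_le_mul_of_nonneg_left hcell hNi
    linarith
  have hsum := Finset.sum_le_sum fun j hj => Finset.sum_le_sum (hij j hj)
  simp only [Finset.sum_add_distrib, ← Finset.mul_sum] at hsum
  rw [hdepth] at hsum
  change _ ≤ _ * edgeScale p τ + _ + _ at hsum
  have := sum_sum_const_le (numAnnuli p) hΛ
  linarith

theorem edgeScale_le_of_concentrated (h : p.Valid) (hω : InDisk p ω) {Λ : ℝ}
    (hΛ : 0 ≤ Λ) (hc : Concentrated p (annuliOf p ω) Λ (anglesOf p ω)) :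
    adjConst p.α / (8 * Real.pi) * edgeScale p (annuliOf p ω) - numAnnuli p ^ 2 * Λ ≤
      2 * numEdges p ω := by
  refine le_trans ?_ (sum_nearSum_le_numEdges h hω)
  set τ := annuliOf p ω
  set ϑ := anglesOf p ω
  have ha := adjConst_pos h.α_pos
  have ha1 := adjConst_le_one h.α_pos
  have hij : ∀ j ∈ Finset.range (numAnnuli p), ∀ i ∈ Finset.range (j + 1),
      adjConst p.α / (8 * Real.pi) *
        ((annulusSet τ i).card * (annulusSet τ j).card * scale p i j) - Λ ≤
      nearSum (offPairs (annulusSet τ i) (annulusSet τ j)) (adjConst p.α * scale p i j) ϑ := by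
    intro j hj i hi
    refine le_trans (le_of_eq ?_)
      (hc j (Finset.mem_range.1 hj) i (Nat.lt_succ_iff.1 (Finset.mem_range.1 hi))).2
    have hw0 := mul_nonneg ha.le (scale_nonneg p i j)
    -- The width stays below `π`, so `nearProb` is exactly linear in it.
    have hw1 : adjConst p.α * scale p i j ≤ 1 :=
      mul_le_one₀ ha1 (scale_nonneg p i j) (scale_le_one p i j)
    have hpi := Real.pi_pos
    rw [nearProb_eq hw0, min_eq_right ((div_le_one hpi).2 (by linarith [Real.pi_gt_three]))]
    field_simp
  have hsum := Finset.sum_le_sum fun j hj => Finset.sum_le_sum (hij j hj)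
  simp only [Finset.sum_sub_distrib, ← Finset.mul_sum] at hsum
  change _ * edgeScale p τ - _ ≤ _ at hsum
  have := sum_sum_const_le (numAnnuli p) hΛ
  linarith

/-- Only the term `i = j` of the outermost annulus is kept; its boundary is at most `R`. -/
theorem sq_mul_exp_le_edgeScale (h : p.Valid) (τ : Fin p.n → ℕ) :
    ((annulusSet τ (numAnnuli p - 1)).card : ℝ) ^ 2 * Real.exp (-(p.R / 2)) ≤ edgeScale p τ := by
  have hk := h.numAnnuli_pos
  have hN : ∀ i, (0 : ℝ) ≤ (annulusSet τ i).card := fun i => Nat.cast_nonneg _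
  have hnn : ∀ i j, 0 ≤ ((annulusSet τ i).card * (annulusSet τ j).card * scale p i j : ℝ) :=
    fun i j => mul_nonneg (mul_nonneg (hN i) (hN j)) (scale_nonneg _ _ _)
  have h1 := Finset.single_le_sum (f := fun j => ∑ i ∈ Finset.range (j + 1),
    ((annulusSet τ i).card * (annulusSet τ j).card * scale p i j : ℝ))
    (fun j _ => Finset.sum_nonneg fun i _ => hnn i j)
    (Finset.mem_range.2 (Nat.sub_lt hk one_pos))
  have h2 := Finset.single_le_sum (f := fun i =>
    ((annulusSet τ i).card * (annulusSet τ (numAnnuli p - 1)).card *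
      scale p i (numAnnuli p - 1) : ℝ)) (fun i _ => hnn i _)
    (Finset.mem_range.2 (Nat.lt_succ_self (numAnnuli p - 1)))
  refine le_trans ?_ (h2.trans h1)
  rw [sq]
  exact mul_le_mul_of_nonneg_left (exp_neg_half_le_scale h (Nat.sub_lt hk one_pos))
    (mul_nonneg (hN _) (hN _))

/-- The event on which the running time is bounded. -/
def Typical (p : Params) (L : ℕ) (s : ℝ) (ω : Fin p.n → ℝ × ℝ) : Prop :=
  InDisk p ω ∧ totalDepth p (annuliOf p ω) < 4 * p.n + numAnnuli p * s ∧
    p.n / 4 - s < (annulusSet (annuliOf p ω) (numAnnuli p - 1)).card ∧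
    Concentrated p (annuliOf p ω) ((64 * L * s) ^ 2) (anglesOf p ω)

theorem ae_inDisk (h : p.Valid) : ∀ᵐ ω ∂sampleLaw p, InDisk p ω := by
  have := isProbabilityMeasure_radialLaw' h
  have h1 : ∀ᵐ r ∂radialLaw p.α p.R, 0 ≤ r ∧ r < p.R := radialLaw_compl_Ico p.α p.R
  have h2 : ∀ᵐ y ∂angleLaw.prod (radialLaw p.α p.R), 0 ≤ y.2 ∧ y.2 < p.R :=
    (measurePreserving_snd (μ := angleLaw)).quasiMeasurePreserving.ae h1
  refine ae_all_iff.2 fun v => ?_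
  exact (measurePreserving_eval (fun _ : Fin p.n => angleLaw.prod (radialLaw p.α p.R))
    v).quasiMeasurePreserving.ae h2

theorem typical_tail (h : p.Valid) {L : ℕ} (hL : p.n ≤ 2 ^ L) (hL1 : 1 ≤ L) {s : ℝ} (hs : 1 ≤ s) :
    sampleLaw p {ω | ¬ Typical p L s ω} ≤
      (numAnnuli p ^ 2 * (2 * (p.n + 4 * L)) + 2 : ℕ) * ENNReal.ofReal (Real.exp (-s)) := by
  have := isProbabilityMeasure_radialLaw' h
  have := isProbabilityMeasure_annulusLaw h
  set ε := ENNReal.ofReal (Real.exp (-s))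
  set E1 : Set ((Fin p.n → Circ) × (Fin p.n → ℕ)) :=
    {q | q.1 ∈ (fun τ : Fin p.n → ℕ => {ϑ | ¬ Concentrated p τ ((64 * L * s) ^ 2) ϑ}) q.2}
  set E2 : Set ((Fin p.n → Circ) × (Fin p.n → ℕ)) := Set.univ ×ˢ
    {τ | 4 * p.n + numAnnuli p * s ≤ totalDepth p τ}
  set E3 : Set ((Fin p.n → Circ) × (Fin p.n → ℕ)) := Set.univ ×ˢ
    {τ | ((annulusSet τ (numAnnuli p - 1)).card : ℝ) ≤ p.n / 4 - s}
  have hsub : {ω | ¬ Typical p L s ω} ⊆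
      {ω | ¬ InDisk p ω} ∪ configuration p ⁻¹' (E1 ∪ (E2 ∪ E3)) := by
    intro ω hω
    by_contra hcon
    rw [Set.mem_union, not_or] at hcon
    obtain ⟨h1, h2⟩ := hcon
    rw [Set.mem_preimage, Set.mem_union, Set.mem_union, not_or, not_or] at h2
    obtain ⟨h2, h3, h4⟩ := h2
    exact hω ⟨not_not.1 h1, not_le.1 fun hc => h3 ⟨Set.mem_univ _, hc⟩,
      not_le.1 fun hc => h4 ⟨Set.mem_univ _, hc⟩, not_not.1 h2⟩
  have hnull : sampleLaw p {ω | ¬ InDisk p ω} = 0 := ae_inDisk h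
  have hmp := measurePreserving_configuration p
  -- An inequality valid for arbitrary sets, so measurability of `E1` need not be shown.
  have hpre : ∀ E, sampleLaw p (configuration p ⁻¹' E) ≤
      ((anglesLaw (Fin p.n)).prod (annuliLaw p)) E := by
    intro E
    rw [← hmp.map_eq]
    exact Measure.le_map_apply hmp.aemeasurable E
  have h1 : ((anglesLaw (Fin p.n)).prod (annuliLaw p)) E1 ≤
      (numAnnuli p ^ 2 * (2 * (p.n + 4 * L)) : ℕ) * ε :=
    prod_le_of_forall_section_le fun τ => concentrated_tail h τ hL hL1 hs
  have h2 : ((anglesLaw (Fin p.n)).prod (annuliLaw p)) E2 ≤ ε := by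
    rw [Measure.prod_prod, measure_univ, one_mul]
    exact sum_depth_tail h s
  have h3 : ((anglesLaw (Fin p.n)).prod (annuliLaw p)) E3 ≤ ε := by
    rw [Measure.prod_prod, measure_univ, one_mul]
    exact card_last_tail h s
  calc _ ≤ sampleLaw p {ω | ¬ InDisk p ω} + sampleLaw p (configuration p ⁻¹' (E1 ∪ (E2 ∪ E3))) :=
        (measure_mono hsub).trans (measure_union_le _ _)
    _ ≤ 0 + ((numAnnuli p ^ 2 * (2 * (p.n + 4 * L)) : ℕ) * ε + (ε + ε)) := by
        rw [hnull]
        refine add_le_add le_rfl ((hpre _).trans ((measure_union_le _ _).trans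
          (add_le_add h1 ((measure_union_le _ _).trans (add_le_add h2 h3)))))
    _ = _ := by push_cast; ring

/-- On the typical event the running time is linear in the number of edges. -/
theorem time_le_of_typical (h : p.Valid) (hκ : 1 ≤ p.κ) {L : ℕ} {s q : ℝ} (hq : 0 < q)
    (hω : Typical p L s ω) (hn : 1 ≤ p.n) (hR : 64 * q ≤ p.n * Real.exp (-(p.R / 2)))
    (hk : (numAnnuli p : ℝ) ≤ p.n) (hks : numAnnuli p * s ≤ p.n) (hs : 8 * s ≤ p.n)
    (hΛ1 : numAnnuli p ^ 2 * (64 * L * s) ^ 2 ≤ p.n)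
    (hΛ2 : numAnnuli p ^ 2 * (64 * L * s) ^ 2 ≤ adjConst p.α / (16 * Real.pi) * (q * p.n)) :
    ((generator p ω).time : ℝ) ≤
      ((15 + 5 * (18 + reachConst p.α + 16 * p.κ)) / q + (2 + 5 * reachConst p.α)) *
        (32 * Real.pi / adjConst p.α) * numEdges p ω := by
  obtain ⟨hdisk, hdepth, hlast, hconc⟩ := hω
  have h1 := time_le_of_concentrated h hκ hdisk (sq_nonneg _) hconc
  have h2 := edgeScale_le_of_concentrated h hdisk (sq_nonneg _) hconc
  have h3 := sq_mul_exp_le_edgeScale h (annuliOf p ω)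
  have hrc := reachConst_nonneg h.α_pos
  have hac := adjConst_pos h.α_pos
  have hpi := Real.pi_pos
  have hn' : (1 : ℝ) ≤ p.n := by exact_mod_cast hn
  have hκ0 : (0 : ℝ) ≤ p.κ := Nat.cast_nonneg _
  set Q := edgeScale p (annuliOf p ω)
  set N := ((annulusSet (annuliOf p ω) (numAnnuli p - 1)).card : ℝ)
  set D := totalDepth p (annuliOf p ω)
  set Λ := (numAnnuli p : ℝ) ^ 2 * (64 * L * s) ^ 2
  set m := (numEdges p ω : ℝ)
  set r := reachConst p.α
  set a := adjConst p.α
  set n := (p.n : ℝ)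
  -- The outermost annulus has more than `n/4 - s ≥ n/8` vertices, which is where `64 = 8²` in `hR`
  -- comes from.
  have hQ : q * n ≤ Q := by
    refine le_trans ?_ h3
    have e1 : (n / 8) ^ 2 ≤ N ^ 2 := pow_le_pow_left₀ (by positivity) (by linarith) 2
    calc q * n = n / 64 * (64 * q) := by ring
      _ ≤ n / 64 * (n * Real.exp (-(p.R / 2))) := mul_le_mul_of_nonneg_left hR (by positivity)
      _ = (n / 8) ^ 2 * Real.exp (-(p.R / 2)) := by ring
      _ ≤ _ := mul_le_mul_of_nonneg_right e1 (Real.exp_pos _).le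
  have hnQ : n ≤ Q / q := (le_div_iff₀ hq).2 (by linarith)
  -- Half of the lower bound `a / (8π) * Q` on `2m` is spent on absorbing `Λ`.
  have hQm : Q ≤ 32 * Real.pi / a * m := by
    have e1 : a / (16 * Real.pi) * (q * n) ≤ a / (16 * Real.pi) * Q :=
      mul_le_mul_of_nonneg_left hQ (by positivity)
    have e2 : a / (8 * Real.pi) * Q = 2 * (a / (16 * Real.pi) * Q) := by field_simp; ring
    have e3 : a / (16 * Real.pi) * Q ≤ 2 * m := by linarith
    calc Q = 16 * Real.pi / a * (a / (16 * Real.pi) * Q) := by field_simp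
      _ ≤ 16 * Real.pi / a * (2 * m) := mul_le_mul_of_nonneg_left e3 (by positivity)
      _ = _ := by ring
  -- Here `15 = 2 + 8 + 4 + 1`, the last for `Λ ≤ n`, and `D ≤ 4n + k s ≤ 5n`.
  have hT : ((generator p ω).time : ℝ) ≤ (15 + 5 * (18 + r + 16 * p.κ)) * n + (2 + 5 * r) * Q := by
    have e1 : (18 + r + 16 * p.κ) * D ≤ (18 + r + 16 * p.κ) * (5 * n) :=
      mul_le_mul_of_nonneg_left (by linarith) (by positivity)
    linarith
  have hK : (15 + 5 * (18 + r + 16 * p.κ)) * n ≤ (15 + 5 * (18 + r + 16 * p.κ)) * (Q / q) :=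
    mul_le_mul_of_nonneg_left hnQ (by positivity)
  calc _ ≤ ((15 + 5 * (18 + r + 16 * p.κ)) / q + (2 + 5 * r)) * Q := by
        refine hT.trans ((add_le_add hK le_rfl).trans (le_of_eq (by ring)))
    _ ≤ ((15 + 5 * (18 + r + 16 * p.κ)) / q + (2 + 5 * r)) * (32 * Real.pi / a * m) :=
        mul_le_mul_of_nonneg_left hQm (by positivity)
    _ = _ := by ring

/-! ### Choice of the logarithmic parameters. -/

theorem eventually_log_pow_le (X : ℝ) :
    ∀ᶠ n : ℕ in Filter.atTop, X * Real.log n ^ 6 ≤ n := by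
  have h1 : (fun x : ℝ => X * Real.log x ^ 6) =o[Filter.atTop] fun x : ℝ => x :=
    (Real.isLittleO_pow_log_id_atTop (n := 6)).const_mul_left X
  have h2 := (h1.bound one_pos).filter_mono le_rfl
  filter_upwards [tendsto_natCast_atTop_atTop.eventually h2] with n hn
  rw [one_mul, Real.norm_of_nonneg (Nat.cast_nonneg n)] at hn
  exact (le_abs_self _).trans hn

theorem numAnnuli_rhgParams_le {n : ℕ} {γ C C₀ : ℝ} {κ : ℕ} (hγ : 2 ≤ γ) (hC : C ≤ C₀)
    (hv : (rhgParams n γ C κ).Valid) (hlog : 1 ≤ Real.log n) :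
    (numAnnuli (rhgParams n γ C κ) : ℝ) ≤ (γ - 1) / 2 * (2 + |C₀|) / Real.log 2 * Real.log n := by
  have h2 := Real.log_pos one_lt_two
  have h := hv.numAnnuli_mul_log_le
  rw [← le_div_iff₀ h2] at h
  refine h.trans ?_
  rw [div_mul_eq_mul_div]
  refine div_le_div_of_nonneg_right ?_ h2.le
  change (γ - 1) / 2 * (2 * Real.log n + C) ≤ _
  rw [mul_assoc]
  refine mul_le_mul_of_nonneg_left ?_ (by linarith)
  have : |C₀| ≤ |C₀| * Real.log n := le_mul_of_one_le_right (abs_nonneg _) hlog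
  linarith [le_abs_self C₀]

theorem natLog_add_one_le {n : ℕ} (hlog : 1 ≤ Real.log n) :
    ((Nat.log 2 n + 1 : ℕ) : ℝ) ≤ 3 * Real.log n := by
  have hn : n ≠ 0 := by
    rintro rfl
    norm_num at hlog
  have h1 : ((2 : ℝ) ^ Nat.log 2 n) ≤ n := by exact_mod_cast Nat.pow_log_le_self 2 hn
  have h2 := Real.log_le_log (by positivity) h1
  rw [Real.log_pow] at h2
  have h3 := Real.log_two_gt_d9
  have h4 : (Nat.log 2 n : ℝ) * (1 / 2) ≤ Nat.log 2 n * Real.log 2 :=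
    mul_le_mul_of_nonneg_left (by linarith) (Nat.cast_nonneg _)
  push_cast
  linarith

/-- The number of bad events is at most `11 n³ ≤ n⁴`, which costs `4` in the exponent. -/
theorem union_bound_le {n k L : ℕ} {c : ℝ} (hn : 20 ≤ n) (hk : k ≤ n) (hL : L ≤ n) :
    ((k ^ 2 * (2 * (n + 4 * L)) + 2 : ℕ) : ENNReal) *
      ENNReal.ofReal (Real.exp (-((c + 4) * Real.log n))) ≤ ENNReal.ofReal ((n : ℝ) ^ (-c)) := by
  have hn0 : (0 : ℝ) < n := by exact_mod_cast (by omega : 0 < n)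
  have h1 : k ^ 2 * (2 * (n + 4 * L)) + 2 ≤ n ^ 4 := by
    calc k ^ 2 * (2 * (n + 4 * L)) + 2 ≤ n ^ 2 * (2 * (n + 4 * n)) + n ^ 3 := by
          have : 2 ≤ n ^ 3 := by nlinarith [Nat.pow_le_pow_left hn 3]
          gcongr
      _ = 11 * n ^ 3 := by ring
      _ ≤ n * n ^ 3 := Nat.mul_le_mul_right _ (by omega)
      _ = n ^ 4 := by ring
  have h2 : Real.exp (-((c + 4) * Real.log n)) = (n : ℝ) ^ (-c) / (n : ℝ) ^ 4 := by
    rw [eq_div_iff (by positivity), ← Real.rpow_natCast, Real.rpow_def_of_pos hn0,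
      Real.rpow_def_of_pos hn0, ← Real.exp_add]
    congr 1; push_cast; ring
  rw [← ENNReal.ofReal_natCast, ← ENNReal.ofReal_mul (Nat.cast_nonneg _), h2]
  refine ENNReal.ofReal_le_ofReal ?_
  rw [← mul_div_assoc, div_le_iff₀ (by positivity), mul_comm]
  exact mul_le_mul_of_nonneg_left (by exact_mod_cast h1) (by positivity)

end

end SRHG

end

open SRHG in
theorem mainTheorem8 (γ : ℝ) (hγ : 2 ≤ γ) (C₀ : ℝ) (κ : ℕ) (hκ : 1 ≤ κ) (c : ℝ) (hc : 0 < c) :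
    ∃ K : ℝ, 0 < K ∧ ∃ n₀ : ℕ, ∀ n : ℕ, n₀ ≤ n → ∀ C : ℝ, C ≤ C₀ →
      Real.log 2 ≤ (γ - 1) / 2 * (2 * Real.log n + C) →
      SRHG.sampleLaw (SRHG.rhgParams n γ C κ) {ω |
        ¬ (((SRHG.generator (SRHG.rhgParams n γ C κ) ω).time : ℝ) ≤
              K * SRHG.numEdges (SRHG.rhgParams n γ C κ) ω ∧
            ((SRHG.generator (SRHG.rhgParams n γ C κ) ω).steps .clique : ℝ) ≤
              K * SRHG.numEdges (SRHG.rhgParams n γ C κ) ω ∧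
            ((SRHG.generator (SRHG.rhgParams n γ C κ) ω).steps .selection : ℝ) ≤
              K * SRHG.numEdges (SRHG.rhgParams n γ C κ) ω ∧
            ((SRHG.generator (SRHG.rhgParams n γ C κ) ω).steps .check : ℝ) ≤
              K * SRHG.numEdges (SRHG.rhgParams n γ C κ) ω)} ≤
        ENNReal.ofReal ((n : ℝ) ^ (-c)) := by
  set α := (γ - 1) / 2 with hα
  have hα0 : 0 < α := by rw [hα]; linarith
  have hrc := reachConst_nonneg hα0
  have hac := adjConst_pos hα0
  have hpi := Real.pi_pos
  -- Chosen for `n * exp (-R/2) = exp (-C/2) ≥ exp (-C₀/2) = 64 q`.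
  set q := Real.exp (-(C₀ / 2)) / 64 with hq
  have hq0 : 0 < q := by positivity
  set X := α * (2 + |C₀|) / Real.log 2 with hX
  have hl2 := Real.log_pos one_lt_two
  have hX0 : 0 ≤ X := by positivity
  -- Since `k ≤ X log n`, `L ≤ 3 log n` and `s = (c + 4) log n`, the total error `k² (64 L s)²` is
  -- at most `Y log⁶ n`. Lower powers of `log n ≥ 1` are also bounded by the sixth.
  set Y := X ^ 2 * (64 * 3 * (c + 4)) ^ 2 with hY
  refine ⟨((15 + 5 * (18 + reachConst α + 16 * κ)) / q + (2 + 5 * reachConst α)) *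
        (32 * Real.pi / adjConst α), by positivity, ?_⟩
  have hev := (eventually_log_pow_le X).and ((eventually_log_pow_le (X * (c + 4))).and
    ((eventually_log_pow_le (8 * (c + 4))).and ((eventually_log_pow_le Y).and
    ((eventually_log_pow_le (Y * (16 * Real.pi / adjConst α / q))).and
    (Filter.eventually_ge_atTop 20)))))
  obtain ⟨n₀, hn₀⟩ := Filter.eventually_atTop.1 hev
  refine ⟨n₀, fun n hn C hC hlog2 => ?_⟩
  obtain ⟨e1, e2, e3, e4, e5, h20⟩ := hn₀ n hn
  set p := rhgParams n γ C κ with hp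
  have hv : p.Valid := ⟨hα0, hlog2⟩
  have hn0 : (0 : ℝ) < n := by exact_mod_cast (by omega : 0 < n)
  have hy : 1 ≤ Real.log n := by
    rw [Real.le_log_iff_exp_le hn0]
    have : (20 : ℝ) ≤ n := by exact_mod_cast h20
    linarith [Real.exp_one_lt_d9]
  have hk := numAnnuli_rhgParams_le hγ hC hv hy
  have hLy := natLog_add_one_le hy
  have hp16 : ∀ i ≤ 6, Real.log n ^ i ≤ Real.log n ^ 6 := fun i hi => pow_le_pow_right₀ hy hi
  set y := Real.log n with hydef
  set L := Nat.log 2 n + 1 with hL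
  set s := (c + 4) * y with hs
  have hkX : (numAnnuli p : ℝ) ≤ X * y := hk
  have hk0 : (0 : ℝ) ≤ numAnnuli p := Nat.cast_nonneg _
  have hs1 : 1 ≤ s := by rw [hs]; nlinarith
  have hkn : (numAnnuli p : ℝ) ≤ n := by
    have := mul_le_mul_of_nonneg_left (hp16 1 (by norm_num)) hX0
    rw [pow_one] at this
    linarith
  have hLn : L ≤ n := Nat.succ_le_of_lt (Nat.log_lt_self 2 (by omega))
  have hks : numAnnuli p * s ≤ n := by
    have h1 : numAnnuli p * s ≤ X * y * s := mul_le_mul_of_nonneg_right hkX (by linarith)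
    have h2 := mul_le_mul_of_nonneg_left (hp16 2 (by norm_num))
      (by positivity : 0 ≤ X * (c + 4))
    have h3 : X * y * s = X * (c + 4) * y ^ 2 := by rw [hs]; ring
    linarith
  have hs8 : 8 * s ≤ n := by
    have h2 := mul_le_mul_of_nonneg_left (hp16 1 (by norm_num)) (by positivity : 0 ≤ 8 * (c + 4))
    rw [pow_one] at h2
    rw [hs]
    linarith
  have hΛ : (numAnnuli p : ℝ) ^ 2 * (64 * L * s) ^ 2 ≤ Y * y ^ 6 := by
    have h1 : (numAnnuli p : ℝ) ^ 2 ≤ (X * y) ^ 2 := pow_le_pow_left₀ hk0 hkX 2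
    have h2 : (64 * L * s) ^ 2 ≤ (64 * (3 * y) * s) ^ 2 := by
      refine pow_le_pow_left₀ (by positivity) ?_ 2
      gcongr
    calc _ ≤ (X * y) ^ 2 * (64 * (3 * y) * s) ^ 2 := mul_le_mul h1 h2 (sq_nonneg _) (sq_nonneg _)
      _ = Y * y ^ 6 := by rw [hY, hs]; ring
  have hΛ2 : (numAnnuli p : ℝ) ^ 2 * (64 * L * s) ^ 2 ≤
      adjConst α / (16 * Real.pi) * (q * n) := by
    refine hΛ.trans ?_
    have h1 := mul_le_mul_of_nonneg_left e5 (by positivity : 0 ≤ adjConst α / (16 * Real.pi) * q)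
    have h2 : adjConst α / (16 * Real.pi) * q * (Y * (16 * Real.pi / adjConst α / q) * y ^ 6) =
        Y * y ^ 6 := by field_simp
    linarith
  have hR : 64 * q ≤ n * Real.exp (-(p.R / 2)) := by
    have h1 : (n : ℝ) * Real.exp (-(p.R / 2)) = Real.exp (-(C / 2)) := by
      change (n : ℝ) * Real.exp (-((2 * Real.log n + C) / 2)) = _
      nth_rewrite 1 [← Real.exp_log hn0]
      rw [← Real.exp_add]; congr 1; ring
    rw [h1, hq, mul_div_cancel₀ _ (by norm_num)]
    exact Real.exp_le_exp.2 (by linarith)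
  have hL2 : p.n ≤ 2 ^ L := (Nat.lt_pow_succ_log_self one_lt_two n).le
  refine le_trans (measure_mono ?_) ((typical_tail hv hL2 (Nat.le_add_left 1 _) hs1).trans
    (union_bound_le h20 (by exact_mod_cast hkn) hLn))
  intro ω hω htyp
  refine hω ?_
  have ht := time_le_of_typical hv hκ hq0 htyp (by change 1 ≤ n; omega) hR hkn hks hs8
    (hΛ.trans e4) hΛ2
  have hsteps : ∀ φ, ((generator p ω).steps φ : ℝ) ≤ (generator p ω).time := fun φ => by
    exact_mod_cast steps_le_time _ φ
  exact ⟨ht, (hsteps _).trans ht, (hsteps _).trans ht, (hsteps _).trans ht⟩
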